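/- **Setting.** For $\mathbf X\in\mathbf R^{n\times d}$ with rows $\mathbf x_1^\top,\dots,\mathbf x_n^\top$, $\mathrm{DPP}(\mathbf X)$ is the distribution on subsets $S\subseteq\{1..n\}$ with $\Pr(S)=\det(\mathbf X_S\mathbf X_S^\top)/\det(\mathbf I+\mathbf X\mathbf X^\top)$, where $\mathbf X_S$ consists of the rows of $\mathbf X$ indexed by $S$. A distribution with probability mass function $q$ on a finite set $\Omega$ is an $\epsilon$-approximation of the one with mass function $p$ if $\frac12\sum_{x\in\Omega}|q(x)-p(x)|\le\epsilon$. $\mathbf B\preceq\mathbf C$ means that $\mathbf C-\mathbf B$ is symmetric positive semidefinite. **Algorithm.** Input: $\mathbf X\in\mathbf R^{n\times d}$, $\mathbf A\in\mathbf R^{d\times d}$, numbers $\tilde l=(\tilde l_1,\dots,\tilde l_n)$ and an oracle that returns $i$ with probability $\tilde l_i/\sum_j\tilde l_j$. Compute $(\mathbf I+\mathbf A)^{-1}$, $\det(\mathbf I+\mathbf A)$, $\tilde s=\mathrm{tr}(\mathbf A(\mathbf I+\mathbf A)^{-1})$ and $q=\lceil 2d\tilde s\rceil$; write $l_i=\mathbf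 x_i^\top(\mathbf I+\mathbf A)^{-1}\mathbf x_i$, and let $\widetilde{\mathbf X}$ be the matrix with rows $\sqrt{\tilde s/(l_i(q-\tilde s))}\;\mathbf x_i^\top$. Repeat: sample $K\sim\mathrm{Poisson}(q)$; sample $\sigma_1,\dots,\sigma_K$ i.i.d. with probabilities proportional to $(l_1,\dots,l_n)$, each by rejection sampling (draw $i$ from the oracle, accept it with probability $l_i/(2\tilde l_i)$, else draw again); sample $\mathit{Acc}\sim\mathrm{Bernoulli}\Big(\frac{\det(\mathbf I+\widetilde{\mathbf X}_\sigma^\top\widetilde{\mathbf X}_\sigma)}{C_K\det(\mathbf I+\mathbf A)}\Big)$ with $C_K=\big(\frac q{q-\tilde s}\big)^{K+d}e^{-\tilde s}$; until $\mathit{Acc}$ is true. Then sample $\widetilde S\sim\mathrm{DPP}(\widetilde{\mathbf X}_\sigma)$ and return $\sigma_{\widetilde S}=\{\sigma_i:i\in\widetilde S\}$. The last step uses the following subroutine for $\mathrm{DPP}(\mathbf Y)$, $\mathbf Y\in\mathbf R^{k\times d}$ with rows $\mathbf y_t^\top$. Start with $\mathbf W=(\mathbf I+\mathbf Y^\top\mathbf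 Y)^{-1}$ and $\widetilde S=\emptyset$. For $t=1,\dots,k$ let $\mathbf v=\mathbf W\mathbf y_t$ and $p=\mathbf y_t^\top\mathbf v$; with probability $p$ add $t$ to $\widetilde S$ and replace $\mathbf W$ by $\mathbf W-\mathbf v\mathbf v^\top/p$, otherwise replace $\mathbf W$ by $\mathbf W+\mathbf v\mathbf v^\top/(1-p)$. All inverses and determinants are computed by successive rank-one updates starting from $\mathbf I$. Running time is the number of steps on a unit-cost real RAM: an operation $+,-,\times,/,\sqrt{\cdot},\exp,\lceil\cdot\rceil$ on reals, a write of an array entry, an oracle call and a Bernoulli draw cost one step each, and a Poisson draw with value $K$ costs $K+1$ steps. **Theorem.** The subroutine returns an exact sample from $\mathrm{DPP}(\mathbf Y)$, for every $k,d$ and $\mathbf Y\in\mathbf R^{k\times d}$. Moreover there are absolute constants $C_0\ge0$ and $c>0$ such that the following holds for all $n\ge1$ and $d$. Let $\epsilon\in[0,1]$, $C\ge0$, let $\mathbf X\in\mathbf R^{n\times d}$ have non-zero rows, and suppose that $$(1-\eta)\mathbf X^\top\mathbf X\preceq\mathbf A\preceq(1+\eta)\mathbf X^\top\mathbf X\quad\text{for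 }\ \eta=\frac{\epsilon}{4\bar s+C\ln(9/\epsilon)},$$ $$\tfrac12\,\mathbf x_i^\top(\mathbf I+\mathbf A)^{-1}\mathbf x_i\le\tilde l_i\le\tfrac32\,\mathbf x_i^\top(\mathbf I+\mathbf A)^{-1}\mathbf x_i\quad\text{for all }\ i\in\{1..n\},$$ where $\bar s=\max\{1,\mathbb E|S|\}$ for $S\sim\mathrm{DPP}(\mathbf X)$, and $\eta=0$ if $\epsilon=0$. Then $\bar s\le d$, and: 1. The algorithm returns $\sigma_{\widetilde S}\sim\mathrm{DPP}(\rho\mathbf X)$ for some $\rho$ with $|\rho-1|\le\eta$, and $\big|\mathbb E|\sigma_{\widetilde S}|-\mathbb E|S|\big|\le\epsilon$. 2. If $C\ge C_0$, then the distribution of $\sigma_{\widetilde S}$ is an $\epsilon$-approximation of $\mathrm{DPP}(\mathbf X)$. 3. For every $\delta\in(0,\frac12]$, with probability at least $1-\delta$ the algorithm halts within $c\,d^3\,\bar s\,\log^2(1/\delta)$ steps. -/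

import Mathlib

open scoped ENNReal

noncomputable section

namespace DPP

/-! ### Determinantal point processes -/

/-- The probability of `S` under `DPP(X)`, where the rows of `X` are indexed by `Fin n`:
`det (X_S X_Sᵀ) / det (I + X Xᵀ)`. -/
def dpp {n d : ℕ} (X : Matrix (Fin n) (Fin d) ℝ) (S : Finset (Fin n)) : ℝ :=
  (X.submatrix (fun i : S => (i : Fin n)) id *
      (X.submatrix (fun i : S => (i : Fin n)) id).transpose).det /
    (1 + X * X.transpose).det

/-- The expected size `𝔼|S|` of `S ∼ DPP(X)`. -/
def dppSize {n d : ℕ} (X : Matrix (Fin n) (Fin d) ℝ) : ℝ :=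
  ∑ S : Finset (Fin n), (S.card : ℝ) * dpp X S

/-- `s̄ = max {1, 𝔼|S|}` for `S ∼ DPP(X)`. -/
def sBar {n d : ℕ} (X : Matrix (Fin n) (Fin d) ℝ) : ℝ := max 1 (dppSize X)

/-- `η = ε / (4 s̄ + C ln (9 / ε))`; for `ε = 0` this is `0`. -/
def eta {n d : ℕ} (X : Matrix (Fin n) (Fin d) ℝ) (ε C : ℝ) : ℝ :=
  ε / (4 * sBar X + C * Real.log (9 / ε))

/-- `l_i = x_iᵀ (I + A)⁻¹ x_i`, where `x_iᵀ` is the `i`-th row of `X`. -/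
def ridgeScore {n d : ℕ} (X : Matrix (Fin n) (Fin d) ℝ) (A : Matrix (Fin d) (Fin d) ℝ)
    (i : Fin n) : ℝ :=
  X i ⬝ᵥ ((1 + A)⁻¹.mulVec (X i))

/-- Total variation distance of two mass functions on a finite domain. -/
def tvDist {Ω : Type} [Fintype Ω] (q p : Ω → ℝ) : ℝ := 1 / 2 * ∑ x, |q x - p x|

/-! ### Deterministic computations with a step count

The cost model is the unit-cost real RAM: each of the arithmetic operations
`+, -, *, /, √, exp, ⌈·⌉` on real numbers costs one step, and so does each write of an array entry.
The programs below obtain new real numbers only through these operations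
(apart from numerical constants and the dimensions). Reading operands, loop control and the
handling of row indices are part of the step that they accompany: every pass of a loop contains
at least one charged step, and every sampled row index has been charged for. -/

/-- A value together with the number of steps spent on computing it. -/
structure Timed (α : Type) where
  val : α
  time : ℕ

namespace Timed

instance : Monad Timed where
  pure a := ⟨a, 0⟩
  bind x f := ⟨(f x.val).val, x.time + (f x.val).time⟩

def add (x y : ℝ) : Timed ℝ := ⟨x + y, 1⟩
def sub (x y : ℝ) : Timed ℝ := ⟨x - y, 1⟩
def mul (x y : ℝ) : Timed ℝ := ⟨x * y, 1⟩
def div (x y : ℝ) : Timed ℝ := ⟨x / y, 1⟩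
def sqrt (x : ℝ) : Timed ℝ := ⟨Real.sqrt x, 1⟩
def exp (x : ℝ) : Timed ℝ := ⟨Real.exp x, 1⟩
def ceil (x : ℝ) : Timed ℝ := ⟨(⌈x⌉ : ℝ), 1⟩

/-- Compute the entries `f 0, f 1, …` one after the other and write them into an array. -/
def array {k : ℕ} {α : Type} (f : Fin k → Timed α) : Timed (Fin k → α) :=
  ⟨fun i => (f i).val, ∑ i, ((f i).time + 1)⟩

/-- Compute the numbers `f 0, f 1, …` one after the other and add each one to a running sum. -/
def sum {k : ℕ} (f : Fin k → Timed ℝ) : Timed ℝ :=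
  ⟨∑ i, (f i).val, ∑ i, ((f i).time + 1)⟩

/-- `x ^ k` by repeated multiplication. -/
def pow (x : ℝ) : ℕ → Timed ℝ
  | 0 => pure 1
  | k + 1 => do
    let y ← pow x k
    mul y x

def dot {d : ℕ} (u v : Fin d → ℝ) : Timed ℝ := sum fun i => mul (u i) (v i)

def mulVec {d : ℕ} (W : Matrix (Fin d) (Fin d) ℝ) (v : Fin d → ℝ) : Timed (Fin d → ℝ) :=
  array fun i => dot (W i) v

def vecMul {d : ℕ} (v : Fin d → ℝ) (W : Matrix (Fin d) (Fin d) ℝ) : Timed (Fin d → ℝ) :=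
  array fun j => dot v fun i => W i j

/-- `W - a bᵀ / c`. -/
def subOuter {d : ℕ} (W : Matrix (Fin d) (Fin d) ℝ) (a b : Fin d → ℝ) (c : ℝ) :
    Timed (Matrix (Fin d) (Fin d) ℝ) :=
  array fun i => array fun j => do
    let t ← mul (a i) (b j)
    let t ← div t c
    sub (W i j) t

/-- The identity matrix. -/
def idMatrix (d : ℕ) : Timed (Matrix (Fin d) (Fin d) ℝ) :=
  array fun i => array fun j => pure (if i = j then 1 else 0)

/-- Rank-one update: from `(M⁻¹, det M)` to `((M + u vᵀ)⁻¹, det (M + u vᵀ))`, by the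
Sherman–Morrison formula and the matrix determinant lemma. -/
def rankOne {d : ℕ} (W : Matrix (Fin d) (Fin d) ℝ) (D : ℝ) (u v : Fin d → ℝ) :
    Timed (Matrix (Fin d) (Fin d) ℝ × ℝ) := do
  let a ← mulVec W u
  let b ← vecMul v W
  let t ← dot v a
  let c ← add 1 t
  let D' ← mul D c
  let W' ← subOuter W a b c
  return (W', D')

/-- The inverse and the determinant of `I + ∑ t, (u t) (v t)ᵀ`. -/
def invDet {k d : ℕ} (u v : Fin k → Fin d → ℝ) : Timed (Matrix (Fin d) (Fin d) ℝ × ℝ) := do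
  let I ← idMatrix d
  (List.finRange k).foldlM (fun s t => rankOne s.1 s.2 (u t) (v t)) (I, 1)

/-- The inverse and the determinant of `I + A`, as `A` is the sum of `e_i A_i` over its rows
`A_i`. -/
def invDetOneAdd {d : ℕ} (A : Matrix (Fin d) (Fin d) ℝ) :
    Timed (Matrix (Fin d) (Fin d) ℝ × ℝ) := do
  let E ← idMatrix d
  invDet E A

/-- `tr (A W)`. -/
def traceMul {d : ℕ} (A W : Matrix (Fin d) (Fin d) ℝ) : Timed ℝ :=
  sum fun i => dot (A i) fun j => W j i

/-- `xᵀ W x`. -/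
def quadForm {d : ℕ} (W : Matrix (Fin d) (Fin d) ℝ) (x : Fin d → ℝ) : Timed ℝ := do
  let y ← mulVec W x
  dot x y

end Timed

/-! ### Randomized computations with a step count -/

/-- A randomized computation, given by its (discrete) joint law of output and running time:
`p a c` is the probability that the computation halts with output `a` after exactly `c` steps.
The total mass is the probability of halting. -/
def RandComp (α : Type) : Type := α → ℕ → ℝ≥0∞

namespace RandComp

open Classical in
/-- Sequential composition: outputs are passed on and running times add up. -/
instance : Monad RandComp where
  pure a := fun b c => if b = a ∧ c = 0 then 1 else 0
  bind p f := fun b c => ∑' a, ∑ k ∈ Finset.HasAntidiagonal.antidiagonal c, p a k.1 * f a b k.2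

open Classical in
/-- A deterministic computation. -/
def lift {α : Type} (x : Timed α) : RandComp α :=
  fun a c => if a = x.val ∧ c = x.time then 1 else 0

/-- A Bernoulli variable with parameter `p`, in one step. The computation is stuck, that is, it
has no output, if `p` is not a probability. -/
def bernoulli (p : ℝ) : RandComp Bool :=
  fun b c => if c = 1 ∧ 0 ≤ p ∧ p ≤ 1 then ENNReal.ofReal (if b then p else 1 - p) else 0

/-- A Poisson variable `K` with mean `q`, in `K + 1` steps. -/
def poisson (q : ℝ) : RandComp ℕ :=
  fun k c => if c = k + 1 then ProbabilityTheory.poissonMeasure q.toNNReal {k} else 0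

/-- One call of the sampling oracle for `i ∼ (w_1, …, w_n)`: the index `i` is returned with
probability `w_i / ∑ j, w_j`, in one step. -/
def oracle {n : ℕ} (w : Fin n → ℝ) : RandComp (Fin n) :=
  fun i c => if c = 1 then ENNReal.ofReal (w i / ∑ j, w j) else 0

/-- At most `m` rounds of `body`, until it returns some value; no output if it never does. -/
def rounds {α : Type} (body : RandComp (Option α)) : ℕ → RandComp α
  | 0 => fun _ _ => 0
  | m + 1 => do
    let r ← body
    match r with
    | some a => pure a
    | none => rounds body m

/-- `repeat body until` it returns some value. -/
def loop {α : Type} (body : RandComp (Option α)) : RandComp α := fun a c => ⨆ m, rounds body m a c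

/-- `k` independent runs of `p`. -/
def replicate {α : Type} (p : RandComp α) : (k : ℕ) → RandComp (Fin k → α)
  | 0 => pure Fin.elim0
  | k + 1 => do
    let a ← p
    let f ← replicate p k
    return Fin.cons a f

/-- The law of the output. -/
def law {α : Type} (p : RandComp α) (a : α) : ℝ≥0∞ := ∑' c, p a c

/-- The probability of halting within `B` steps. -/
def haltsWithin {α : Type} (p : RandComp α) (B : ℝ) : ℝ≥0∞ :=
  ∑' a, ∑' c : ℕ, if (c : ℝ) ≤ B then p a c else 0

end RandComp

/-! ### The algorithm -/

open Timed RandComp in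
/-- One step of `dppSample`: decide whether the row `y` with label `t` joins the sample `S`, with
probability `yᵀ W y`, and condition `W` on the decision. -/
def dppStep {k d : ℕ} (W : Matrix (Fin d) (Fin d) ℝ) (S : Finset (Fin k)) (t : Fin k)
    (y : Fin d → ℝ) : RandComp (Matrix (Fin d) (Fin d) ℝ × Finset (Fin k)) := do
  let v ← lift (mulVec W y)
  let p ← lift (dot y v)
  let b ← bernoulli p
  if b then
    let W' ← lift (subOuter W v v p)
    return (W', insert t S)
  else
    let c ← lift (sub p 1)
    let W' ← lift (subOuter W v v c)
    return (W', S)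

open Timed RandComp in
/-- Sampling from `DPP(Y)` by the chain rule: the rows are visited one after the other, and
`y_iᵀ W y_j`, with `W = (I + Yᵀ Y)⁻¹` at the start, is the marginal kernel of the remaining rows
conditioned on the decisions made so far. -/
def dppSample {k d : ℕ} (Y : Matrix (Fin k) (Fin d) ℝ) : RandComp (Finset (Fin k)) := do
  let M ← lift (invDet Y Y)
  let r ← (List.finRange k).foldlM (fun s t => dppStep s.1 s.2 t (Y t)) (M.1, ∅)
  return r.2

open Timed RandComp in
/-- An exact sample `i ∼ (l_1, …, l_n)`, where `l_i = x_iᵀ W x_i`, by rejection sampling from the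
oracle for `lt`: the proposal `i` is accepted with probability `l_i / (2 lt_i)`. The number `l_i`
is returned along with `i`. -/
def rowSample {n d : ℕ} (X : Matrix (Fin n) (Fin d) ℝ) (lt : Fin n → ℝ)
    (W : Matrix (Fin d) (Fin d) ℝ) : RandComp (Fin n × ℝ) :=
  loop do
    let i ← oracle lt
    let l ← lift (quadForm W (X i))
    let t ← lift (mul 2 (lt i))
    let p ← lift (div l t)
    let acc ← bernoulli p
    return if acc then some (i, l) else none

open Timed in
/-- The matrix with the rows `√(s / (l_t (q - s))) x_{σ_t}`, for `t = 1, …, K`, where `smp` lists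
the pairs `(σ_t, l_t)`. -/
def rescaledRows {n d K : ℕ} (X : Matrix (Fin n) (Fin d) ℝ) (s q : ℝ)
    (smp : Fin K → Fin n × ℝ) : Timed (Matrix (Fin K) (Fin d) ℝ) :=
  array fun t => do
    let r ← sub q s
    let r ← mul (smp t).2 r
    let r ← div s r
    let r ← sqrt r
    array fun j => mul r (X (smp t).1 j)

open Timed in
/-- `C_K = (q / (q - s)) ^ (K + d) * e ^ (-s)`. -/
def constC (s q : ℝ) (K d : ℕ) : Timed ℝ := do
  let r ← sub q s
  let r ← div q r
  let r ← pow r (K + d)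
  let m ← sub 0 s
  let e ← exp m
  mul r e

open Timed RandComp in
/-- One round of the main `repeat` loop. The arguments are `W = (I + A)⁻¹`, `D = det (I + A)`,
`s = tr (A (I + A)⁻¹)` and `q = ⌈2 d s⌉`; the output on acceptance is the length `K`, the sequence
`σ` and the matrix of its rescaled rows. -/
def mainRound {n d : ℕ} (X : Matrix (Fin n) (Fin d) ℝ) (lt : Fin n → ℝ)
    (W : Matrix (Fin d) (Fin d) ℝ) (D s q : ℝ) :
    RandComp (Option ((K : ℕ) × (Fin K → Fin n) × Matrix (Fin K) (Fin d) ℝ)) := do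
  let K ← poisson q
  let smp ← replicate (rowSample X lt W) K
  let Y ← lift (rescaledRows X s q smp)
  let M ← lift (invDet Y Y)
  let cK ← lift (constC s q K d)
  let den ← lift (mul cK D)
  let p ← lift (div M.2 den)
  let acc ← bernoulli p
  return if acc then some ⟨K, fun t => (smp t).1, Y⟩ else none

open Timed RandComp in
/-- Fast DPP sampling from `X`, `A` and the oracle for `lt`. The output is the set
`{σ_t : t ∈ S}` with `S ∼ DPP` of the matrix of the rescaled rows. -/
def fastDPP {n d : ℕ} (X : Matrix (Fin n) (Fin d) ℝ) (A : Matrix (Fin d) (Fin d) ℝ)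
    (lt : Fin n → ℝ) : RandComp (Finset (Fin n)) := do
  let M ← lift (invDetOneAdd A)
  let s ← lift (traceMul A M.1)
  let t ← lift (mul 2 d)
  let t ← lift (mul t s)
  let q ← lift (ceil t)
  let r ← loop (mainRound X lt M.1 M.2 s q)
  let S ← dppSample r.2.2
  return S.image r.2.1

end DPP

end

/-! Write `W = (I + A)⁻¹`, `G = Xᵀ X`, `s = tr (A W)` and `L = ∑ l_i = tr (W G)`.

Law of the output. In an accepted round the determinant in the acceptance probability cancels the
normalization of the final DPP step, so a set `T` of positions contributes the minor of its rescaled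
rows. In this minor the factors `s / (l_i (q - s))` cancel the sampling probabilities `l_i / L` up
to a constant. Repeated rows give a zero minor, and a set `S` of size `k` is listed by `k!`
sequences; with the `K.choose k` choices of `T`, the weight `det (X_S X_Sᵀ)` gets the factor `K (K -
1) ⋯ (K - k + 1) (s / (L (q - s)))^k`. Division by `C_K` turns Poisson(q) into Poisson(q - s), up to
a factor free of `K`, and its factorial moment `(q - s)^k` leaves `(s / L)^k det (X_S X_Sᵀ)`. This
is the weight of DPP(√(s/L) X) (`expect_one_mainRound_dppSample`). The Loewner bounds on `A` give
`|s / L - 1| ≤ η`, and a comparison of normalizing constants along the eigenvalues of `G` bounds the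
total variation distance by `(4/3) η 𝔼|S| ≤ ε / 3` (`tvDist_le`).

Acceptance. The tangent bound for `log det` (`det_le_det_mul_exp`) shows that the acceptance
probability is at most 1. The same bound, with `η s̄ ≤ 1/4` and `q ≥ 2 d s`, shows that a round
succeeds with probability at least 1/4.

Subroutine. The rank-one update of `W` takes the Schur complement of the marginal kernel of the
remaining rows (`gram_condition`), and the product of the pivots is the determinant of a matrix that
mixes rows of the kernel and of its complement.

Time. `expect z p f` is `𝔼 z^T f`. It nests under composition and equals `α / (1 - β)` for a loop
whose rounds have accepted part `α` and rejected part `β` (`expect_loop`). At `z = 1` it gives laws.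
At `z = e^θ` with `θ = 1 / (40000 d³ s̄)` it bounds `𝔼 z^T` by 18, and Markov's inequality bounds
the tail. -/

noncomputable section

namespace DPP

/-! ### Generating functions of randomized computations. -/

namespace RandComp

/-- The expectation of `z ^ T * f a`, over the event of halting, for a randomized computation with
output `a` and running time `T`. -/
def expect {α : Type} (z : ℝ≥0∞) (p : RandComp α) (f : α → ℝ≥0∞) : ℝ≥0∞ :=
  ∑' a, ∑' c, p a c * z ^ c * f a

variable {α β : Type} {z : ℝ≥0∞}

theorem law_eq_expect [DecidableEq α] (p : RandComp α) (a : α) :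
    p.law a = expect 1 p fun b => if b = a then 1 else 0 := by
  unfold law expect
  rw [tsum_eq_single a]
  · simp
  · intro b hb; simp [hb]

theorem expect_mono (p : RandComp α) {f g : α → ℝ≥0∞} (h : ∀ a, f a ≤ g a) :
    expect z p f ≤ expect z p g :=
  ENNReal.tsum_le_tsum fun a => ENNReal.tsum_le_tsum fun _ => mul_le_mul_right (h a) _

theorem expect_one_le (hz : 1 ≤ z) (p : RandComp α) (f : α → ℝ≥0∞) :
    expect 1 p f ≤ expect z p f := by
  refine ENNReal.tsum_le_tsum fun a => ENNReal.tsum_le_tsum fun c => ?_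
  gcongr

theorem expect_add (p : RandComp α) (f g : α → ℝ≥0∞) :
    expect z p (fun a => f a + g a) = expect z p f + expect z p g := by
  simp only [expect, mul_add, ENNReal.tsum_add]

theorem expect_mul_const (p : RandComp α) (f : α → ℝ≥0∞) (r : ℝ≥0∞) :
    expect z p (fun a => f a * r) = expect z p f * r := by
  simp only [expect, ← mul_assoc, ENNReal.tsum_mul_right]

theorem expect_const (p : RandComp α) (r : ℝ≥0∞) :
    expect z p (fun _ => r) = expect z p (fun _ => 1) * r := by
  rw [← expect_mul_const]; simp

open Classical in
theorem expect_pure (a : α) (f : α → ℝ≥0∞) : expect z (pure a : RandComp α) f = f a := by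
  change ∑' b, ∑' c, (if b = a ∧ c = 0 then 1 else 0) * z ^ c * f b = _
  rw [tsum_eq_single a, tsum_eq_single 0]
  · simp
  · intro c hc; simp [hc]
  · intro b hb; simp [hb]

theorem expect_lift (x : Timed α) (f : α → ℝ≥0∞) :
    expect z (lift x) f = z ^ x.time * f x.val := by
  unfold expect lift
  rw [tsum_eq_single x.val, tsum_eq_single x.time]
  · simp
  · intro c hc; simp [hc]
  · intro b hb; simp [hb]

theorem tsum_sum_antidiagonal (F : ℕ → ℕ → ℝ≥0∞) :
    ∑' c, ∑ k ∈ Finset.HasAntidiagonal.antidiagonal c, F k.1 k.2 = ∑' i, ∑' j, F i j := by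
  rw [← ENNReal.tsum_prod, ← Finset.HasAntidiagonal.sigmaAntidiagonalEquivProd.tsum_eq,
    ENNReal.tsum_sigma']
  refine tsum_congr fun c => ?_
  rw [tsum_fintype, Finset.univ_eq_attach, ← Finset.sum_attach]
  rfl

/-- Running times add under composition and `z ^ (i + j) = z ^ i * z ^ j`, so the convolution over
the antidiagonal becomes a nested expectation. Law and time bound of the algorithm both rest on this
rule. -/
theorem expect_bind (p : RandComp α) (g : α → RandComp β) (f : β → ℝ≥0∞) :
    expect z (p >>= g) f = expect z p fun a => expect z (g a) f := by
  change ∑' b, ∑' c, (∑' a, ∑ k ∈ Finset.HasAntidiagonal.antidiagonal c,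
    p a k.1 * g a b k.2) * z ^ c * f b = _
  have h1 : ∀ b c, (∑' a, ∑ k ∈ Finset.HasAntidiagonal.antidiagonal c,
      p a k.1 * g a b k.2) * z ^ c * f b = ∑' a, ∑ k ∈ Finset.HasAntidiagonal.antidiagonal c,
      (p a k.1 * z ^ k.1) * (g a b k.2 * z ^ k.2 * f b) := by
    intro b c
    rw [← ENNReal.tsum_mul_right, ← ENNReal.tsum_mul_right]
    refine tsum_congr fun a => ?_
    rw [Finset.sum_mul, Finset.sum_mul]
    refine Finset.sum_congr rfl fun k hk => ?_
    rw [← Finset.HasAntidiagonal.mem_antidiagonal.1 hk, pow_add]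
    ring
  simp_rw [h1]
  have h2 : ∀ b, ∑' c, ∑' a, ∑ k ∈ Finset.HasAntidiagonal.antidiagonal c,
      (p a k.1 * z ^ k.1) * (g a b k.2 * z ^ k.2 * f b) =
      ∑' a, ∑' i, ∑' j, (p a i * z ^ i) * (g a b j * z ^ j * f b) := by
    intro b
    rw [ENNReal.tsum_comm]
    exact tsum_congr fun a =>
      tsum_sum_antidiagonal fun i j => (p a i * z ^ i) * (g a b j * z ^ j * f b)
  simp_rw [h2, ENNReal.tsum_mul_left]
  rw [ENNReal.tsum_comm]
  unfold expect
  refine tsum_congr fun a => ?_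
  rw [ENNReal.tsum_comm]
  refine tsum_congr fun i => ?_
  rw [ENNReal.tsum_mul_left]

theorem expect_bernoulli {p : ℝ} (h0 : 0 ≤ p) (h1 : p ≤ 1) (f : Bool → ℝ≥0∞) :
    expect z (bernoulli p) f =
      z * (ENNReal.ofReal p * f true + ENNReal.ofReal (1 - p) * f false) := by
  unfold expect bernoulli
  have : ∀ b, ∑' c, (if c = 1 ∧ 0 ≤ p ∧ p ≤ 1 then ENNReal.ofReal (if b then p else 1 - p) else 0)
      * z ^ c * f b = ENNReal.ofReal (if b then p else 1 - p) * z * f b := by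
    intro b
    rw [tsum_eq_single 1]
    · simp [h0, h1]
    · intro c hc; simp [hc]
  simp_rw [this]
  rw [tsum_fintype, Fintype.sum_bool]
  simp
  ring

/-- A stuck computation has mass zero, so time bounds need not know that `p` is a probability. -/
theorem expect_bernoulli_le (p : ℝ) {f : Bool → ℝ≥0∞} {M : ℝ≥0∞} (hf : ∀ b, f b ≤ M) :
    expect z (bernoulli p) f ≤ z * M := by
  by_cases h : 0 ≤ p ∧ p ≤ 1
  · rw [expect_bernoulli h.1 h.2]
    gcongr
    calc _ ≤ ENNReal.ofReal p * M + ENNReal.ofReal (1 - p) * M := by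
          gcongr <;> apply hf
      _ = M := by
          rw [← add_mul, ← ENNReal.ofReal_add h.1 (by linarith)]
          simp
  · simp [expect, bernoulli, h]

theorem expect_poisson (q : ℝ) (f : ℕ → ℝ≥0∞) :
    expect z (poisson q) f =
      ∑' k, ProbabilityTheory.poissonMeasure q.toNNReal {k} * z ^ (k + 1) * f k := by
  unfold expect poisson
  refine tsum_congr fun k => ?_
  rw [tsum_eq_single (k + 1)]
  · simp
  · intro c hc; simp [hc]

theorem expect_oracle {n : ℕ} (w : Fin n → ℝ) (f : Fin n → ℝ≥0∞) :
    expect z (oracle w) f = z * ∑ i, ENNReal.ofReal (w i / ∑ j, w j) * f i := by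
  unfold expect oracle
  rw [tsum_fintype, Finset.mul_sum]
  refine Finset.sum_congr rfl fun k _ => ?_
  rw [tsum_eq_single 1]
  · simp; ring
  · intro c hc; simp [hc]

theorem rounds_zero (body : RandComp (Option α)) : rounds body 0 = fun _ _ => 0 := by
  rw [rounds]

/-- The test function `r.elim 0 f` sees only accepted rounds and `r.elim 1 fun _ => 0` only rejected
ones; after a rejection the loop starts afresh. -/
theorem expect_rounds_succ (body : RandComp (Option α)) (m : ℕ) (f : α → ℝ≥0∞) :
    expect z (rounds body (m + 1)) f =
      expect z body (fun r => r.elim 0 f) +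
        expect z body (fun r => r.elim 1 fun _ => 0) * expect z (rounds body m) f := by
  rw [rounds, expect_bind, ← expect_mul_const, ← expect_add]
  congr 1
  funext r
  cases r with
  | none => simp
  | some a => simp [expect_pure]

theorem rounds_mono (body : RandComp (Option α)) (a : α) (c : ℕ) :
    Monotone fun m => rounds body m a c := by
  refine monotone_nat_of_le_succ fun m => ?_
  induction m generalizing a c with
  | zero => rw [rounds_zero]; exact zero_le
  | succ m ih =>
    rw [rounds, rounds]
    refine ENNReal.tsum_le_tsum fun r => Finset.sum_le_sum fun k _ => mul_le_mul_right ?_ _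
    cases r with
    | none => exact ih a k.2
    | some a => exact le_rfl

theorem expect_loop_eq_iSup (body : RandComp (Option α)) (f : α → ℝ≥0∞) :
    expect z (loop body) f = ⨆ m, expect z (rounds body m) f := by
  unfold expect loop
  have hm : ∀ a c, Monotone fun m => rounds body m a c * z ^ c * f a := by
    intro a c m m' h
    have h1 : rounds body m a c ≤ rounds body m' a c := rounds_mono body a c h
    dsimp only
    gcongr
  have hm' : ∀ a, Monotone fun m => ∑' c, rounds body m a c * z ^ c * f a :=
    fun a m m' h => ENNReal.tsum_le_tsum fun c => hm a c h
  -- Monotone convergence for the counting measure.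
  have key : ∀ {ι : Type} (F : ι → ℕ → ℝ≥0∞), (∀ i, Monotone (F i)) →
      ∑' i, ⨆ m, F i m = ⨆ m, ∑' i, F i m := by
    intro ι F hF
    let _ : MeasurableSpace ι := ⊤
    simp only [← MeasureTheory.lintegral_count]
    exact MeasureTheory.lintegral_iSup (fun n => measurable_from_top)
      fun m m' h i => hF i h
  rw [← key _ hm']
  refine tsum_congr fun a => ?_
  rw [← key _ (hm a)]
  refine tsum_congr fun c => ?_
  rw [ENNReal.iSup_mul, ENNReal.iSup_mul]

/-- A geometric series in the rejected part. In `[0, ∞]` it needs no convergence hypothesis: if the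
rejected part is at least 1, truncated subtraction gives `0⁻¹ = ⊤`, which is the sum of the series.
-/
theorem expect_loop (body : RandComp (Option α)) (f : α → ℝ≥0∞) :
    expect z (loop body) f =
      expect z body (fun r => r.elim 0 f) *
        (1 - expect z body (fun r => r.elim 1 fun _ => 0))⁻¹ := by
  rw [expect_loop_eq_iSup, ← ENNReal.tsum_geometric, ENNReal.tsum_eq_iSup_nat,
    ENNReal.mul_iSup]
  refine iSup_congr fun m => ?_
  induction m with
  | zero => simp [rounds_zero, expect]
  | succ m ih =>
    rw [expect_rounds_succ, ih, Finset.sum_range_succ', pow_zero]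
    simp only [pow_succ, ← Finset.sum_mul]
    ring

/-- If a round halts almost surely, the output of the loop is the output of a round conditioned on
success. -/
theorem expect_one_loop (body : RandComp (Option α)) (h : expect 1 body (fun _ => 1) = 1)
    (f : α → ℝ≥0∞) :
    expect 1 (loop body) f = expect 1 body (fun r => r.elim 0 f) /
      expect 1 body (fun r => r.elim 0 fun _ => 1) := by
  have h1 : expect 1 body (fun r => r.elim 0 fun _ => 1) +
      expect 1 body (fun r => r.elim 1 fun _ => 0) = 1 := by
    rw [← expect_add]
    refine Eq.trans ?_ h
    congr 1
    funext r
    cases r <;> simp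
  rw [expect_loop, div_eq_mul_inv]
  congr 2
  refine (ENNReal.eq_sub_of_add_eq ?_ h1).symm
  exact ne_top_of_le_ne_top ENNReal.one_ne_top (le_add_self.trans h1.le)

/-- The law of one run is assumed to sit on the `n` points `g i`. This lets a sampler that returns
an index together with a real number be treated by a finite sum over sequences of indices. -/
theorem expect_replicate (p : RandComp α) {n : ℕ} (w : Fin n → ℝ≥0∞) (g : Fin n → α)
    (h : ∀ f, expect z p f = ∑ i, w i * f (g i)) (k : ℕ) (f : (Fin k → α) → ℝ≥0∞) :
    expect z (replicate p k) f = ∑ σ : Fin k → Fin n, (∏ t, w (σ t)) * f fun t => g (σ t) := by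
  induction k with
  | zero =>
    rw [replicate, expect_pure, Fintype.sum_unique]
    simp only [Finset.univ_eq_empty, Finset.prod_empty, one_mul]
    congr 1
    exact Subsingleton.elim _ _
  | succ k ih =>
    rw [replicate, expect_bind, h, ← (Fin.consEquiv fun _ : Fin (k + 1) => Fin n).sum_comp,
      Fintype.sum_prod_type]
    refine Finset.sum_congr rfl fun i _ => ?_
    rw [expect_bind, ih, Finset.mul_sum]
    refine Finset.sum_congr rfl fun σ _ => ?_
    rw [expect_pure, Fin.prod_univ_succ]
    simp only [Fin.consEquiv_apply, Fin.cons_zero, Fin.cons_succ]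
    rw [mul_assoc]
    congr 3
    funext t
    refine Fin.cases ?_ (fun t => ?_) t <;> simp

theorem expect_replicate_one (p : RandComp α) (k : ℕ) :
    expect z (replicate p k) (fun _ => 1) = expect z p (fun _ => 1) ^ k := by
  induction k with
  | zero => rw [replicate, expect_pure, pow_zero]
  | succ k ih =>
    rw [replicate, expect_bind, pow_succ, ← ih, mul_comm, ← expect_const p]
    congr 1
    funext a
    rw [expect_bind]
    simp [expect_pure]

/-- Markov's inequality for `z ^ T`. -/
theorem one_le_haltsWithin_add (p : RandComp α) (B : ℝ) (hz : 1 ≤ z) (m : ℕ) (hm : m ≤ B)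
    (hp : expect 1 p (fun _ => 1) = 1) :
    z ^ m ≤ z ^ m * p.haltsWithin B + expect z p fun _ => 1 := by
  have h : z ^ m * expect 1 p (fun _ => 1) ≤
      z ^ m * p.haltsWithin B + expect z p fun _ => 1 := by
    unfold expect haltsWithin
    rw [← ENNReal.tsum_mul_left, ← ENNReal.tsum_mul_left, ← ENNReal.tsum_add]
    refine ENNReal.tsum_le_tsum fun a => ?_
    rw [← ENNReal.tsum_mul_left, ← ENNReal.tsum_mul_left, ← ENNReal.tsum_add]
    refine ENNReal.tsum_le_tsum fun c => ?_
    simp only [one_pow, mul_one]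
    split_ifs with h
    · exact le_self_add
    -- Here the time `c` exceeds `B ≥ m`, so `z ^ m ≤ z ^ c`.
    · rw [mul_zero, zero_add, mul_comm]
      gcongr
      by_contra h'
      exact h (le_trans (by exact_mod_cast (not_le.1 h').le) hm)
  rwa [hp, mul_one] at h

end RandComp

end DPP

/-! ### Deterministic computations: values and costs. -/

namespace DPP

open Matrix

theorem posDef_one_add_transpose_mul_self {m : Type*} [Fintype m] {d : ℕ}
    (Y : Matrix m (Fin d) ℝ) :
    (1 + Y.transpose * Y).PosDef := by
  have := posSemidef_conjTranspose_mul_self Y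
  rw [conjTranspose_eq_transpose_of_trivial] at this
  exact Matrix.PosDef.one.add_posSemidef this

namespace Timed

variable {α β : Type} {d k : ℕ}

@[simp] theorem val_pure (a : α) : (pure a : Timed α).val = a := rfl
@[simp] theorem time_pure (a : α) : (pure a : Timed α).time = 0 := rfl
@[simp] theorem val_bind (x : Timed α) (f : α → Timed β) : (x >>= f).val = (f x.val).val := rfl
@[simp] theorem time_bind (x : Timed α) (f : α → Timed β) :
    (x >>= f).time = x.time + (f x.val).time := rfl
@[simp] theorem val_add (x y : ℝ) : (add x y).val = x + y := rfl
@[simp] theorem time_add (x y : ℝ) : (add x y).time = 1 := rfl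
@[simp] theorem val_sub (x y : ℝ) : (sub x y).val = x - y := rfl
@[simp] theorem time_sub (x y : ℝ) : (sub x y).time = 1 := rfl
@[simp] theorem val_mul (x y : ℝ) : (mul x y).val = x * y := rfl
@[simp] theorem time_mul (x y : ℝ) : (mul x y).time = 1 := rfl
@[simp] theorem val_div (x y : ℝ) : (div x y).val = x / y := rfl
@[simp] theorem time_div (x y : ℝ) : (div x y).time = 1 := rfl
@[simp] theorem val_sqrt (x : ℝ) : (sqrt x).val = Real.sqrt x := rfl
@[simp] theorem time_sqrt (x : ℝ) : (sqrt x).time = 1 := rfl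
@[simp] theorem val_exp (x : ℝ) : (exp x).val = Real.exp x := rfl
@[simp] theorem time_exp (x : ℝ) : (exp x).time = 1 := rfl
@[simp] theorem val_ceil (x : ℝ) : (ceil x).val = (⌈x⌉ : ℝ) := rfl
@[simp] theorem time_ceil (x : ℝ) : (ceil x).time = 1 := rfl
@[simp] theorem val_array (f : Fin k → Timed α) : (array f).val = fun i => (f i).val := rfl
theorem time_array (f : Fin k → Timed α) : (array f).time = ∑ i, ((f i).time + 1) := rfl
@[simp] theorem val_sum (f : Fin k → Timed ℝ) : (sum f).val = ∑ i, (f i).val := rfl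
theorem time_sum (f : Fin k → Timed ℝ) : (sum f).time = ∑ i, ((f i).time + 1) := rfl

@[simp] theorem val_pow (x : ℝ) (m : ℕ) : (pow x m).val = x ^ m := by
  induction m with
  | zero => simp [pow]
  | succ m ih => simp [pow, ih, pow_succ]

@[simp] theorem time_pow (x : ℝ) (m : ℕ) : (pow x m).time = m := by
  induction m with
  | zero => simp [pow]
  | succ m ih => simp [pow, ih]

@[simp] theorem val_dot (u v : Fin d → ℝ) : (dot u v).val = u ⬝ᵥ v := rfl
@[simp] theorem time_dot (u v : Fin d → ℝ) : (dot u v).time = 2 * d := by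
  simp [dot, time_sum, mul_comm]

@[simp] theorem val_mulVec (W : Matrix (Fin d) (Fin d) ℝ) (v : Fin d → ℝ) :
    (mulVec W v).val = W *ᵥ v := rfl
@[simp] theorem time_mulVec (W : Matrix (Fin d) (Fin d) ℝ) (v : Fin d → ℝ) :
    (mulVec W v).time = d * (2 * d + 1) := by
  simp [mulVec, time_array]

@[simp] theorem val_vecMul (W : Matrix (Fin d) (Fin d) ℝ) (v : Fin d → ℝ) :
    (vecMul v W).val = v ᵥ* W := rfl
@[simp] theorem time_vecMul (W : Matrix (Fin d) (Fin d) ℝ) (v : Fin d → ℝ) :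
    (vecMul v W).time = d * (2 * d + 1) := by
  simp [vecMul, time_array]

@[simp] theorem val_subOuter (W : Matrix (Fin d) (Fin d) ℝ) (a b : Fin d → ℝ) (c : ℝ) :
    (subOuter W a b c).val = W - c⁻¹ • vecMulVec a b := by
  ext i j
  simp [subOuter, vecMulVec_apply]
  ring
@[simp] theorem time_subOuter (W : Matrix (Fin d) (Fin d) ℝ) (a b : Fin d → ℝ) (c : ℝ) :
    (subOuter W a b c).time = d * (4 * d + 1) := by
  simp [subOuter, time_array, mul_comm]

@[simp] theorem val_idMatrix : (idMatrix d).val = 1 := by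
  ext i j
  simp [idMatrix, Matrix.one_apply]
@[simp] theorem time_idMatrix : (idMatrix d).time = d * (d + 1) := by
  simp [idMatrix, time_array]

theorem val_rankOne (W : Matrix (Fin d) (Fin d) ℝ) (D : ℝ) (u v : Fin d → ℝ) :
    (rankOne W D u v).val = (W - (1 + v ⬝ᵥ W *ᵥ u)⁻¹ • vecMulVec (W *ᵥ u) (v ᵥ* W),
      D * (1 + v ⬝ᵥ W *ᵥ u)) := by
  simp [rankOne]
@[simp] theorem time_rankOne (W : Matrix (Fin d) (Fin d) ℝ) (D : ℝ) (u v : Fin d → ℝ) :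
    (rankOne W D u v).time = 8 * d ^ 2 + 5 * d + 2 := by
  simp [rankOne]
  ring

@[simp] theorem val_traceMul (A W : Matrix (Fin d) (Fin d) ℝ) :
    (traceMul A W).val = (A * W).trace := rfl
@[simp] theorem time_traceMul (A W : Matrix (Fin d) (Fin d) ℝ) :
    (traceMul A W).time = d * (2 * d + 1) := by
  simp [traceMul, time_sum]

@[simp] theorem val_quadForm (W : Matrix (Fin d) (Fin d) ℝ) (x : Fin d → ℝ) :
    (quadForm W x).val = x ⬝ᵥ W *ᵥ x := rfl
@[simp] theorem time_quadForm (W : Matrix (Fin d) (Fin d) ℝ) (x : Fin d → ℝ) :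
    (quadForm W x).time = 2 * d ^ 2 + 3 * d := by
  simp [quadForm]; ring

theorem time_foldlM_rankOne (u v : Fin k → Fin d → ℝ) (l : List (Fin k))
    (s : Matrix (Fin d) (Fin d) ℝ × ℝ) :
    (l.foldlM (fun s t => rankOne s.1 s.2 (u t) (v t)) s).time =
      l.length * (8 * d ^ 2 + 5 * d + 2) := by
  induction l generalizing s with
  | nil => simp
  | cons t l ih => simp [ih]; ring

@[simp] theorem time_invDet (u v : Fin k → Fin d → ℝ) :
    (invDet u v).time = d * (d + 1) + k * (8 * d ^ 2 + 5 * d + 2) := by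
  simp [invDet, time_foldlM_rankOne]

@[simp] theorem time_invDetOneAdd (A : Matrix (Fin d) (Fin d) ℝ) :
    (invDetOneAdd A).time = d * (d + 1) + (d * (d + 1) + d * (8 * d ^ 2 + 5 * d + 2)) := by
  have h : (invDet (idMatrix d).val A).time = d * (d + 1) + d * (8 * d ^ 2 + 5 * d + 2) :=
    time_invDet _ _
  change (idMatrix d).time + (invDet (idMatrix d).val A).time = _
  rw [h, time_idMatrix]

/-- The Sherman–Morrison formula and the matrix determinant lemma. -/
theorem val_rankOne_inv {M : Matrix (Fin d) (Fin d) ℝ} {u v : Fin d → ℝ} (hM : IsUnit M.det)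
    (hM' : IsUnit (M + vecMulVec u v).det) :
    (rankOne M⁻¹ M.det u v).val = ((M + vecMulVec u v)⁻¹, (M + vecMulVec u v).det) := by
  have hdet : (M + vecMulVec u v).det = M.det * (1 + v ⬝ᵥ M⁻¹ *ᵥ u) := by
    have h1 : M + vecMulVec u v = M * (1 + vecMulVec (M⁻¹ *ᵥ u) v) := by
      rw [mul_add, mul_one, mul_vecMulVec, mulVec_mulVec, mul_nonsing_inv _ hM, one_mulVec]
    rw [h1, det_mul, vecMulVec_eq Unit, det_one_add_replicateCol_mul_replicateRow]
  have hc : 1 + v ⬝ᵥ M⁻¹ *ᵥ u ≠ 0 := by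
    rw [hdet] at hM'
    exact right_ne_zero_of_mul hM'.ne_zero
  rw [val_rankOne, ← hdet]
  congr 1
  refine (inv_eq_right_inv ?_).symm
  set c := 1 + v ⬝ᵥ M⁻¹ *ᵥ u with hcdef
  rw [add_mul, mul_sub, mul_sub, mul_nonsing_inv _ hM, Matrix.mul_smul, mul_vecMulVec, mulVec_mulVec,
    mul_nonsing_inv _ hM, one_mulVec, vecMulVec_mul, Matrix.mul_smul, vecMulVec_mul_vecMulVec]
  have h2 : vecMulVec u ((v ⬝ᵥ M⁻¹ *ᵥ u) • (v ᵥ* M⁻¹)) = (c - 1) • vecMulVec u (v ᵥ* M⁻¹) := by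
    rw [vecMulVec_smul]
    simp [hcdef]
  rw [h2, smul_smul]
  have h3 : c⁻¹ * (c - 1) = 1 - c⁻¹ := by field_simp
  rw [h3, sub_smul, one_smul]
  abel

/-- Each update divides by a ratio of consecutive determinants, so the matrix must be invertible
after every prefix of the list. -/
theorem val_foldlM_rankOne (u v : Fin k → Fin d → ℝ) (l : List (Fin k))
    (M : Matrix (Fin d) (Fin d) ℝ)
    (h : ∀ p, p <+: l → IsUnit (M + (p.map fun t => vecMulVec (u t) (v t)).sum).det) :
    (l.foldlM (fun s t => rankOne s.1 s.2 (u t) (v t)) (M⁻¹, M.det)).val =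
      ((M + (l.map fun t => vecMulVec (u t) (v t)).sum)⁻¹,
        (M + (l.map fun t => vecMulVec (u t) (v t)).sum).det) := by
  induction l generalizing M with
  | nil => simp
  | cons t l ih =>
    have h0 := h [] (List.nil_prefix)
    have h1 := h [t] (by simp)
    simp only [List.map_nil, List.sum_nil, add_zero, List.map_cons, List.sum_cons] at h0 h1
    rw [List.foldlM_cons, val_bind, val_rankOne_inv h0 h1, ih]
    · simp [add_assoc]
    · intro p hp
      have := h (t :: p) (by simpa using hp)
      simpa [add_assoc] using this

theorem val_invDet (u v : Fin k → Fin d → ℝ)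
    (h : ∀ p : List (Fin k), p.Nodup →
      IsUnit (1 + (p.map fun t => vecMulVec (u t) (v t)).sum).det) :
    (invDet u v).val = ((1 + (∑ t, vecMulVec (u t) (v t)))⁻¹,
      (1 + (∑ t, vecMulVec (u t) (v t))).det) := by
  have h1 := val_foldlM_rankOne u v (List.finRange k) 1
    fun p hp => h p (hp.sublist.nodup (List.nodup_finRange k))
  have h2 : ((List.finRange k).map fun t => vecMulVec (u t) (v t)).sum =
      ∑ t, vecMulVec (u t) (v t) := by
    rw [← List.ofFn_eq_map, Fin.sum_ofFn]
  rw [h2] at h1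
  rw [← h1]
  simp [invDet]

theorem sum_vecMulVec_self (Y : Matrix (Fin k) (Fin d) ℝ) (s : Finset (Fin k)) :
    ∑ t ∈ s, vecMulVec (Y t) (Y t) = (Y.submatrix (fun i : s => (i : Fin k)) id).transpose *
      Y.submatrix (fun i : s => (i : Fin k)) id := by
  ext i j
  rw [Matrix.sum_apply, Matrix.mul_apply, ← Finset.sum_attach]
  simp [vecMulVec_apply]

theorem sum_univ_vecMulVec_self (Y : Matrix (Fin k) (Fin d) ℝ) :
    ∑ t, vecMulVec (Y t) (Y t) = Y.transpose * Y := by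
  ext i j
  rw [Matrix.sum_apply, Matrix.mul_apply]
  simp [vecMulVec_apply]

theorem val_invDet_self (Y : Matrix (Fin k) (Fin d) ℝ) :
    (invDet Y Y).val = ((1 + Y.transpose * Y)⁻¹, (1 + Y.transpose * Y).det) := by
  refine (val_invDet (fun t => Y t) (fun t => Y t) fun p hp => ?_).trans ?_
  swap
  · rw [sum_univ_vecMulVec_self]
  rw [← List.sum_toFinset _ hp, sum_vecMulVec_self]
  exact (isUnit_iff_isUnit_det _).1 (posDef_one_add_transpose_mul_self _).isUnit

/-- The intermediate matrices are `I + P A` with a coordinate projection `P`. They need not be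
symmetric, but `det (I + P A) = det (I + P A P)` since `P² = P`, and `I + P A P` is positive
definite. -/
theorem val_invDetOneAdd {A : Matrix (Fin d) (Fin d) ℝ} (hA : A.PosSemidef) :
    (invDetOneAdd A).val = ((1 + A)⁻¹, (1 + A).det) := by
  have hs : ∀ s : Finset (Fin d), ∑ t ∈ s, vecMulVec ((1 : Matrix (Fin d) (Fin d) ℝ) t) (A t) =
      diagonal (fun t => if t ∈ s then 1 else 0) * A := by
    intro s
    ext i j
    rw [Matrix.sum_apply, diagonal_mul]
    simp [vecMulVec_apply, Matrix.one_apply]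
  rw [invDetOneAdd, val_bind, val_idMatrix]
  refine (val_invDet (fun t => (1 : Matrix (Fin d) (Fin d) ℝ) t) (fun t => A t)
    fun p hp => ?_).trans ?_
  swap
  · rw [hs]
    simp
  · rw [← List.sum_toFinset _ hp, hs]
    set P : Matrix (Fin d) (Fin d) ℝ := diagonal fun t => if t ∈ p.toFinset then 1 else 0 with hP
    have hPP : P * P = P := by
      rw [hP, diagonal_mul_diagonal]
      congr 1
      funext t
      split_ifs <;> simp
    have hPA : (1 + P * A).det = (1 + P * A * P.conjTranspose).det := by
      have h1 : P.conjTranspose = P := by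
        rw [hP, diagonal_conjTranspose]
        congr 1
      conv_lhs => rw [← hPP, mul_assoc, det_one_add_mul_comm]
      rw [h1]
    rw [hPA]
    exact (isUnit_iff_isUnit_det _).1
      (Matrix.PosDef.one.add_posSemidef (hA.mul_mul_conjTranspose_same P)).isUnit

end Timed

end DPP

/-! ### Semidefinite matrices. -/

namespace DPP

open Matrix

section Semidefinite

variable {ι : Type*} [Fintype ι] [DecidableEq ι]

open scoped MatrixOrder ComplexOrder in
theorem exists_eq_conjTranspose_mul_self {P : Matrix ι ι ℝ} (hP : P.PosSemidef) :
    ∃ B : Matrix ι ι ℝ, P = Bᴴ * B :=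
  CStarAlgebra.nonneg_iff_eq_star_mul_self.1 hP.nonneg

theorem trace_mul_nonneg {P Q : Matrix ι ι ℝ} (hP : P.PosSemidef) (hQ : Q.PosSemidef) :
    0 ≤ (P * Q).trace := by
  obtain ⟨B, rfl⟩ := exists_eq_conjTranspose_mul_self hP
  rw [mul_assoc, trace_mul_comm]
  exact (hQ.mul_mul_conjTranspose_same B).trace_nonneg

/-- `det H ≤ det P * exp (tr (P⁻¹ H) - d)`: the determinant lies below the exponential of the
tangent of `log det`. -/
theorem det_le_det_mul_exp {P H : Matrix ι ι ℝ} (hP : P.PosDef) (hH : H.PosSemidef) :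
    H.det ≤ P.det * Real.exp ((P⁻¹ * H).trace - Fintype.card ι) := by
  obtain ⟨B, hB⟩ := exists_eq_conjTranspose_mul_self hP.posSemidef
  have hPd := hP.det_pos
  have hdet : P.det = B.det * B.det := by
    rw [hB, det_mul, det_conjTranspose, star_trivial]
  have hB0 : B.det ≠ 0 := fun h => by rw [hdet, h] at hPd; simp at hPd
  have hBu : IsUnit B.det := hB0.isUnit
  have hM := hH.conjTranspose_mul_mul_same B⁻¹
  -- Congruence by `B⁻¹`, where `P = Bᴴ B`, reduces to the case `P = 1`.
  set M := (B⁻¹)ᴴ * H * B⁻¹ with hMdef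
  have hdetM : H.det = P.det * M.det := by
    rw [hMdef, det_mul, det_mul, det_conjTranspose, det_nonsing_inv, hdet, Ring.inverse_eq_inv',
      star_trivial]
    field_simp
  have htr : (P⁻¹ * H).trace = M.trace := by
    rw [hMdef, mul_assoc, trace_mul_comm (B⁻¹)ᴴ, mul_assoc, trace_mul_comm, hB,
      Matrix.mul_inv_rev, conjTranspose_nonsing_inv]
  rw [hdetM, htr, hM.1.det_eq_prod_eigenvalues, hM.1.trace_eq_sum_eigenvalues]
  refine mul_le_mul_of_nonneg_left ?_ hPd.le
  have h1 : ∑ i, hM.1.eigenvalues i - (Fintype.card ι : ℝ) =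
      ∑ i, (hM.1.eigenvalues i - 1) := by simp
  simp only [RCLike.ofReal_real_eq_id, id]
  rw [h1, Real.exp_sum]
  -- Every eigenvalue `μ` satisfies `μ ≤ exp (μ - 1)`.
  refine Finset.prod_le_prod (fun i _ => hM.eigenvalues_nonneg i) fun i _ => ?_
  linarith [Real.add_one_le_exp (hM.1.eigenvalues i - 1)]

/-- Inversion reverses the Loewner order. -/
theorem dotProduct_inv_le {B C : Matrix ι ι ℝ} (hB : B.PosDef) (hC : C.PosDef)
    (h : (B - C).PosSemidef) (x : ι → ℝ) : x ⬝ᵥ B⁻¹ *ᵥ x ≤ x ⬝ᵥ C⁻¹ *ᵥ x := by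
  have hBu := (isUnit_iff_isUnit_det _).1 hB.isUnit
  have hCu := (isUnit_iff_isUnit_det _).1 hC.isUnit
  set u := B⁻¹ *ᵥ x with hu
  set v := C⁻¹ *ᵥ x with hv
  have hBu' : B *ᵥ u = x := by rw [hu, mulVec_mulVec, mul_nonsing_inv _ hBu, one_mulVec]
  have hCv : C *ᵥ v = x := by rw [hv, mulVec_mulVec, mul_nonsing_inv _ hCu, one_mulVec]
  have hsymm : v ⬝ᵥ C *ᵥ u = x ⬝ᵥ u := by
    rw [dotProduct_mulVec, ← mulVec_transpose, ← conjTranspose_eq_transpose_of_trivial, hC.1, hCv]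
  -- The two nonnegative numbers `(u - v)ᵀ C (u - v)` and `uᵀ (B - C) u` add up to `xᵀ v - xᵀ u`.
  have h1 := hC.posSemidef.dotProduct_mulVec_nonneg (u - v)
  have h2 := h.dotProduct_mulVec_nonneg u
  simp only [star_trivial, mulVec_sub, sub_mulVec, dotProduct_sub, sub_dotProduct, hBu', hCv,
    hsymm] at h1 h2
  rw [dotProduct_comm u x, dotProduct_comm v x] at h1
  rw [dotProduct_comm u x] at h2
  linarith

theorem exists_orthogonal_diagonalization {G : Matrix ι ι ℝ} (hG : G.PosSemidef) :
    ∃ (U : Matrix ι ι ℝ) (lam : ι → ℝ), U * Uᵀ = 1 ∧ Uᵀ * U = 1 ∧ (∀ i, 0 ≤ lam i) ∧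
      G = U * diagonal lam * Uᵀ := by
  refine ⟨hG.1.eigenvectorUnitary, hG.1.eigenvalues, ?_, ?_, hG.eigenvalues_nonneg, ?_⟩
  · rw [← conjTranspose_eq_transpose_of_trivial]
    exact Unitary.coe_mul_star_self hG.1.eigenvectorUnitary
  · rw [← conjTranspose_eq_transpose_of_trivial]
    exact Unitary.coe_star_mul_self hG.1.eigenvectorUnitary
  · conv_lhs => rw [hG.1.spectral_theorem, Unitary.conjStarAlgAut_apply]
    rw [← conjTranspose_eq_transpose_of_trivial]
    rfl

/-- The eigenvalues determine `det (I + t G)` and `tr ((I + t G)⁻¹ G)`. -/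
theorem exists_eigenvalues {G : Matrix ι ι ℝ} (hG : G.PosSemidef) :
    ∃ lam : ι → ℝ, (∀ i, 0 ≤ lam i) ∧ (∀ t : ℝ, (1 + t • G).det = ∏ i, (1 + t * lam i)) ∧
      ∀ t : ℝ, 0 ≤ t → ((1 + t • G)⁻¹ * G).trace = ∑ i, lam i / (1 + t * lam i) := by
  obtain ⟨U, lam, hU, hU', hl, hGU⟩ := exists_orthogonal_diagonalization hG
  have hone : ∀ t : ℝ, 1 + t • G = U * diagonal (fun i => 1 + t * lam i) * Uᵀ := by
    intro t
    have : diagonal (fun i => 1 + t * lam i) = 1 + t • diagonal lam := by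
      rw [← diagonal_smul, ← diagonal_one, diagonal_add]
      rfl
    rw [this, mul_add, add_mul, mul_one, hU, hGU, Matrix.mul_smul, Matrix.smul_mul]
  refine ⟨lam, hl, fun t => ?_, fun t ht => ?_⟩
  · rw [hone, det_mul, det_mul, mul_right_comm, ← det_mul, hU, det_one, one_mul, det_diagonal]
  · have hpos : ∀ i, 0 < 1 + t * lam i := fun i => by have := mul_nonneg ht (hl i); linarith
    have hinv : (1 + t • G)⁻¹ = U * diagonal (fun i => (1 + t * lam i)⁻¹) * Uᵀ := by
      refine inv_eq_right_inv ?_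
      rw [hone]
      calc U * diagonal (fun i => 1 + t * lam i) * Uᵀ *
          (U * diagonal (fun i => (1 + t * lam i)⁻¹) * Uᵀ)
          = U * (diagonal (fun i => 1 + t * lam i) * (Uᵀ * U) *
            diagonal (fun i => (1 + t * lam i)⁻¹)) * Uᵀ := by simp only [mul_assoc]
        _ = 1 := by
          rw [hU', mul_one, diagonal_mul_diagonal]
          simp only [mul_inv_cancel₀ (hpos _).ne']
          rw [diagonal_one, mul_one, hU]
    rw [hinv]
    conv_lhs => rw [hGU]
    calc (U * diagonal (fun i => (1 + t * lam i)⁻¹) * Uᵀ * (U * diagonal lam * Uᵀ)).trace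
        = (U * (diagonal (fun i => (1 + t * lam i)⁻¹) * (Uᵀ * U) * diagonal lam) * Uᵀ).trace := by
          simp only [mul_assoc]
      _ = ∑ i, lam i / (1 + t * lam i) := by
          rw [hU', mul_one, diagonal_mul_diagonal, trace_mul_comm, ← mul_assoc, hU', one_mul,
            trace_diagonal]
          exact Finset.sum_congr rfl fun i _ => by rw [div_eq_inv_mul]

end Semidefinite

theorem transpose_mul_self_posSemidef {ι m : Type*} [Fintype ι] [Fintype m] (X : Matrix m ι ℝ) :
    (Xᵀ * X).PosSemidef := by
  have := posSemidef_conjTranspose_mul_self X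
  rwa [conjTranspose_eq_transpose_of_trivial] at this

theorem self_mul_transpose_posSemidef {ι m : Type*} [Fintype ι] [Fintype m] (X : Matrix ι m ℝ) :
    (X * Xᵀ).PosSemidef := by
  have := posSemidef_self_mul_conjTranspose X
  rwa [conjTranspose_eq_transpose_of_trivial] at this

/-! ### Principal minors; normalization and mean size of a DPP. -/

section PrincipalMinors

variable {ι R : Type*} [Fintype ι] [DecidableEq ι] [CommRing R]

/-- The matrix with the rows of `L` in `S` and the rows of the identity matrix outside `S`. -/
def rowsOrOne (S : Finset ι) (L : Matrix ι ι R) : Matrix ι ι R :=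
  of fun i j => if i ∈ S then L i j else (1 : Matrix ι ι R) i j

theorem det_rowsOrOne (S : Finset ι) (L : Matrix ι ι R) :
    (rowsOrOne S L).det =
      (L.submatrix (fun i : S => (i : ι)) fun i : S => (i : ι)).det := by
  rw [twoBlockTriangular_det _ (fun i => i ∈ S)]
  · have h1 : toSquareBlockProp (rowsOrOne S L) (fun i => ¬ i ∈ S) = 1 := by
      ext i j
      rw [toSquareBlockProp_def, of_apply, rowsOrOne, of_apply, if_neg i.2]
      simp [Matrix.one_apply, Subtype.ext_iff]
    have h2 : toSquareBlockProp (rowsOrOne S L) (fun i => i ∈ S) =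
        L.submatrix (fun i : S => (i : ι)) fun i : S => (i : ι) := by
      ext i j
      exact if_pos i.2
    rw [h1, det_one, mul_one, h2]
    convert rfl
  · intro i hi j hj
    rw [rowsOrOne, of_apply, if_neg hi, one_apply_ne]
    rintro rfl
    exact hi hj

/-- Expand `det (L + 1)` by multilinearity in the rows: choosing the rows of `L` in `S` and those of
the identity elsewhere gives the principal minor of `S`. -/
theorem sum_det_submatrix (L : Matrix ι ι R) :
    ∑ S : Finset ι, (L.submatrix (fun i : S => (i : ι)) fun i : S => (i : ι)).det =
      (1 + L).det := by
  have := (detRowAlternating (n := ι) (R := R)).toMultilinearMap.map_add_univ L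
    (1 : Matrix ι ι R)
  rw [add_comm]
  refine Eq.trans ?_ this.symm
  refine Finset.sum_congr rfl fun S _ => (det_rowsOrOne S L).symm.trans ?_
  change (rowsOrOne S L).det = Matrix.det (S.piecewise L (1 : Matrix ι ι R))
  congr 1
  ext i j
  by_cases hi : i ∈ S
  · exact (if_pos hi).trans (congrFun (Finset.piecewise_eq_of_mem S L _ hi) j).symm
  · exact (if_neg hi).trans (congrFun (Finset.piecewise_eq_of_notMem S L _ hi) j).symm

end PrincipalMinors

/-- The unnormalized probability `det (X_S X_Sᵀ)` of `S` under `DPP(X)`. -/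
def dppWeight {n d : ℕ} (X : Matrix (Fin n) (Fin d) ℝ) (S : Finset (Fin n)) : ℝ :=
  (X.submatrix (fun i : S => (i : Fin n)) id *
      (X.submatrix (fun i : S => (i : Fin n)) id).transpose).det

variable {n d : ℕ} (X : Matrix (Fin n) (Fin d) ℝ)

theorem dppWeight_eq_det_submatrix (S : Finset (Fin n)) :
    dppWeight X S =
      ((X * Xᵀ).submatrix (fun i : S => (i : Fin n)) fun i : S => (i : Fin n)).det := rfl

theorem dppWeight_nonneg (S : Finset (Fin n)) : 0 ≤ dppWeight X S :=
  (self_mul_transpose_posSemidef _).det_nonneg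

theorem dppWeight_smul (r : ℝ) (S : Finset (Fin n)) :
    dppWeight (r • X) S = (r ^ 2) ^ S.card * dppWeight X S := by
  unfold dppWeight
  have : (r • X).submatrix (fun i : S => (i : Fin n)) id *
      ((r • X).submatrix (fun i : S => (i : Fin n)) id).transpose =
      (r ^ 2) • (X.submatrix (fun i : S => (i : Fin n)) id *
      (X.submatrix (fun i : S => (i : Fin n)) id).transpose) := by
    ext i j
    simp [Matrix.mul_apply, Finset.mul_sum, sq]
    exact Finset.sum_congr rfl fun _ _ => by ring
  rw [this, det_smul, Fintype.card_coe]

theorem det_one_add_mul_transpose :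
    (1 + X * Xᵀ).det = (1 + Xᵀ * X).det := det_one_add_mul_comm _ _

theorem dpp_eq (S : Finset (Fin n)) : dpp X S = dppWeight X S / (1 + Xᵀ * X).det := by
  rw [← det_one_add_mul_transpose]
  rfl

theorem sum_dppWeight : ∑ S, dppWeight X S = (1 + Xᵀ * X).det := by
  rw [← det_one_add_mul_transpose, ← sum_det_submatrix]
  rfl

theorem dpp_nonneg (S : Finset (Fin n)) : 0 ≤ dpp X S := by
  rw [dpp_eq]
  exact div_nonneg (dppWeight_nonneg X S) (posDef_one_add_transpose_mul_self X).det_pos.le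

theorem sum_dpp : ∑ S, dpp X S = 1 := by
  simp only [dpp_eq, ← Finset.sum_div, sum_dppWeight]
  exact div_self (posDef_one_add_transpose_mul_self X).det_pos.ne'

theorem smul_transpose_mul_smul (r : ℝ) : (r • X)ᵀ * (r • X) = r ^ 2 • (Xᵀ * X) := by
  rw [transpose_smul, Matrix.mul_smul, Matrix.smul_mul, smul_smul, sq]

/-- Scaling `X` by `√t` multiplies the weight of `S` by `t ^ |S|`, so the normalizing constant of
`DPP(√t X)` is the generating polynomial of `|S|`. -/
theorem sum_pow_card_mul_dppWeight {t : ℝ} (ht : 0 ≤ t) :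
    ∑ S, t ^ S.card * dppWeight X S = (1 + t • (Xᵀ * X)).det := by
  have := sum_dppWeight (√t • X)
  rw [smul_transpose_mul_smul] at this
  simpa only [dppWeight_smul, Real.sq_sqrt ht] using this

/-- The expected size of a sample of `DPP(√t X)` in terms of the eigenvalues of `Xᵀ X`. -/
theorem sum_card_mul_pow_mul_dppWeight {lam : Fin d → ℝ} (hl : ∀ i, 0 ≤ lam i)
    (hdet : ∀ t : ℝ, (1 + t • (Xᵀ * X)).det = ∏ i, (1 + t * lam i)) {t : ℝ} (ht : 0 < t) :
    ∑ S : Finset (Fin n), (S.card : ℝ) * (t ^ S.card * dppWeight X S) =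
      (∏ i, (1 + t * lam i)) * ∑ i, t * lam i / (1 + t * lam i) := by
  have hpos : ∀ i, 0 < 1 + t * lam i := fun i => by have := mul_nonneg ht.le (hl i); linarith
  -- The generating polynomial of `|S|` is differentiated in its two forms, as a sum over sets and
  -- as a product over eigenvalues. The forms are known to agree for `u ≥ 0`, which contains a
  -- neighbourhood of `t`.
  have h1 : HasDerivAt (fun u : ℝ => ∑ S : Finset (Fin n), u ^ S.card * dppWeight X S)
      (∑ S : Finset (Fin n), (S.card : ℝ) * t ^ (S.card - 1) * dppWeight X S) t :=
    HasDerivAt.fun_sum fun S _ => (hasDerivAt_pow _ _).mul_const _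
  have h2 : HasDerivAt (fun u : ℝ => ∏ i, (1 + u * lam i))
      (∑ i, (∏ j ∈ Finset.univ.erase i, (1 + t * lam j)) • lam i) t := by
    refine HasDerivAt.fun_finsetProd fun i _ => ?_
    simpa using ((hasDerivAt_id t).mul_const (lam i)).const_add 1
  have heq : (fun u : ℝ => ∑ S : Finset (Fin n), u ^ S.card * dppWeight X S) =ᶠ[nhds t]
      fun u : ℝ => ∏ i, (1 + u * lam i) := by
    filter_upwards [lt_mem_nhds ht] with u hu
    rw [sum_pow_card_mul_dppWeight X (le_of_lt hu), hdet]
  have h3 := h1.unique (h2.congr_of_eventuallyEq heq)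
  have h4 : ∀ m : ℕ, (m : ℝ) * t ^ m = t * (m * t ^ (m - 1)) := by
    intro m
    cases m with
    | zero => simp
    | succ m => simp [pow_succ]; ring
  calc _ = t * ∑ S : Finset (Fin n), (S.card : ℝ) * t ^ (S.card - 1) * dppWeight X S := by
        rw [Finset.mul_sum]
        refine Finset.sum_congr rfl fun S _ => ?_
        rw [← mul_assoc, h4, mul_assoc]
    _ = _ := by
        rw [h3, Finset.mul_sum, Finset.mul_sum]
        refine Finset.sum_congr rfl fun i _ => ?_
        rw [← Finset.mul_prod_erase _ _ (Finset.mem_univ i), smul_eq_mul]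
        field_simp [(hpos i).ne']

/-- The expected size of a sample of `DPP(r X)` in terms of the eigenvalues of `Xᵀ X`. -/
theorem dppSize_smul {lam : Fin d → ℝ} (hl : ∀ i, 0 ≤ lam i)
    (hdet : ∀ t : ℝ, (1 + t • (Xᵀ * X)).det = ∏ i, (1 + t * lam i)) {r : ℝ} (hr : r ≠ 0) :
    dppSize (r • X) = ∑ i, r ^ 2 * lam i / (1 + r ^ 2 * lam i) := by
  have hpos : ∀ i, 0 < 1 + r ^ 2 * lam i := fun i => by
    have := mul_nonneg (sq_nonneg r) (hl i); linarith
  unfold dppSize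
  simp only [dpp_eq, dppWeight_smul, smul_transpose_mul_smul, hdet, mul_div_assoc']
  rw [← Finset.sum_div, sum_card_mul_pow_mul_dppWeight X hl hdet (by positivity),
    mul_div_cancel_left₀]
  exact (Finset.prod_pos fun i _ => hpos i).ne'

theorem dppSize_eq {lam : Fin d → ℝ} (hl : ∀ i, 0 ≤ lam i)
    (hdet : ∀ t : ℝ, (1 + t • (Xᵀ * X)).det = ∏ i, (1 + t * lam i)) :
    dppSize X = ∑ i, lam i / (1 + lam i) := by
  simpa using dppSize_smul X hl hdet one_ne_zero

end DPP

/-! ### Schur complements and the chain rule sampler. -/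

namespace DPP

open Matrix

section Schur

variable {m : ℕ}

/-- The Schur complement of the first diagonal entry. -/
def schur (M : Matrix (Fin (m + 1)) (Fin (m + 1)) ℝ) : Matrix (Fin m) (Fin m) ℝ :=
  of fun i j => M i.succ j.succ - M i.succ 0 * M 0 j.succ / M 0 0

theorem det_eq_mul_det_schur {M : Matrix (Fin (m + 1)) (Fin (m + 1)) ℝ} (h : M 0 0 ≠ 0) :
    M.det = M 0 0 * (schur M).det := by
  let B : Matrix (Fin (m + 1)) (Fin (m + 1)) ℝ := of fun i j =>
    Fin.cases (motive := fun _ => ℝ) (M 0 j)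
      (fun i => M i.succ j - M i.succ 0 / M 0 0 * M 0 j) i
  have hB : M.det = B.det := by
    refine det_eq_of_forall_row_eq_smul_add_const
      (Fin.cases (motive := fun _ => ℝ) 0 fun i => M i.succ 0 / M 0 0) 0 rfl fun i j => ?_
    refine Fin.cases ?_ (fun i => ?_) i
    · simp [B]
    · simp [B]
  rw [hB, det_succ_column_zero, Fin.sum_univ_succ, Finset.sum_eq_zero]
  · have : B.submatrix (Fin.succAbove 0) Fin.succ = schur M := by
      ext i j
      simp [B, schur]
      ring
    rw [this]
    simp [B]
  · intro i _
    simp [B, h]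

theorem schur_posSemidef {M : Matrix (Fin (m + 1)) (Fin (m + 1)) ℝ} (hM : M.PosSemidef)
    (h : M 0 0 ≠ 0) : (schur M).PosSemidef := by
  -- The columns of `B` are the unit vectors with index at least 1, corrected to be `M`-orthogonal
  -- to the zeroth one. Hence `Bᴴ M B` is the Schur complement.
  let B : Matrix (Fin (m + 1)) (Fin m) ℝ := of fun i j =>
    Fin.cases (motive := fun _ => ℝ) (-(M 0 j.succ / M 0 0))
      (fun i => (1 : Matrix (Fin m) (Fin m) ℝ) i j) i
  have hs : ∀ i j, M i j = M j i := fun i j => by simpa using hM.1.apply j i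
  convert hM.conjTranspose_mul_mul_same B using 1
  ext i j
  simp only [Matrix.mul_apply, Fin.sum_univ_succ, schur, of_apply, conjTranspose_apply, star_trivial,
    B, Fin.cases_zero, Fin.cases_succ, Matrix.one_apply, ite_mul, mul_ite, mul_one, mul_zero,
    one_mul, zero_mul, Finset.sum_ite_eq', Finset.mem_univ, if_true]
  rw [hs i.succ 0]
  field_simp
  ring

/-- A symmetric matrix with `0 ≤ K ≤ 1`. -/
def IsPosContraction {ι : Type} [DecidableEq ι] (K : Matrix ι ι ℝ) : Prop :=
  K.PosSemidef ∧ (1 - K).PosSemidef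

theorem IsPosContraction.schur {K : Matrix (Fin (m + 1)) (Fin (m + 1)) ℝ}
    (hK : IsPosContraction K) (h : K 0 0 ≠ 0) : IsPosContraction (schur K) := by
  refine ⟨schur_posSemidef hK.1 h, ?_⟩
  have hs : ∀ i j, K i j = K j i := fun i j => by simpa using hK.1.1.apply j i
  have h0 : 0 ≤ (K 0 0)⁻¹ := inv_nonneg.2 hK.1.diag_nonneg
  -- `1 - schur K` is a principal submatrix of `1 - K` plus a nonnegative multiple of a rank-one
  -- square.
  have h1 := (hK.2.submatrix Fin.succ).add
    ((posSemidef_vecMulVec_self_star fun i : Fin m => K i.succ 0).smul h0)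
  convert h1 using 1
  ext i j
  simp [DPP.schur, vecMulVec_apply, Matrix.one_apply, hs 0 j.succ]
  ring

/-- The marginal kernel of the remaining points after the decision `b` on the first one. -/
def condKernel (b : Bool) (K : Matrix (Fin (m + 1)) (Fin (m + 1)) ℝ) : Matrix (Fin m) (Fin m) ℝ :=
  if b then schur K else 1 - schur (1 - K)

/-- Excluding a point means including it in the complementary process, whose kernel is `1 - K`. So
both decisions reduce to the Schur complement. -/
theorem IsPosContraction.condKernel {K : Matrix (Fin (m + 1)) (Fin (m + 1)) ℝ}
    (hK : IsPosContraction K) (b : Bool) (h : (if b then K 0 0 else 1 - K 0 0) ≠ 0) :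
    IsPosContraction (condKernel b K) := by
  cases b with
  | true => exact hK.schur h
  | false =>
    have h1 : IsPosContraction (1 - K) := ⟨hK.2, by simpa using hK.1⟩
    have h2 := h1.schur (by simpa using h)
    exact ⟨h2.2, by simpa [DPP.condKernel] using h2.1⟩

/-- The determinant of this matrix is the probability of the set `{i | b i}` under the point
process with marginal kernel `K`. -/
def patternMatrix (b : Fin m → Bool) (K : Matrix (Fin m) (Fin m) ℝ) : Matrix (Fin m) (Fin m) ℝ :=
  of fun i j => if b i then K i j else (1 - K) i j

/-- Off the diagonal, rows of `1 - K` are the negatives of rows of `K`. Eliminating the first column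
therefore changes a row of either kind into the corresponding row for the conditioned kernel. -/
theorem schur_patternMatrix_cons (b : Bool) (c : Fin m → Bool)
    (K : Matrix (Fin (m + 1)) (Fin (m + 1)) ℝ) :
    schur (patternMatrix (Fin.cons b c : Fin (m + 1) → Bool) K) =
      patternMatrix c (condKernel b K) := by
  ext i j
  cases b <;> cases hc : c i <;>
    simp [schur, patternMatrix, condKernel, hc, Matrix.one_apply, Fin.succ_ne_zero,
      (Fin.succ_ne_zero _).symm] <;> ring

theorem posSemidef_row_eq_zero {M : Matrix (Fin (m + 1)) (Fin (m + 1)) ℝ} (hM : M.PosSemidef)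
    (h : M 0 0 = 0) (j : Fin (m + 1)) : M 0 j = 0 := by
  have h1 := (hM.dotProduct_mulVec_zero_iff (Pi.single 0 1)).1 (by simp [h])
  have h2 := congrFun h1 j
  have hs : M j 0 = M 0 j := by simpa using hM.1.apply 0 j
  simpa [hs] using h2

/-- The chain rule for probabilities: the pivot is the probability of the first decision, and the
Schur complement describes the rest. If the pivot is zero, semidefiniteness makes the whole first
row zero and both sides vanish. -/
theorem det_patternMatrix_cons {K : Matrix (Fin (m + 1)) (Fin (m + 1)) ℝ}
    (hK : IsPosContraction K) (b : Bool) (c : Fin m → Bool) :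
    (patternMatrix (Fin.cons b c : Fin (m + 1) → Bool) K).det =
      (if b then K 0 0 else 1 - K 0 0) * (patternMatrix c (condKernel b K)).det := by
  have h00 : patternMatrix (Fin.cons b c : Fin (m + 1) → Bool) K 0 0 =
      if b then K 0 0 else 1 - K 0 0 := by
    cases b <;> simp [patternMatrix]
  by_cases h : (if b then K 0 0 else 1 - K 0 0) = 0
  · rw [h, zero_mul]
    refine det_eq_zero_of_row_eq_zero 0 fun j => ?_
    cases b with
    | true => exact posSemidef_row_eq_zero hK.1 h j
    | false => exact posSemidef_row_eq_zero hK.2 (by simpa using h) j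
  · rw [det_eq_mul_det_schur (h00 ▸ h), h00, schur_patternMatrix_cons]

end Schur

section Sampling

open RandComp Timed

variable {d k : ℕ}

/-- The update `W + v vᵀ / (1 - p)` after a rejection is written as `W - v vᵀ / (p - 1)`, so that
both decisions have the same shape. -/
theorem expect_one_dppStep {W : Matrix (Fin d) (Fin d) ℝ} {S : Finset (Fin k)} {t : Fin k}
    {y : Fin d → ℝ} (h0 : 0 ≤ y ⬝ᵥ W *ᵥ y) (h1 : y ⬝ᵥ W *ᵥ y ≤ 1)
    (f : Matrix (Fin d) (Fin d) ℝ × Finset (Fin k) → ℝ≥0∞) :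
    expect 1 (dppStep W S t y) f = ∑ b : Bool,
      ENNReal.ofReal (if b then y ⬝ᵥ W *ᵥ y else 1 - y ⬝ᵥ W *ᵥ y) *
        f (W - (if b then y ⬝ᵥ W *ᵥ y else y ⬝ᵥ W *ᵥ y - 1)⁻¹ • vecMulVec (W *ᵥ y) (W *ᵥ y),
          if b then insert t S else S) := by
  rw [Fintype.sum_bool, dppStep]
  simp only [expect_bind, expect_lift, val_mulVec, val_dot, one_pow, one_mul,
    expect_bernoulli h0 h1, expect_pure, val_subOuter, val_sub, if_true, Bool.false_eq_true,
    if_false]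

/-- The Gram matrix of the vectors `y i` for the form `W`. -/
def gram {m : ℕ} (W : Matrix (Fin d) (Fin d) ℝ) (y : Fin m → Fin d → ℝ) :
    Matrix (Fin m) (Fin m) ℝ :=
  of fun i j => y i ⬝ᵥ W *ᵥ y j

/-- This is why the algorithm may keep a `d × d` matrix instead of a kernel: updating the form by `W
y₀` subtracts the product of the inner products with `y₀`, which is the correction in a Schur
complement. -/
theorem gram_condition {m : ℕ} {W : Matrix (Fin d) (Fin d) ℝ} (hW : Wᵀ = W)
    (y : Fin (m + 1) → Fin d → ℝ) (b : Bool) :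
    gram (W - (if b then y 0 ⬝ᵥ W *ᵥ y 0 else y 0 ⬝ᵥ W *ᵥ y 0 - 1)⁻¹ •
      vecMulVec (W *ᵥ y 0) (W *ᵥ y 0)) (fun i => y i.succ) = condKernel b (gram W y) := by
  have hs : ∀ u v : Fin d → ℝ, (W *ᵥ u) ⬝ᵥ v = u ⬝ᵥ W *ᵥ v := fun u v => by
    rw [dotProduct_mulVec, ← mulVec_transpose, hW]
  have hv : ∀ u v : Fin d → ℝ, u ⬝ᵥ vecMulVec (W *ᵥ y 0) (W *ᵥ y 0) *ᵥ v =
      (u ⬝ᵥ W *ᵥ y 0) * (y 0 ⬝ᵥ W *ᵥ v) := fun u v => by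
    rw [vecMulVec_mulVec, hs, dotProduct_smul]
    simp [mul_comm]
  ext i j
  simp only [gram, of_apply, sub_mulVec, smul_mulVec, dotProduct_sub, dotProduct_smul, hv]
  cases b with
  | true =>
    simp [condKernel, schur]
    ring
  | false =>
    simp only [condKernel, schur, Matrix.sub_apply, of_apply, Matrix.one_apply, Fin.succ_inj,
      Fin.succ_ne_zero, (Fin.succ_ne_zero _).symm, if_false, Bool.false_eq_true, if_true,
      smul_eq_mul]
    rw [← neg_sub 1 (y 0 ⬝ᵥ W *ᵥ y 0), inv_neg]
    ring

/-- Induction over the rows not yet visited, which `e` enumerates; `S` holds the labels selected so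
far. -/
theorem expect_one_foldlM_dppStep (Y : Fin k → Fin d → ℝ) {m : ℕ} (e : Fin m → Fin k)
    {W : Matrix (Fin d) (Fin d) ℝ} (hW : Wᵀ = W) (S : Finset (Fin k))
    (hK : IsPosContraction (gram W fun i => Y (e i))) (f : Finset (Fin k) → ℝ≥0∞) :
    expect 1 (((List.finRange m).map e).foldlM (fun s t => dppStep s.1 s.2 t (Y t)) (W, S))
      (fun r => f r.2) =
      ∑ b : Fin m → Bool, ENNReal.ofReal (patternMatrix b (gram W fun i => Y (e i))).det *
        f (S ∪ (Finset.univ.filter fun i => b i = true).image e) := by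
  induction m generalizing W S with
  | zero =>
    rw [List.finRange_zero, List.map_nil, List.foldlM_nil, expect_pure, Fintype.sum_unique]
    simp
  | succ m ih =>
    have hp0 : 0 ≤ Y (e 0) ⬝ᵥ W *ᵥ Y (e 0) := hK.1.diag_nonneg (i := 0)
    have hp1 : Y (e 0) ⬝ᵥ W *ᵥ Y (e 0) ≤ 1 := by
      simpa [gram] using hK.2.diag_nonneg (i := 0)
    rw [List.finRange_succ, List.map_cons, List.foldlM_cons, expect_bind,
      expect_one_dppStep hp0 hp1, ← (Fin.consEquiv fun _ : Fin (m + 1) => Bool).sum_comp,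
      Fintype.sum_prod_type]
    refine Finset.sum_congr rfl fun b _ => ?_
    change _ = ∑ c : Fin m → Bool, ENNReal.ofReal (patternMatrix
      (Fin.cons b c : Fin (m + 1) → Bool) (gram W fun i => Y (e i))).det *
      f (S ∪ (Finset.univ.filter fun i => (Fin.cons b c : Fin (m + 1) → Bool) i = true).image e)
    have hπ : (0 : ℝ) ≤ if b then Y (e 0) ⬝ᵥ W *ᵥ Y (e 0) else 1 - Y (e 0) ⬝ᵥ W *ᵥ Y (e 0) := by
      split_ifs <;> linarith
    have hdet : ∀ c : Fin m → Bool,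
        (patternMatrix (Fin.cons b c : Fin (m + 1) → Bool) (gram W fun i => Y (e i))).det =
        (if b then Y (e 0) ⬝ᵥ W *ᵥ Y (e 0) else 1 - Y (e 0) ⬝ᵥ W *ᵥ Y (e 0)) *
          (patternMatrix c (condKernel b (gram W fun i => Y (e i)))).det :=
      fun c => det_patternMatrix_cons hK b c
    simp_rw [hdet, ENNReal.ofReal_mul hπ, mul_assoc, ← Finset.mul_sum]
    -- A decision of probability zero contributes nothing to either side, whatever the division by
    -- zero in its update yields. Otherwise the conditioned kernel is again a contraction.
    rcases hπ.eq_or_lt with h | h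
    · rw [← h, ENNReal.ofReal_zero, zero_mul, zero_mul]
    congr 1
    have hK' := gram_condition hW (fun i => Y (e i)) b
    have hc := hK.condKernel b h.ne'
    rw [← hK'] at hc
    rw [List.map_map]
    refine (ih (fun i => e i.succ) ?_ _ hc).trans ?_
    · rw [transpose_sub, transpose_smul, transpose_vecMulVec, hW]
    · rw [hK']
      refine Finset.sum_congr rfl fun c _ => ?_
      congr 2
      ext x
      simp only [Finset.mem_union, Finset.mem_image, Finset.mem_filter, Finset.mem_univ, true_and,
        Fin.exists_fin_succ, Fin.cons_zero, Fin.cons_succ]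
      cases b
      · simp
      · rw [if_pos rfl, Finset.mem_insert, eq_comm (a := x) (b := e 0)]
        tauto

/-- The push-through identity `Yᵀ (I + Y Yᵀ) = (I + Yᵀ Y) Yᵀ`. It identifies the initial Gram matrix
with `L (I + L)⁻¹`, where `L = Y Yᵀ`. -/
theorem mul_inv_mul_transpose_mul_one_add (Y : Matrix (Fin k) (Fin d) ℝ) :
    Y * (1 + Yᵀ * Y)⁻¹ * Yᵀ * (1 + Y * Yᵀ) = Y * Yᵀ := by
  have hu := (isUnit_iff_isUnit_det _).1 (posDef_one_add_transpose_mul_self Y).isUnit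
  have h : Yᵀ * (1 + Y * Yᵀ) = (1 + Yᵀ * Y) * Yᵀ := by
    rw [Matrix.mul_add, Matrix.add_mul, Matrix.mul_one, Matrix.one_mul, Matrix.mul_assoc]
  rw [Matrix.mul_assoc, h, ← Matrix.mul_assoc, Matrix.mul_assoc Y, nonsing_inv_mul _ hu,
    Matrix.mul_one]

/-- The chain rule sampler is exact. -/
theorem expect_one_dppSample (Y : Matrix (Fin k) (Fin d) ℝ) (f : Finset (Fin k) → ℝ≥0∞) :
    expect 1 (dppSample Y) f = ∑ S, ENNReal.ofReal (dpp Y S) * f S := by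
  have hP := posDef_one_add_transpose_mul_self Y
  have hQ : (1 + Y * Yᵀ).PosDef := by simpa using posDef_one_add_transpose_mul_self Yᵀ
  have hQu := (isUnit_iff_isUnit_det _).1 hQ.isUnit
  set W := (1 + Yᵀ * Y)⁻¹ with hWdef
  have hW : Wᵀ = W := by
    rw [← conjTranspose_eq_transpose_of_trivial]
    exact hP.inv.1
  have hgram : gram W (fun i => Y i) = Y * W * Yᵀ := by
    ext i j
    change Y i ⬝ᵥ W *ᵥ Y j = _
    rw [dotProduct_mulVec]
    rfl
  have hL := mul_inv_mul_transpose_mul_one_add Y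
  rw [← hWdef] at hL
  have hone : (1 - Y * W * Yᵀ) * (1 + Y * Yᵀ) = 1 := by
    rw [sub_mul, hL]; simp
  have hK : IsPosContraction (gram W fun i => Y i) := by
    rw [hgram]
    refine ⟨?_, ?_⟩
    · simpa [conjTranspose_eq_transpose_of_trivial] using
        hP.inv.posSemidef.mul_mul_conjTranspose_same Y
    · rw [← inv_eq_left_inv hone]
      exact hQ.inv.posSemidef
  have h1 := expect_one_foldlM_dppStep Y id hW ∅ hK f
  rw [List.map_id] at h1
  rw [dppSample, expect_bind, expect_lift, val_invDet_self]
  simp only [one_pow, one_mul, expect_bind, expect_pure]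
  refine h1.trans ?_
  refine Finset.sum_nbij' (fun b => Finset.univ.filter fun i => b i = true)
    (fun S i => decide (i ∈ S)) (by simp) (by simp) (fun b _ => by ext i; simp)
    (fun S _ => by ext i; simp) fun b _ => ?_
  rw [Finset.image_id, Finset.empty_union]
  congr 2
  -- Multiplication by `I + L` turns rows of `K` into rows of `L` and rows of `1 - K` into rows of
  -- the identity, which leaves the principal minor of `L`.
  rw [dpp_eq, ← det_one_add_mul_transpose, eq_div_iff hQ.det_pos.ne', ← det_mul,
    dppWeight_eq_det_submatrix, ← det_rowsOrOne]
  congr 1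
  ext i j
  change ∑ l, patternMatrix b (gram W fun i => Y i) i l *
    (1 + Y * Yᵀ : Matrix (Fin k) (Fin k) ℝ) l j = _
  rw [hgram]
  simp only [patternMatrix, rowsOrOne, of_apply, Finset.mem_filter, Finset.mem_univ, true_and]
  split_ifs with h
  · rw [← Matrix.mul_apply, hL]
  · rw [← Matrix.mul_apply, hone]

theorem law_dppSample (Y : Matrix (Fin k) (Fin d) ℝ) (S : Finset (Fin k)) :
    (dppSample Y).law S = ENNReal.ofReal (dpp Y S) := by
  rw [law_eq_expect, expect_one_dppSample]
  simp

end Sampling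

end DPP

/-! ### Sums over row sequences, and Poisson factorial moments. -/

namespace DPP

open Matrix

section Counting

variable {n : ℕ} {κ : Type} [Fintype κ]

/-- Marginalization: the coordinates outside `T` each sum to 1. -/
theorem sum_prod_mul_restrict {K : ℕ} (w : Fin n → ℝ≥0∞) (hw : ∑ i, w i = 1)
    (T : Finset (Fin K)) (F : (T → Fin n) → ℝ≥0∞) :
    ∑ σ : Fin K → Fin n, (∏ t, w (σ t)) * F (fun t => σ t) =
      ∑ τ : T → Fin n, (∏ t, w (τ t)) * F τ := by
  rw [← (Equiv.piEquivPiSubtypeProd (· ∈ T) fun _ => Fin n).symm.sum_comp,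
    Fintype.sum_prod_type]
  refine Finset.sum_congr rfl fun τ _ => ?_
  have h1 : ∀ υ : {t // t ∉ T} → Fin n,
      (∏ t, w ((Equiv.piEquivPiSubtypeProd (· ∈ T) fun _ => Fin n).symm (τ, υ) t)) *
        F (fun t => (Equiv.piEquivPiSubtypeProd (· ∈ T) fun _ => Fin n).symm (τ, υ) t) =
      ((∏ t, w (τ t)) * F τ) * ∏ t, w (υ t) := by
    intro υ
    have h2 : (fun t : T => (Equiv.piEquivPiSubtypeProd (· ∈ T) fun _ => Fin n).symm (τ, υ) t) =
        τ := by
      funext t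
      simp [Equiv.piEquivPiSubtypeProd]
    have h3 : ∀ t : {t // t ∉ T},
        (Equiv.piEquivPiSubtypeProd (· ∈ T) fun _ => Fin n).symm (τ, υ) t = υ t := by
      intro t
      simp [Equiv.piEquivPiSubtypeProd, t.2]
    rw [h2, ← Finset.prod_mul_prod_compl T, ← Finset.prod_coe_sort T,
      Finset.prod_subtype Tᶜ (p := (· ∉ T)) (by simp)]
    simp only [h3]
    rw [mul_right_comm]
    congr 2
    exact Finset.prod_congr rfl fun t _ => congrArg w (congrFun h2 t)
  simp_rw [h1, ← Finset.mul_sum]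
  have h4 := Finset.prod_univ_sum (fun _ : {t // t ∉ T} => (Finset.univ : Finset (Fin n)))
    fun _ i => w i
  rw [Fintype.piFinset_univ] at h4
  rw [← h4]
  simp [hw]

theorem exists_equiv_of_image_eq {τ : κ → Fin n} {S : Finset (Fin n)}
    (hτ : Finset.univ.image τ = S) (hS : S.card = Fintype.card κ) :
    ∃ e : κ ≃ S, (fun t => (e t : Fin n)) = τ := by
  have hmem : ∀ t, τ t ∈ S := fun t => hτ ▸ Finset.mem_image_of_mem _ (Finset.mem_univ t)
  refine ⟨Equiv.ofBijective (fun t => ⟨τ t, hmem t⟩)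
    ((Fintype.bijective_iff_surjective_and_card _).2 ⟨?_, by simp [hS]⟩), rfl⟩
  rintro ⟨i, hi⟩
  rw [← hτ] at hi
  obtain ⟨t, _, rfl⟩ := Finset.mem_image.1 hi
  exact ⟨t, rfl⟩

theorem card_filter_image_eq [DecidableEq κ] {S : Finset (Fin n)} (hS : S.card = Fintype.card κ) :
    (Finset.univ.filter fun τ : κ → Fin n => Finset.univ.image τ = S).card =
      (Fintype.card κ).factorial := by
  have e0 : κ ≃ S := Fintype.equivOfCardEq (by simp [hS])
  rw [← Fintype.card_equiv e0, ← Finset.card_univ]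
  symm
  refine Finset.card_bij (fun (e : κ ≃ S) _ t => (e t : Fin n)) ?_ ?_ ?_
  · intro e _
    rw [Finset.mem_filter]
    refine ⟨Finset.mem_univ _, ?_⟩
    ext i
    simp only [Finset.mem_image, Finset.mem_univ, true_and]
    refine ⟨fun ⟨t, ht⟩ => ht ▸ (e t).2, fun hi => ⟨e.symm ⟨i, hi⟩, by simp⟩⟩
  · intro e _ e' _ h
    ext t
    exact congrArg Fin.val (congrFun h t)
  · intro τ hτ
    obtain ⟨e, he⟩ := exists_equiv_of_image_eq (Finset.mem_filter.1 hτ).2 hS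
    exact ⟨e, Finset.mem_univ _, he⟩

/-- A sequence with a repetition gives two equal rows and a zero determinant. The others list the
elements of a set, `k!` sequences for each set of size `k`, and reordering does not change the
minor. -/
theorem sum_det_gram_mul [DecidableEq κ] {d : ℕ} (X : Matrix (Fin n) (Fin d) ℝ) (f : Finset (Fin n) → ℝ≥0∞) :
    ∑ τ : κ → Fin n, ENNReal.ofReal ((X * Xᵀ).submatrix τ τ).det * f (Finset.univ.image τ) =
      ∑ S : Finset (Fin n), if S.card = Fintype.card κ then
        ((Fintype.card κ).factorial : ℝ≥0∞) * (ENNReal.ofReal (dppWeight X S) * f S) else 0 := by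
  rw [← Finset.sum_fiberwise Finset.univ fun τ : κ → Fin n => Finset.univ.image τ]
  refine Finset.sum_congr rfl fun S _ => ?_
  split_ifs with hS
  · rw [← card_filter_image_eq hS, ← nsmul_eq_mul, ← Finset.sum_const]
    refine Finset.sum_congr rfl fun τ hτ => ?_
    have h := (Finset.mem_filter.1 hτ).2
    obtain ⟨e, he⟩ := exists_equiv_of_image_eq h hS
    rw [h, dppWeight_eq_det_submatrix, ← det_submatrix_equiv_self e, ← he]
    rfl
  · refine Finset.sum_eq_zero fun τ hτ => ?_
    have h := (Finset.mem_filter.1 hτ).2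
    have hinj : ¬ Function.Injective τ := fun hi => hS <| by
      rw [← h, Finset.card_image_of_injective _ hi, Finset.card_univ]
    obtain ⟨a, b, hab, hne⟩ := Function.not_injective_iff.1 hinj
    rw [det_zero_of_row_eq hne, ENNReal.ofReal_zero, zero_mul]
    funext j
    simp [hab]

end Counting

/-- Terms with `K < k` vanish. For `K = j + k` the falling factorial reduces `K!` to `j!`, and `r ^
k` times the Poisson law of `j` remains. -/
theorem tsum_poisson_mul_descFactorial {r : ℝ} (hr : 0 ≤ r) (k : ℕ) :
    ∑' K : ℕ, ENNReal.ofReal (Real.exp (-r) * r ^ K / K.factorial) * (K.descFactorial k : ℝ≥0∞) =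
      ENNReal.ofReal r ^ k := by
  rw [← (add_left_injective k).tsum_eq (f := fun K : ℕ =>
    ENNReal.ofReal (Real.exp (-r) * r ^ K / K.factorial) * (K.descFactorial k : ℝ≥0∞))]
  · have h1 : ∀ j : ℕ, ENNReal.ofReal (Real.exp (-r) * r ^ (j + k) / (j + k).factorial) *
        ((j + k).descFactorial k : ℝ≥0∞) =
        ENNReal.ofReal (Real.exp (-r) * r ^ j / j.factorial) * ENNReal.ofReal r ^ k := by
      intro j
      rw [← ENNReal.ofReal_natCast, ← ENNReal.ofReal_mul (by positivity),
        ← ENNReal.ofReal_pow hr, ← ENNReal.ofReal_mul (by positivity)]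
      congr 1
      have h2 : ((j + k).factorial : ℝ) = j.factorial * (j + k).descFactorial k := by
        exact_mod_cast (by
          have := Nat.factorial_mul_descFactorial (Nat.le_add_left k j)
          rw [Nat.add_sub_cancel] at this
          exact this.symm)
      have h3 : ((j + k).descFactorial k : ℝ) ≠ 0 := by
        intro h0
        rw [h0, mul_zero] at h2
        exact (by positivity : ((j + k).factorial : ℝ) ≠ 0) h2
      rw [h2, pow_add]
      field_simp
    simp_rw [h1, ENNReal.tsum_mul_right]
    have h4 : HasSum (fun j : ℕ => Real.exp (-r) * r ^ j / j.factorial) 1 :=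
      ProbabilityTheory.hasSum_one_poissonMeasure ⟨r, hr⟩
    rw [← ENNReal.ofReal_tsum_of_nonneg (fun j => by positivity) h4.summable]
    rw [h4.tsum_eq, ENNReal.ofReal_one, one_mul]
  · intro K hK
    by_contra h
    refine hK ?_
    have : K < k := by
      by_contra h'
      exact h ⟨K - k, Nat.sub_add_cancel (not_lt.1 h')⟩
    simp [Nat.descFactorial_eq_zero_iff_lt.2 this]

/-! ### Rejection sampling of a row. -/

section RowSample

open RandComp Timed

variable {n d : ℕ} {z : ℝ≥0∞}

/-- One round of the rejection sampler. -/
def rowTrial (X : Matrix (Fin n) (Fin d) ℝ) (lt : Fin n → ℝ) (W : Matrix (Fin d) (Fin d) ℝ) :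
    RandComp (Option (Fin n × ℝ)) := do
  let i ← oracle lt
  let l ← lift (quadForm W (X i))
  let t ← lift (mul 2 (lt i))
  let p ← lift (div l t)
  let acc ← bernoulli p
  return if acc then some (i, l) else none

theorem rowSample_eq (X : Matrix (Fin n) (Fin d) ℝ) (lt : Fin n → ℝ)
    (W : Matrix (Fin d) (Fin d) ℝ) : rowSample X lt W = loop (rowTrial X lt W) := rfl

/-- The index `i` is proposed and accepted with probability `(lt_i / Λ) (l_i / (2 lt_i)) = l_i / (2
Λ)`, where `Λ = ∑ lt_j`; the individual estimate cancels. Besides the quadratic form, a trial pays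
for the oracle call, a product, a quotient and the coin. -/
theorem expect_rowTrial {X : Matrix (Fin n) (Fin d) ℝ} {lt : Fin n → ℝ}
    {W : Matrix (Fin d) (Fin d) ℝ} (hl : ∀ i, 0 < X i ⬝ᵥ W *ᵥ X i)
    (hlt : ∀ i, X i ⬝ᵥ W *ᵥ X i ≤ 2 * lt i) (f : Option (Fin n × ℝ) → ℝ≥0∞) :
    expect z (rowTrial X lt W) f = z ^ (2 * d ^ 2 + 3 * d + 4) *
      ∑ i, (ENNReal.ofReal ((X i ⬝ᵥ W *ᵥ X i) / (2 * ∑ j, lt j)) *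
          f (some (i, X i ⬝ᵥ W *ᵥ X i)) +
        ENNReal.ofReal (lt i / (∑ j, lt j) - (X i ⬝ᵥ W *ᵥ X i) / (2 * ∑ j, lt j)) * f none) := by
  have hlt0 : ∀ i, 0 < lt i := fun i => by linarith [hl i, hlt i]
  have hp0 : ∀ i, 0 ≤ X i ⬝ᵥ W *ᵥ X i / (2 * lt i) := fun i =>
    div_nonneg (hl i).le (by linarith [hlt0 i])
  have hp1 : ∀ i, X i ⬝ᵥ W *ᵥ X i / (2 * lt i) ≤ 1 := fun i =>
    (div_le_one (by linarith [hlt0 i])).2 (hlt i)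
  rw [rowTrial, expect_bind, expect_oracle]
  have h1 : ∀ i, expect z (lift (quadForm W (X i)) >>= fun l => lift (mul 2 (lt i)) >>= fun t =>
      lift (div l t) >>= fun p => bernoulli p >>= fun acc =>
      (pure (if acc then some (i, l) else none) : RandComp (Option (Fin n × ℝ)))) f =
      z ^ (2 * d ^ 2 + 3 * d + 3) *
        (ENNReal.ofReal (X i ⬝ᵥ W *ᵥ X i / (2 * lt i)) * f (some (i, X i ⬝ᵥ W *ᵥ X i)) +
        ENNReal.ofReal (1 - X i ⬝ᵥ W *ᵥ X i / (2 * lt i)) * f none) := by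
    intro i
    simp only [expect_bind, expect_lift, val_quadForm, val_mul, val_div, time_quadForm, time_mul,
      time_div, expect_bernoulli (hp0 i) (hp1 i), expect_pure, if_true, Bool.false_eq_true,
      if_false]
    ring
  refine (congrArg (z * ·) (Finset.sum_congr rfl fun i _ =>
    congrArg (ENNReal.ofReal (lt i / ∑ j, lt j) * ·) (h1 i))).trans ?_
  rw [Finset.mul_sum, Finset.mul_sum]
  refine Finset.sum_congr rfl fun i _ => ?_
  have hΛ : 0 < ∑ j, lt j := Finset.sum_pos (fun j _ => hlt0 j) ⟨i, Finset.mem_univ i⟩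
  have hΛ0 : 0 ≤ lt i / ∑ j, lt j := div_nonneg (hlt0 i).le hΛ.le
  have h2 : (X i ⬝ᵥ W *ᵥ X i) / (2 * ∑ j, lt j) =
      lt i / (∑ j, lt j) * (X i ⬝ᵥ W *ᵥ X i / (2 * lt i)) := by
    have := (hlt0 i).ne'
    field_simp
  have h3 : lt i / (∑ j, lt j) - (X i ⬝ᵥ W *ᵥ X i) / (2 * ∑ j, lt j) =
      lt i / (∑ j, lt j) * (1 - X i ⬝ᵥ W *ᵥ X i / (2 * lt i)) := by
    rw [h2]; ring
  rw [h3, h2, ENNReal.ofReal_mul hΛ0, ENNReal.ofReal_mul hΛ0]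
  ring

theorem expect_rowTrial_some {X : Matrix (Fin n) (Fin d) ℝ} {lt : Fin n → ℝ}
    {W : Matrix (Fin d) (Fin d) ℝ} (hl : ∀ i, 0 < X i ⬝ᵥ W *ᵥ X i)
    (hlt : ∀ i, X i ⬝ᵥ W *ᵥ X i ≤ 2 * lt i) (f : Fin n × ℝ → ℝ≥0∞) :
    expect z (rowTrial X lt W) (fun r => r.elim 0 f) = z ^ (2 * d ^ 2 + 3 * d + 4) *
      ∑ i, ENNReal.ofReal ((X i ⬝ᵥ W *ᵥ X i) / (2 * ∑ j, lt j)) *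
          f (i, X i ⬝ᵥ W *ᵥ X i) := by
  rw [expect_rowTrial hl hlt]
  simp

theorem expect_rowTrial_none [NeZero n] {X : Matrix (Fin n) (Fin d) ℝ} {lt : Fin n → ℝ}
    {W : Matrix (Fin d) (Fin d) ℝ} (hl : ∀ i, 0 < X i ⬝ᵥ W *ᵥ X i)
    (hlt : ∀ i, X i ⬝ᵥ W *ᵥ X i ≤ 2 * lt i) :
    expect z (rowTrial X lt W) (fun r => r.elim 1 fun _ => 0) = z ^ (2 * d ^ 2 + 3 * d + 4) *
      ENNReal.ofReal (1 - (∑ i, X i ⬝ᵥ W *ᵥ X i) / (2 * ∑ j, lt j)) := by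
  have hlt0 : ∀ i, 0 < lt i := fun i => by linarith [hl i, hlt i]
  have hΛ : 0 < ∑ j, lt j := Finset.sum_pos (fun j _ => hlt0 j) Finset.univ_nonempty
  rw [expect_rowTrial hl hlt]
  simp only [Option.elim, mul_zero, zero_add, mul_one]
  rw [← ENNReal.ofReal_sum_of_nonneg, Finset.sum_sub_distrib, ← Finset.sum_div, ← Finset.sum_div,
    div_self hΛ.ne']
  intro i _
  have h : (X i ⬝ᵥ W *ᵥ X i) / (2 * ∑ j, lt j) ≤ (2 * lt i) / (2 * ∑ j, lt j) := by
    gcongr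
    exact hlt i
  rw [mul_div_mul_left _ _ two_ne_zero] at h
  linarith

theorem expect_one_rowTrial [NeZero n] {X : Matrix (Fin n) (Fin d) ℝ} {lt : Fin n → ℝ}
    {W : Matrix (Fin d) (Fin d) ℝ} (hl : ∀ i, 0 < X i ⬝ᵥ W *ᵥ X i)
    (hlt : ∀ i, X i ⬝ᵥ W *ᵥ X i ≤ 2 * lt i) :
    expect 1 (rowTrial X lt W) (fun _ => 1) = 1 := by
  have hlt0 : ∀ i, 0 < lt i := fun i => by linarith [hl i, hlt i]
  have hΛ : 0 < ∑ j, lt j := Finset.sum_pos (fun j _ => hlt0 j) Finset.univ_nonempty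
  have h1 : (1 : ℝ≥0∞) = ∑ i, ENNReal.ofReal (lt i / ∑ j, lt j) := by
    rw [← ENNReal.ofReal_sum_of_nonneg fun i _ => div_nonneg (hlt0 i).le hΛ.le, ← Finset.sum_div,
      div_self hΛ.ne', ENNReal.ofReal_one]
  rw [expect_rowTrial hl hlt, one_pow, one_mul]
  refine Eq.trans (Finset.sum_congr rfl fun i _ => ?_) h1.symm
  rw [mul_one, mul_one, ← ENNReal.ofReal_add]
  · congr 1; ring
  · exact div_nonneg (hl i).le (by linarith)
  · have h : (X i ⬝ᵥ W *ᵥ X i) / (2 * ∑ j, lt j) ≤ (2 * lt i) / (2 * ∑ j, lt j) := by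
      gcongr
      exact hlt i
    rw [mul_div_mul_left _ _ two_ne_zero] at h
    linarith

/-- Rejection sampling is exact. -/
theorem expect_one_rowSample [NeZero n] {X : Matrix (Fin n) (Fin d) ℝ} {lt : Fin n → ℝ}
    {W : Matrix (Fin d) (Fin d) ℝ} (hl : ∀ i, 0 < X i ⬝ᵥ W *ᵥ X i)
    (hlt : ∀ i, X i ⬝ᵥ W *ᵥ X i ≤ 2 * lt i) (f : Fin n × ℝ → ℝ≥0∞) :
    expect 1 (rowSample X lt W) f = ∑ i,
      ENNReal.ofReal ((X i ⬝ᵥ W *ᵥ X i) / ∑ j, X j ⬝ᵥ W *ᵥ X j) *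
        f (i, X i ⬝ᵥ W *ᵥ X i) := by
  have hlt0 : ∀ i, 0 < lt i := fun i => by linarith [hl i, hlt i]
  have hΛ : 0 < ∑ j, lt j := Finset.sum_pos (fun j _ => hlt0 j) Finset.univ_nonempty
  have hL : 0 < ∑ j, X j ⬝ᵥ W *ᵥ X j := Finset.sum_pos (fun j _ => hl j) Finset.univ_nonempty
  have hp : 0 < (∑ j, X j ⬝ᵥ W *ᵥ X j) / (2 * ∑ j, lt j) := by positivity
  rw [rowSample_eq, expect_one_loop _ (expect_one_rowTrial hl hlt), expect_rowTrial_some hl hlt,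
    expect_rowTrial_some hl hlt]
  simp only [one_pow, one_mul, mul_one]
  rw [← ENNReal.ofReal_sum_of_nonneg fun i _ => div_nonneg (hl i).le (by linarith),
    ← Finset.sum_div, div_eq_mul_inv, Finset.sum_mul]
  refine Finset.sum_congr rfl fun i _ => ?_
  rw [mul_right_comm, ← div_eq_mul_inv, ← ENNReal.ofReal_div_of_pos hp]
  congr 2
  field_simp

end RowSample

end DPP

/-! ### One round of the main loop. -/

namespace DPP

open Matrix RandComp Timed

variable {n d : ℕ} {z : ℝ≥0∞}

/-- The matrix of the rescaled rows with indices `σ`. -/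
def rescaled {K : ℕ} (X : Matrix (Fin n) (Fin d) ℝ) (W : Matrix (Fin d) (Fin d) ℝ) (s q : ℝ)
    (σ : Fin K → Fin n) : Matrix (Fin K) (Fin d) ℝ :=
  of fun t j => √(s / ((X (σ t) ⬝ᵥ W *ᵥ X (σ t)) * (q - s))) * X (σ t) j

theorem val_rescaledRows {K : ℕ} (X : Matrix (Fin n) (Fin d) ℝ) (W : Matrix (Fin d) (Fin d) ℝ)
    (s q : ℝ) (σ : Fin K → Fin n) :
    (rescaledRows X s q fun t => (σ t, X (σ t) ⬝ᵥ W *ᵥ X (σ t))).val = rescaled X W s q σ := by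
  ext t j
  simp [rescaledRows, rescaled]

theorem time_rescaledRows {K : ℕ} (X : Matrix (Fin n) (Fin d) ℝ) (s q : ℝ)
    (smp : Fin K → Fin n × ℝ) : (rescaledRows X s q smp).time = K * (2 * d + 5) := by
  simp [rescaledRows, time_array]
  left
  ring

theorem val_constC (s q : ℝ) (K d : ℕ) :
    (constC s q K d).val = (q / (q - s)) ^ (K + d) * Real.exp (-s) := by
  simp [constC]

theorem time_constC (s q : ℝ) (K d : ℕ) : (constC s q K d).time = K + d + 5 := by
  simp [constC]
  ring

/-- The acceptance probability in the main loop. -/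
def acceptProb {K : ℕ} (X : Matrix (Fin n) (Fin d) ℝ) (W : Matrix (Fin d) (Fin d) ℝ) (D s q : ℝ)
    (σ : Fin K → Fin n) : ℝ :=
  (1 + (rescaled X W s q σ)ᵀ * rescaled X W s q σ).det /
    ((q / (q - s)) ^ (K + d) * Real.exp (-s) * D)

/-- The rescaling gives every row the same value `s / (q - s)` of the quadratic form of `W`, since
`l_i` cancels. So the trace depends on `σ` only through `K`. -/
theorem trace_inv_mul_rescaled {K : ℕ} {X : Matrix (Fin n) (Fin d) ℝ}
    {W : Matrix (Fin d) (Fin d) ℝ} (hl : ∀ i, 0 < X i ⬝ᵥ W *ᵥ X i) {s q : ℝ} (hs : 0 < s)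
    (hq : s < q) (σ : Fin K → Fin n) :
    (W * ((rescaled X W s q σ)ᵀ * rescaled X W s q σ)).trace = K * (s / (q - s)) := by
  rw [← Matrix.mul_assoc, trace_mul_comm, ← Matrix.mul_assoc]
  have h1 : ∀ t, (rescaled X W s q σ * W * (rescaled X W s q σ)ᵀ) t t = s / (q - s) := by
    intro t
    have hr : rescaled X W s q σ t =
        √(s / ((X (σ t) ⬝ᵥ W *ᵥ X (σ t)) * (q - s))) • X (σ t) := rfl
    have h2 : (rescaled X W s q σ * W * (rescaled X W s q σ)ᵀ) t t =
        rescaled X W s q σ t ⬝ᵥ W *ᵥ rescaled X W s q σ t := by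
      rw [dotProduct_mulVec]
      rfl
    have h3 := hl (σ t)
    have h4 : 0 < q - s := by linarith
    rw [h2, hr, mulVec_smul, dotProduct_smul, smul_dotProduct, smul_smul, smul_eq_mul,
      Real.mul_self_sqrt (by positivity)]
    field_simp
  simp [trace, h1]

theorem trace_inv_one_add {A : Matrix (Fin d) (Fin d) ℝ} (hA : A.PosSemidef) :
    (1 + A)⁻¹.trace = d - (A * (1 + A)⁻¹).trace := by
  have hu := (isUnit_iff_isUnit_det _).1 (Matrix.PosDef.one.add_posSemidef hA).isUnit
  have h := mul_nonsing_inv _ hu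
  rw [Matrix.add_mul, Matrix.one_mul] at h
  have h' := congrArg trace h
  rw [trace_add, trace_one, Fintype.card_fin] at h'
  linarith

/-- Apply the tangent bound at `I + A` to `c⁻¹ H`, where `c = q / (q - s)` and `H` is the matrix in
the numerator. As `c⁻¹ = 1 - s / q ≤ 1` and `s ≤ d`, the exponent is at most `K s / q - s`, and `exp
(s / q) ≤ c` follows from `1 - x ≤ e^(-x)`. Undoing the scaling costs `c ^ d`, and the product of
these factors is `C_K`. -/
theorem acceptProb_le_one {K : ℕ} {X : Matrix (Fin n) (Fin d) ℝ}
    {A : Matrix (Fin d) (Fin d) ℝ} (hA : A.PosSemidef)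
    (hl : ∀ i, 0 < X i ⬝ᵥ (1 + A)⁻¹ *ᵥ X i) {s q : ℝ} (hsA : s = (A * (1 + A)⁻¹).trace)
    (hs : 0 < s) (hsd : s ≤ d) (hq : s < q) (σ : Fin K → Fin n) :
    acceptProb X (1 + A)⁻¹ (1 + A).det s q σ ≤ 1 := by
  have hP : (1 + A).PosDef := Matrix.PosDef.one.add_posSemidef hA
  have hq0 : 0 < q := hs.trans hq
  have hqs : 0 < q - s := by linarith
  set Y := rescaled X (1 + A)⁻¹ s q σ with hY
  set H := 1 + Yᵀ * Y with hH
  have hHp : H.PosSemidef := (posDef_one_add_transpose_mul_self Y).posSemidef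
  set c := q / (q - s) with hc
  have hc0 : 0 < c := by positivity
  have h1 := det_le_det_mul_exp hP (hHp.smul (inv_nonneg.2 hc0.le))
  have htr : ((1 + A)⁻¹ * H).trace = d - s + K * (s / (q - s)) := by
    rw [hH, Matrix.mul_add, trace_add, Matrix.mul_one, trace_inv_one_add hA, ← hsA, hY,
      trace_inv_mul_rescaled hl hs hq]
  rw [det_smul, Matrix.mul_smul, trace_smul, htr, Fintype.card_fin, smul_eq_mul] at h1
  have hcinv : c⁻¹ = 1 - s / q := by
    rw [hc]
    field_simp
  have hexp : c⁻¹ * (d - s + K * (s / (q - s))) - d ≤ K * (s / q) - s := by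
    have h2 : c⁻¹ * (K * (s / (q - s))) = K * (s / q) := by
      rw [hc]
      field_simp
    have h3 : c⁻¹ * (d - s) ≤ d - s := by
      rw [hcinv]
      have : 0 ≤ s / q := by positivity
      nlinarith [mul_nonneg this (sub_nonneg.2 hsd)]
    linarith [mul_add c⁻¹ ((d : ℝ) - s) (K * (s / (q - s)))]
  have hpow : Real.exp (K * (s / q)) ≤ c ^ K := by
    rw [Real.exp_nat_mul]
    gcongr
    have h4 := Real.add_one_le_exp (-(s / q))
    rw [Real.exp_neg] at h4
    have h5 : c⁻¹ ≤ (Real.exp (s / q))⁻¹ := by rw [hcinv]; linarith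
    exact (inv_le_inv₀ hc0 (Real.exp_pos _)).1 h5
  have hD := hP.det_pos
  rw [acceptProb, div_le_one (by positivity), ← hc, ← hY, ← hH]
  calc H.det = c ^ d * (c⁻¹ ^ d * H.det) := by
        rw [← mul_assoc, ← mul_pow, mul_inv_cancel₀ hc0.ne', one_pow, one_mul]
    _ ≤ c ^ d * ((1 + A).det * Real.exp (c⁻¹ * (d - s + K * (s / (q - s))) - d)) := by
        gcongr
    _ ≤ c ^ d * ((1 + A).det * Real.exp (K * (s / q) - s)) := by gcongr
    _ = c ^ d * ((1 + A).det * (Real.exp (K * (s / q)) * Real.exp (-s))) := by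
        rw [sub_eq_add_neg, Real.exp_add]
    _ ≤ c ^ d * ((1 + A).det * (c ^ K * Real.exp (-s))) := by gcongr
    _ = c ^ (K + d) * Real.exp (-s) * (1 + A).det := by rw [pow_add]; ring

theorem acceptProb_nonneg {K : ℕ} {X : Matrix (Fin n) (Fin d) ℝ} {W : Matrix (Fin d) (Fin d) ℝ}
    {D s q : ℝ} (hD : 0 < D) (hq0 : 0 < q) (hq : s < q) (σ : Fin K → Fin n) :
    0 ≤ acceptProb X W D s q σ := by
  have hqs : 0 < q - s := by linarith
  exact div_nonneg (posDef_one_add_transpose_mul_self _).det_pos.le (by positivity)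

/-- The part of a round of the main loop after sampling the rows. -/
def roundTail {K : ℕ} (X : Matrix (Fin n) (Fin d) ℝ) (D s q : ℝ) (smp : Fin K → Fin n × ℝ) :
    RandComp (Option ((K : ℕ) × (Fin K → Fin n) × Matrix (Fin K) (Fin d) ℝ)) := do
  let Y ← lift (rescaledRows X s q smp)
  let M ← lift (invDet Y Y)
  let cK ← lift (constC s q K d)
  let den ← lift (mul cK D)
  let p ← lift (div M.2 den)
  let acc ← bernoulli p
  return if acc then some ⟨K, fun t => (smp t).1, Y⟩ else none

theorem mainRound_eq (X : Matrix (Fin n) (Fin d) ℝ) (lt : Fin n → ℝ)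
    (W : Matrix (Fin d) (Fin d) ℝ) (D s q : ℝ) :
    mainRound X lt W D s q =
      (poisson q >>= fun K => replicate (rowSample X lt W) K >>= fun smp =>
        roundTail X D s q smp) := rfl

theorem expect_one_roundTail {K : ℕ} {X : Matrix (Fin n) (Fin d) ℝ}
    {W : Matrix (Fin d) (Fin d) ℝ} {D s q : ℝ} (σ : Fin K → Fin n)
    (h0 : 0 ≤ acceptProb X W D s q σ) (h1 : acceptProb X W D s q σ ≤ 1)
    (f : Option ((K : ℕ) × (Fin K → Fin n) × Matrix (Fin K) (Fin d) ℝ) → ℝ≥0∞) :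
    expect 1 (roundTail X D s q fun t => (σ t, X (σ t) ⬝ᵥ W *ᵥ X (σ t))) f =
      ENNReal.ofReal (acceptProb X W D s q σ) * f (some ⟨K, σ, rescaled X W s q σ⟩) +
        ENNReal.ofReal (1 - acceptProb X W D s q σ) * f none := by
  simp only [roundTail, expect_bind, expect_lift, one_pow, one_mul, val_rescaledRows,
    val_invDet_self, val_constC, val_mul, val_div]
  refine (expect_bernoulli h0 h1 _).trans ?_
  simp [expect_pure]

theorem expect_one_mainRound [NeZero n] {X : Matrix (Fin n) (Fin d) ℝ} {lt : Fin n → ℝ}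
    {W : Matrix (Fin d) (Fin d) ℝ} {D s q : ℝ} (hl : ∀ i, 0 < X i ⬝ᵥ W *ᵥ X i)
    (hlt : ∀ i, X i ⬝ᵥ W *ᵥ X i ≤ 2 * lt i)
    (h0 : ∀ (K : ℕ) (σ : Fin K → Fin n), 0 ≤ acceptProb X W D s q σ)
    (h1 : ∀ (K : ℕ) (σ : Fin K → Fin n), acceptProb X W D s q σ ≤ 1)
    (f : Option ((K : ℕ) × (Fin K → Fin n) × Matrix (Fin K) (Fin d) ℝ) → ℝ≥0∞) :
    expect 1 (mainRound X lt W D s q) f =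
      ∑' K, ProbabilityTheory.poissonMeasure q.toNNReal {K} * ∑ σ : Fin K → Fin n,
        (∏ t, ENNReal.ofReal ((X (σ t) ⬝ᵥ W *ᵥ X (σ t)) / ∑ j, X j ⬝ᵥ W *ᵥ X j)) *
          (ENNReal.ofReal (acceptProb X W D s q σ) * f (some ⟨K, σ, rescaled X W s q σ⟩) +
            ENNReal.ofReal (1 - acceptProb X W D s q σ) * f none) := by
  rw [mainRound_eq, expect_bind, expect_poisson]
  refine tsum_congr fun K => ?_
  rw [one_pow, mul_one, expect_bind]
  congr 1
  rw [expect_replicate _ (fun i => ENNReal.ofReal ((X i ⬝ᵥ W *ᵥ X i) / ∑ j, X j ⬝ᵥ W *ᵥ X j))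
    (fun i => (i, X i ⬝ᵥ W *ᵥ X i)) (expect_one_rowSample hl hlt)]
  exact Finset.sum_congr rfl fun σ _ => congrArg _ (expect_one_roundTail σ (h0 K σ) (h1 K σ) f)

theorem sum_ofReal_div_sum [NeZero n] {w : Fin n → ℝ} (hw : ∀ i, 0 < w i) :
    ∑ i, ENNReal.ofReal (w i / ∑ j, w j) = 1 := by
  have h : 0 < ∑ j, w j := Finset.sum_pos (fun j _ => hw j) Finset.univ_nonempty
  rw [← ENNReal.ofReal_sum_of_nonneg fun i _ => div_nonneg (hw i).le h.le, ← Finset.sum_div,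
    div_self h.ne', ENNReal.ofReal_one]

theorem sum_prod_eq_one {w : Fin n → ℝ≥0∞} (hw : ∑ i, w i = 1) (K : ℕ) :
    ∑ σ : Fin K → Fin n, ∏ t, w (σ t) = 1 := by
  have h4 := Finset.prod_univ_sum (fun _ : Fin K => (Finset.univ : Finset (Fin n))) fun _ i => w i
  rw [Fintype.piFinset_univ] at h4
  rw [← h4]
  simp [hw]

theorem tsum_poisson (q : ℝ) :
    ∑' K, ProbabilityTheory.poissonMeasure q.toNNReal {K} = 1 := by
  have h := tsum_poisson_mul_descFactorial q.toNNReal.2 0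
  simp only [Nat.descFactorial_zero, Nat.cast_one, mul_one, pow_zero] at h
  rw [← h]
  exact tsum_congr fun K => ProbabilityTheory.poissonMeasure_singleton _ _

theorem expect_one_mainRound_one [NeZero n] {X : Matrix (Fin n) (Fin d) ℝ} {lt : Fin n → ℝ}
    {W : Matrix (Fin d) (Fin d) ℝ} {D s q : ℝ} (hl : ∀ i, 0 < X i ⬝ᵥ W *ᵥ X i)
    (hlt : ∀ i, X i ⬝ᵥ W *ᵥ X i ≤ 2 * lt i)
    (h0 : ∀ (K : ℕ) (σ : Fin K → Fin n), 0 ≤ acceptProb X W D s q σ)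
    (h1 : ∀ (K : ℕ) (σ : Fin K → Fin n), acceptProb X W D s q σ ≤ 1) :
    expect 1 (mainRound X lt W D s q) (fun _ => 1) = 1 := by
  rw [expect_one_mainRound hl hlt h0 h1]
  refine (tsum_congr fun K => ?_).trans (tsum_poisson q)
  have h2 : ∀ σ : Fin K → Fin n, ENNReal.ofReal (acceptProb X W D s q σ) * 1 +
      ENNReal.ofReal (1 - acceptProb X W D s q σ) * 1 = 1 := fun σ => by
    rw [mul_one, mul_one, ← ENNReal.ofReal_add (h0 K σ) (by linarith [h1 K σ])]
    simp
  exact (congrArg _ ((Finset.sum_congr rfl fun σ _ => (congrArg _ (h2 σ)).trans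
    (mul_one _)).trans (sum_prod_eq_one (sum_ofReal_div_sum hl) K))).trans (mul_one _)

theorem dppWeight_rescaled {K : ℕ} {X : Matrix (Fin n) (Fin d) ℝ} {W : Matrix (Fin d) (Fin d) ℝ}
    (hl : ∀ i, 0 < X i ⬝ᵥ W *ᵥ X i) {s q : ℝ} (hs : 0 < s) (hq : s < q) (σ : Fin K → Fin n)
    (T : Finset (Fin K)) :
    dppWeight (rescaled X W s q σ) T =
      (∏ t : T, s / ((X (σ t) ⬝ᵥ W *ᵥ X (σ t)) * (q - s))) *
        ((X * Xᵀ).submatrix (fun t : T => σ t) fun t : T => σ t).det := by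
  rw [dppWeight_eq_det_submatrix]
  have h1 : (rescaled X W s q σ * (rescaled X W s q σ)ᵀ).submatrix
      (fun i : T => (i : Fin K)) (fun i : T => (i : Fin K)) =
      diagonal (fun t : T => √(s / ((X (σ t) ⬝ᵥ W *ᵥ X (σ t)) * (q - s)))) *
        ((X * Xᵀ).submatrix (fun t : T => σ t) fun t : T => σ t) *
      diagonal (fun t : T => √(s / ((X (σ t) ⬝ᵥ W *ᵥ X (σ t)) * (q - s)))) := by
    ext i j
    rw [mul_diagonal, diagonal_mul, submatrix_apply, submatrix_apply, Matrix.mul_apply,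
      Matrix.mul_apply, Finset.mul_sum, Finset.sum_mul]
    refine Finset.sum_congr rfl fun l _ => ?_
    simp only [rescaled, of_apply, transpose_apply]
    ring
  rw [h1, det_mul, det_mul, det_diagonal, mul_right_comm, ← Finset.prod_mul_distrib]
  congr 1
  refine Finset.prod_congr rfl fun t _ => Real.mul_self_sqrt ?_
  have := hl (σ t)
  have h4 : 0 < q - s := by linarith
  positivity

/-- The weight of the sets that the final step extracts from `K` independent rows. -/
theorem sum_prod_mul_dppWeight_rescaled [NeZero n] {K : ℕ} {X : Matrix (Fin n) (Fin d) ℝ}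
    {W : Matrix (Fin d) (Fin d) ℝ} (hl : ∀ i, 0 < X i ⬝ᵥ W *ᵥ X i) {s q : ℝ} (hs : 0 < s)
    (hq : s < q) (f : Finset (Fin n) → ℝ≥0∞) :
    ∑ σ : Fin K → Fin n,
      (∏ t, ENNReal.ofReal ((X (σ t) ⬝ᵥ W *ᵥ X (σ t)) / ∑ j, X j ⬝ᵥ W *ᵥ X j)) *
        ∑ T : Finset (Fin K), ENNReal.ofReal (dppWeight (rescaled X W s q σ) T) * f (T.image σ) =
    ∑ S : Finset (Fin n), (K.descFactorial S.card : ℝ≥0∞) *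
      ENNReal.ofReal (s / ((∑ j, X j ⬝ᵥ W *ᵥ X j) * (q - s))) ^ S.card *
        (ENNReal.ofReal (dppWeight X S) * f S) := by
  have hL : 0 < ∑ j, X j ⬝ᵥ W *ᵥ X j := Finset.sum_pos (fun j _ => hl j) Finset.univ_nonempty
  have hqs : 0 < q - s := by linarith
  set L := ∑ j, X j ⬝ᵥ W *ᵥ X j with hLdef
  -- For a fixed set `T` of positions only the restriction of `σ` to `T` matters.
  have hT : ∀ T : Finset (Fin K), ∑ σ : Fin K → Fin n,
      (∏ t, ENNReal.ofReal ((X (σ t) ⬝ᵥ W *ᵥ X (σ t)) / L)) *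
        (ENNReal.ofReal (dppWeight (rescaled X W s q σ) T) * f (T.image σ)) =
      ∑ S : Finset (Fin n), if S.card = T.card then
        (T.card.factorial : ℝ≥0∞) * ENNReal.ofReal (s / (L * (q - s))) ^ T.card *
          (ENNReal.ofReal (dppWeight X S) * f S) else 0 := by
    intro T
    have h1 := sum_prod_mul_restrict (fun i => ENNReal.ofReal ((X i ⬝ᵥ W *ᵥ X i) / L))
      (sum_ofReal_div_sum hl) T fun τ => ENNReal.ofReal
        ((∏ t : T, s / ((X (τ t) ⬝ᵥ W *ᵥ X (τ t)) * (q - s))) *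
        ((X * Xᵀ).submatrix τ τ).det) * f (Finset.univ.image τ)
    have h2 : ∀ σ : Fin K → Fin n, Finset.univ.image (fun t : T => σ t) = T.image σ := by
      intro σ
      ext i
      simp
    simp only [h2, ← dppWeight_rescaled hl hs hq] at h1
    rw [h1]
    have h3 : ∀ τ : T → Fin n, (∏ t, ENNReal.ofReal ((X (τ t) ⬝ᵥ W *ᵥ X (τ t)) / L)) *
        (ENNReal.ofReal ((∏ t : T, s / ((X (τ t) ⬝ᵥ W *ᵥ X (τ t)) * (q - s))) *
        ((X * Xᵀ).submatrix τ τ).det) * f (Finset.univ.image τ)) =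
        ENNReal.ofReal (s / (L * (q - s))) ^ T.card *
          (ENNReal.ofReal ((X * Xᵀ).submatrix τ τ).det * f (Finset.univ.image τ)) := by
      intro τ
      have h4 : ∀ t, 0 ≤ (X (τ t) ⬝ᵥ W *ᵥ X (τ t)) / L := fun t => div_nonneg (hl _).le hL.le
      have h5 : ∀ t, 0 ≤ s / ((X (τ t) ⬝ᵥ W *ᵥ X (τ t)) * (q - s)) := fun t => by
        have := hl (τ t)
        positivity
      rw [ENNReal.ofReal_mul (Finset.prod_nonneg fun t _ => h5 t),
        ENNReal.ofReal_prod_of_nonneg fun t _ => h5 t, ← mul_assoc, ← mul_assoc,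
        ← Finset.prod_mul_distrib]
      -- The purpose of the rescaling: the scores cancel, and each position carries the same factor.
      have h6 : ∀ t : T, ENNReal.ofReal ((X (τ t) ⬝ᵥ W *ᵥ X (τ t)) / L) *
          ENNReal.ofReal (s / ((X (τ t) ⬝ᵥ W *ᵥ X (τ t)) * (q - s))) =
          ENNReal.ofReal (s / (L * (q - s))) := by
        intro t
        rw [← ENNReal.ofReal_mul (h4 t)]
        congr 1
        have := (hl (τ t)).ne'
        field_simp
      simp_rw [h6]
      rw [Finset.prod_const, Finset.card_univ, Fintype.card_coe, mul_assoc]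
    simp_rw [h3]
    rw [← Finset.mul_sum, sum_det_gram_mul, Finset.mul_sum, Fintype.card_coe]
    refine Finset.sum_congr rfl fun S _ => ?_
    split_ifs
    · ring
    · rw [mul_zero]
  simp_rw [Finset.mul_sum]
  rw [Finset.sum_comm]
  simp_rw [hT]
  rw [Finset.sum_comm]
  refine Finset.sum_congr rfl fun S _ => ?_
  rw [← Finset.sum_filter]
  -- Summing over the sets of positions of size `k` gives `K.choose k * k! = K.descFactorial k`.
  have h7 : (Finset.univ.filter fun T : Finset (Fin K) => S.card = T.card) =
      Finset.powersetCard S.card Finset.univ := by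
    ext T
    simp [Finset.mem_powersetCard, eq_comm]
  rw [h7, Finset.sum_congr rfl fun T hT' => by rw [(Finset.mem_powersetCard.1 hT').2],
    Finset.sum_const, Finset.card_powersetCard, Finset.card_univ, Fintype.card_fin, nsmul_eq_mul,
    Nat.descFactorial_eq_factorial_mul_choose]
  push_cast
  ring

/-- The output of an accepted round, fed into the final step. -/
theorem expect_one_mainRound_dppSample [NeZero n] {X : Matrix (Fin n) (Fin d) ℝ} {lt : Fin n → ℝ}
    {W : Matrix (Fin d) (Fin d) ℝ} {D s q : ℝ} (hl : ∀ i, 0 < X i ⬝ᵥ W *ᵥ X i)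
    (hlt : ∀ i, X i ⬝ᵥ W *ᵥ X i ≤ 2 * lt i) (hD : 0 < D) (hs : 0 < s) (hq : s < q)
    (h1 : ∀ (K : ℕ) (σ : Fin K → Fin n), acceptProb X W D s q σ ≤ 1)
    (f : Finset (Fin n) → ℝ≥0∞) :
    expect 1 (mainRound X lt W D s q) (fun r => r.elim 0 fun r =>
      expect 1 (dppSample r.2.2) fun S => f (S.image r.2.1)) =
      ENNReal.ofReal ((1 - s / q) ^ d / D) * ∑ S : Finset (Fin n),
        ENNReal.ofReal ((s / ∑ j, X j ⬝ᵥ W *ᵥ X j) ^ S.card * dppWeight X S) * f S := by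
  have hL : 0 < ∑ j, X j ⬝ᵥ W *ᵥ X j := Finset.sum_pos (fun j _ => hl j) Finset.univ_nonempty
  have hq0 : 0 < q := hs.trans hq
  have hqs : 0 < q - s := by linarith
  set L := ∑ j, X j ⬝ᵥ W *ᵥ X j with hLdef
  have hc : 0 < 1 - s / q := by
    rw [sub_pos, div_lt_one hq0]
    exact hq
  have hc' : q / (q - s) = (1 - s / q)⁻¹ := by field_simp
  -- The numerator of the acceptance probability is the normalizing constant of the final DPP.
  have h2 : ∀ (K : ℕ) (σ : Fin K → Fin n), ENNReal.ofReal (acceptProb X W D s q σ) *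
      (expect 1 (dppSample (rescaled X W s q σ)) fun S => f (S.image σ)) =
      ENNReal.ofReal (1 / ((q / (q - s)) ^ (K + d) * Real.exp (-s) * D)) *
      ∑ T : Finset (Fin K), ENNReal.ofReal (dppWeight (rescaled X W s q σ) T) * f (T.image σ) := by
    intro K σ
    rw [expect_one_dppSample, Finset.mul_sum, Finset.mul_sum]
    refine Finset.sum_congr rfl fun T _ => ?_
    rw [← mul_assoc, ← mul_assoc, ← ENNReal.ofReal_mul (acceptProb_nonneg hD hq0 hq σ),
      ← ENNReal.ofReal_mul (by positivity), dpp_eq, acceptProb]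
    congr 2
    have := (posDef_one_add_transpose_mul_self (rescaled X W s q σ)).det_pos.ne'
    field_simp
  rw [expect_one_mainRound hl hlt (fun K σ => acceptProb_nonneg hD hq0 hq σ) h1]
  have h3 : ∀ K : ℕ, ∑ σ : Fin K → Fin n,
      (∏ t, ENNReal.ofReal ((X (σ t) ⬝ᵥ W *ᵥ X (σ t)) / L)) *
      (ENNReal.ofReal (1 / ((q / (q - s)) ^ (K + d) * Real.exp (-s) * D)) *
      ∑ T : Finset (Fin K), ENNReal.ofReal (dppWeight (rescaled X W s q σ) T) * f (T.image σ)) =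
      ENNReal.ofReal (1 / ((q / (q - s)) ^ (K + d) * Real.exp (-s) * D)) *
      ∑ S : Finset (Fin n), (K.descFactorial S.card : ℝ≥0∞) *
      ENNReal.ofReal (s / (L * (q - s))) ^ S.card * (ENNReal.ofReal (dppWeight X S) * f S) := by
    intro K
    rw [← sum_prod_mul_dppWeight_rescaled hl hs hq, Finset.mul_sum]
    exact Finset.sum_congr rfl fun σ _ => mul_left_comm _ _ _
  refine (tsum_congr fun K => congrArg _ ((Finset.sum_congr rfl fun σ _ => congrArg _
    ((congrArg₂ (· + ·) rfl (mul_zero _)).trans ((add_zero _).trans (h2 K σ)))).trans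
    (h3 K))).trans ?_
  -- Exponential tilting: the factor `(1 - s / q) ^ K * exp s` from `1 / C_K` turns Poisson(q) into
  -- Poisson(q - s).
  have h4 : ∀ K : ℕ, ProbabilityTheory.poissonMeasure q.toNNReal {K} *
      ENNReal.ofReal (1 / ((q / (q - s)) ^ (K + d) * Real.exp (-s) * D)) =
      ENNReal.ofReal ((1 - s / q) ^ d / D) *
        ENNReal.ofReal (Real.exp (-(q - s)) * (q - s) ^ K / K.factorial) := by
    intro K
    rw [ProbabilityTheory.poissonMeasure_singleton, Real.coe_toNNReal _ hq0.le,
      ← ENNReal.ofReal_mul (by positivity), ← ENNReal.ofReal_mul (by positivity), hc',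
      neg_sub, sub_eq_add_neg s q, Real.exp_add, Real.exp_neg s]
    congr 1
    have h5 : q - s = q * (1 - s / q) := by field_simp
    rw [h5, pow_add, mul_pow, inv_pow, inv_pow]
    have := hc.ne'
    have := hq0.ne'
    field_simp
  simp_rw [← mul_assoc, h4, mul_assoc]
  rw [ENNReal.tsum_mul_left]
  congr 1
  simp_rw [Finset.mul_sum]
  rw [Summable.tsum_finsetSum fun _ _ => ENNReal.summable]
  refine Finset.sum_congr rfl fun S _ => ?_
  simp_rw [← mul_assoc]
  rw [ENNReal.tsum_mul_right, ENNReal.tsum_mul_right, ENNReal.tsum_mul_right,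
    tsum_poisson_mul_descFactorial hqs.le, ← mul_pow, ← ENNReal.ofReal_mul hqs.le,
    ← ENNReal.ofReal_pow (by positivity), ← ENNReal.ofReal_mul (by positivity)]
  congr 4
  field_simp

end DPP

/-! ### The law of the output and its distance from the target. -/

namespace DPP

open Matrix RandComp Timed

variable {n d : ℕ}

/-- The sum `∑ i, l_i` of the ridge leverage scores. -/
def scoreSum (X : Matrix (Fin n) (Fin d) ℝ) (A : Matrix (Fin d) (Fin d) ℝ) : ℝ :=
  ∑ i, X i ⬝ᵥ (1 + A)⁻¹ *ᵥ X i

/-- `tr (A (I + A)⁻¹)`. -/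
def effDim (A : Matrix (Fin d) (Fin d) ℝ) : ℝ := (A * (1 + A)⁻¹).trace

/-- The mean of the Poisson variable in the main loop. -/
def poissonRate (A : Matrix (Fin d) (Fin d) ℝ) : ℝ := ⌈2 * (d : ℝ) * effDim A⌉

/-- The rounds of the main loop on the given input. -/
def inputRound (X : Matrix (Fin n) (Fin d) ℝ) (A : Matrix (Fin d) (Fin d) ℝ) (lt : Fin n → ℝ) :
    RandComp (Option ((K : ℕ) × (Fin K → Fin n) × Matrix (Fin K) (Fin d) ℝ)) :=
  mainRound X lt (1 + A)⁻¹ (1 + A).det (effDim A) (poissonRate A)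

/-- The hypotheses on the input, for an accuracy `η` that is small compared to `1 / s̄`. -/
structure IsAdmissible (X : Matrix (Fin n) (Fin d) ℝ) (A : Matrix (Fin d) (Fin d) ℝ)
    (lt : Fin n → ℝ) (η : ℝ) : Prop where
  pos : 0 < n
  row_ne_zero : ∀ i, X i ≠ 0
  eta_nonneg : 0 ≤ η
  eta_mul_sBar_le : η * sBar X ≤ 1 / 4
  lower : (A - (1 - η) • (Xᵀ * X)).PosSemidef
  upper : ((1 + η) • (Xᵀ * X) - A).PosSemidef
  oracle_lower : ∀ i, 1 / 2 * (X i ⬝ᵥ (1 + A)⁻¹ *ᵥ X i) ≤ lt i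
  oracle_upper : ∀ i, lt i ≤ 3 / 2 * (X i ⬝ᵥ (1 + A)⁻¹ *ᵥ X i)

theorem sum_dotProduct_mulVec (X : Matrix (Fin n) (Fin d) ℝ) (W : Matrix (Fin d) (Fin d) ℝ) :
    ∑ i, X i ⬝ᵥ W *ᵥ X i = (W * (Xᵀ * X)).trace := by
  rw [← Matrix.mul_assoc, trace_mul_comm, ← Matrix.mul_assoc, trace]
  refine Finset.sum_congr rfl fun i _ => ?_
  rw [dotProduct_mulVec]
  rfl

theorem one_le_sBar (X : Matrix (Fin n) (Fin d) ℝ) : 1 ≤ sBar X := le_max_left _ _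

theorem dppSize_le_sBar (X : Matrix (Fin n) (Fin d) ℝ) : dppSize X ≤ sBar X := le_max_right _ _

theorem expect_one_dppSample_one {k : ℕ} (Y : Matrix (Fin k) (Fin d) ℝ) :
    expect 1 (dppSample Y) (fun _ => 1) = 1 := by
  rw [expect_one_dppSample]
  simp only [mul_one]
  rw [← ENNReal.ofReal_sum_of_nonneg fun S _ => dpp_nonneg Y S, sum_dpp, ENNReal.ofReal_one]

namespace IsAdmissible

variable {X : Matrix (Fin n) (Fin d) ℝ} {A : Matrix (Fin d) (Fin d) ℝ} {lt : Fin n → ℝ} {η : ℝ}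

theorem eta_le (h : IsAdmissible X A lt η) : η ≤ 1 / 4 := by
  have := mul_le_mul_of_nonneg_left (one_le_sBar X) h.eta_nonneg
  linarith [h.eta_mul_sBar_le]

theorem neZero (h : IsAdmissible X A lt η) : NeZero n := ⟨h.pos.ne'⟩

theorem one_le_dim (h : IsAdmissible X A lt η) : 1 ≤ d := by
  rcases Nat.eq_zero_or_pos d with rfl | hd
  · exact absurd (Subsingleton.elim _ _) (h.row_ne_zero ⟨0, h.pos⟩)
  · exact hd

theorem posSemidef (h : IsAdmissible X A lt η) : A.PosSemidef := by
  have h1 : 0 ≤ 1 - η := by linarith [h.eta_le]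
  simpa using h.lower.add ((transpose_mul_self_posSemidef X).smul h1)

theorem posDef (h : IsAdmissible X A lt η) : (1 + A).PosDef :=
  Matrix.PosDef.one.add_posSemidef h.posSemidef

theorem score_pos (h : IsAdmissible X A lt η) (i : Fin n) :
    0 < X i ⬝ᵥ (1 + A)⁻¹ *ᵥ X i := by
  simpa using h.posDef.inv.dotProduct_mulVec_pos (h.row_ne_zero i)

theorem score_le (h : IsAdmissible X A lt η) (i : Fin n) :
    X i ⬝ᵥ (1 + A)⁻¹ *ᵥ X i ≤ 2 * lt i := by
  linarith [h.oracle_lower i]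

theorem scoreSum_pos (h : IsAdmissible X A lt η) : 0 < scoreSum X A :=
  Finset.sum_pos (fun i _ => h.score_pos i) ⟨⟨0, h.pos⟩, Finset.mem_univ _⟩

/-- The trace of a product of semidefinite matrices is nonnegative; take `A - (1 - η) G` and `(I +
A)⁻¹`, and note `∑ l_i = tr ((I + A)⁻¹ G)`. -/
theorem mul_scoreSum_le_effDim (h : IsAdmissible X A lt η) :
    (1 - η) * scoreSum X A ≤ effDim A := by
  have h1 := trace_mul_nonneg h.lower h.posDef.inv.posSemidef
  rw [Matrix.sub_mul, trace_sub, Matrix.smul_mul, trace_smul, trace_mul_comm (Xᵀ * X),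
    ← sum_dotProduct_mulVec, smul_eq_mul] at h1
  exact sub_nonneg.1 h1

theorem effDim_le_mul_scoreSum (h : IsAdmissible X A lt η) :
    effDim A ≤ (1 + η) * scoreSum X A := by
  have h1 := trace_mul_nonneg h.upper h.posDef.inv.posSemidef
  rw [Matrix.sub_mul, trace_sub, Matrix.smul_mul, trace_smul, trace_mul_comm (Xᵀ * X),
    ← sum_dotProduct_mulVec, smul_eq_mul] at h1
  exact sub_nonneg.1 h1

theorem effDim_pos (h : IsAdmissible X A lt η) : 0 < effDim A :=
  lt_of_lt_of_le (mul_pos (by linarith [h.eta_le]) h.scoreSum_pos) h.mul_scoreSum_le_effDim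

theorem effDim_le_dim (h : IsAdmissible X A lt η) : effDim A ≤ d := by
  have h1 := trace_inv_one_add h.posSemidef
  have h2 := h.posDef.inv.posSemidef.trace_nonneg
  have h3 : effDim A = (A * (1 + A)⁻¹).trace := rfl
  linarith

theorem le_poissonRate (_h : IsAdmissible X A lt η) :
    2 * (d : ℝ) * effDim A ≤ poissonRate A := Int.le_ceil _

theorem effDim_lt_poissonRate (h : IsAdmissible X A lt η) : effDim A < poissonRate A := by
  have h1 : (1 : ℝ) ≤ d := by exact_mod_cast h.one_le_dim
  nlinarith [h.le_poissonRate, h.effDim_pos]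

theorem ratio_lower (h : IsAdmissible X A lt η) : 1 - η ≤ effDim A / scoreSum X A :=
  (le_div_iff₀ h.scoreSum_pos).2 h.mul_scoreSum_le_effDim

theorem ratio_upper (h : IsAdmissible X A lt η) : effDim A / scoreSum X A ≤ 1 + η :=
  (div_le_iff₀ h.scoreSum_pos).2 h.effDim_le_mul_scoreSum

theorem ratio_pos (h : IsAdmissible X A lt η) : 0 < effDim A / scoreSum X A :=
  div_pos h.effDim_pos h.scoreSum_pos

theorem acceptProb_le_one (h : IsAdmissible X A lt η) (K : ℕ) (σ : Fin K → Fin n) :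
    acceptProb X (1 + A)⁻¹ (1 + A).det (effDim A) (poissonRate A) σ ≤ 1 :=
  DPP.acceptProb_le_one h.posSemidef h.score_pos rfl h.effDim_pos h.effDim_le_dim
    h.effDim_lt_poissonRate σ

/-- The preprocessing has deterministic cost: `8 d³ + 7 d² + 4 d` for the inverse and determinant,
`2 d² + d` for the trace, and 3 for `q`. -/
theorem expect_fastDPP (h : IsAdmissible X A lt η) (z : ℝ≥0∞) (f : Finset (Fin n) → ℝ≥0∞) :
    expect z (fastDPP X A lt) f =
      z ^ (8 * d ^ 3 + 9 * d ^ 2 + 5 * d + 3) * expect z (loop (inputRound X A lt)) fun r =>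
        expect z (dppSample r.2.2) fun S => f (S.image r.2.1) := by
  have h1 : expect z (fastDPP X A lt) f =
      z ^ (invDetOneAdd A).time * (z ^ (traceMul A (invDetOneAdd A).val.1).time *
        (z * (z * (z * expect z (loop (mainRound X lt (invDetOneAdd A).val.1
          (invDetOneAdd A).val.2 (A * (invDetOneAdd A).val.1).trace
          ⌈2 * (d : ℝ) * (A * (invDetOneAdd A).val.1).trace⌉)) fun r =>
        expect z (dppSample r.2.2) fun S => f (S.image r.2.1))))) := by
    simp only [fastDPP, expect_bind, expect_lift, val_traceMul, val_mul, val_ceil, time_mul,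
      time_ceil, pow_one, expect_pure]
  rw [h1, val_invDetOneAdd h.posSemidef, time_traceMul, time_invDetOneAdd]
  change _ * (_ * (z * (z * (z * expect z (loop (inputRound X A lt)) _)))) = _
  ring

theorem expect_one_round (h : IsAdmissible X A lt η) (f : Finset (Fin n) → ℝ≥0∞) :
    expect 1 (inputRound X A lt) (fun r => r.elim 0 fun r =>
      expect 1 (dppSample r.2.2) fun S => f (S.image r.2.1)) =
      ENNReal.ofReal ((1 - effDim A / poissonRate A) ^ d / (1 + A).det) *
        ∑ S : Finset (Fin n),
        ENNReal.ofReal ((effDim A / scoreSum X A) ^ S.card * dppWeight X S) * f S := by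
  have := h.neZero
  exact expect_one_mainRound_dppSample h.score_pos h.score_le h.posDef.det_pos h.effDim_pos
    h.effDim_lt_poissonRate h.acceptProb_le_one f

theorem one_sub_pos (h : IsAdmissible X A lt η) : 0 < 1 - effDim A / poissonRate A := by
  rw [sub_pos, div_lt_one (h.effDim_pos.trans h.effDim_lt_poissonRate)]
  exact h.effDim_lt_poissonRate

/-- The probability of success of a round. -/
theorem expect_one_round_some (h : IsAdmissible X A lt η) :
    expect 1 (inputRound X A lt) (fun r => r.elim 0 fun _ => 1) =
      ENNReal.ofReal ((1 - effDim A / poissonRate A) ^ d / (1 + A).det) *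
        ENNReal.ofReal (1 + (effDim A / scoreSum X A) • (Xᵀ * X)).det := by
  have h1 := h.expect_one_round fun _ => 1
  simp only [expect_one_dppSample_one, mul_one] at h1
  rw [h1, ← ENNReal.ofReal_sum_of_nonneg, sum_pow_card_mul_dppWeight X h.ratio_pos.le]
  exact fun S _ => mul_nonneg (pow_nonneg h.ratio_pos.le _) (dppWeight_nonneg X S)

theorem expect_one_round_one (h : IsAdmissible X A lt η) :
    expect 1 (inputRound X A lt) (fun _ => 1) = 1 := by
  have := h.neZero
  exact expect_one_mainRound_one h.score_pos h.score_le
    (fun K σ => acceptProb_nonneg h.posDef.det_pos (h.effDim_pos.trans h.effDim_lt_poissonRate)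
      h.effDim_lt_poissonRate σ) h.acceptProb_le_one

/-- The algorithm samples exactly from a rescaled point process. -/
theorem expect_one_fastDPP (h : IsAdmissible X A lt η) (f : Finset (Fin n) → ℝ≥0∞) :
    expect 1 (fastDPP X A lt) f =
      ∑ S, ENNReal.ofReal (dpp (√(effDim A / scoreSum X A) • X) S) * f S := by
  have ht := h.ratio_pos
  have hZ : 0 < (1 + (effDim A / scoreSum X A) • (Xᵀ * X)).det :=
    (Matrix.PosDef.one.add_posSemidef ((transpose_mul_self_posSemidef X).smul ht.le)).det_pos
  have hκ : 0 < (1 - effDim A / poissonRate A) ^ d / (1 + A).det :=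
    div_pos (pow_pos h.one_sub_pos _) h.posDef.det_pos
  rw [h.expect_fastDPP, one_pow, one_mul, expect_one_loop _ h.expect_one_round_one,
    h.expect_one_round, h.expect_one_round_some,
    ENNReal.mul_div_mul_left _ _ (by simpa using hκ) ENNReal.ofReal_ne_top, div_eq_mul_inv,
    Finset.sum_mul]
  refine Finset.sum_congr rfl fun S _ => ?_
  rw [mul_right_comm, ← div_eq_mul_inv, ← ENNReal.ofReal_div_of_pos hZ, dpp_eq, dppWeight_smul,
    smul_transpose_mul_smul, Real.sq_sqrt ht.le]

theorem law_fastDPP (h : IsAdmissible X A lt η) (S : Finset (Fin n)) :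
    (fastDPP X A lt).law S = ENNReal.ofReal (dpp (√(effDim A / scoreSum X A) • X) S) := by
  rw [law_eq_expect, h.expect_one_fastDPP]
  simp

theorem abs_sqrt_sub_one_le (h : IsAdmissible X A lt η) :
    |√(effDim A / scoreSum X A) - 1| ≤ η := by
  have h0 := Real.sqrt_nonneg (effDim A / scoreSum X A)
  have h1 := Real.sq_sqrt h.ratio_pos.le
  have h2 := h.ratio_lower
  have h3 := h.ratio_upper
  have h4 := h.eta_nonneg
  rw [abs_le]
  constructor <;> nlinarith

end IsAdmissible

/-- Two determinantal point processes with proportional matrices are close if the factors are. -/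
theorem sum_abs_sub_le {X : Matrix (Fin n) (Fin d) ℝ} {lam : Fin d → ℝ} (hl : ∀ i, 0 ≤ lam i)
    (hdet : ∀ t : ℝ, (1 + t • (Xᵀ * X)).det = ∏ i, (1 + t * lam i)) {a b : ℝ} (ha : 0 < a)
    (hab : a ≤ b) :
    ∑ S, |dpp (√a • X) S - dpp (√b • X) S| ≤ 2 * ((b - a) * ∑ i, lam i / (1 + a * lam i)) := by
  have hb := ha.trans_le hab
  have hpos : ∀ t : ℝ, 0 < t → ∀ i, 0 < 1 + t * lam i := fun t ht i => by
    have := mul_nonneg ht.le (hl i); linarith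
  set x := (b - a) * ∑ i, lam i / (1 + a * lam i) with hx
  have hZ : ∀ t : ℝ, 0 < t → 0 < (1 + t • (Xᵀ * X)).det := fun t ht => by
    rw [hdet]; exact Finset.prod_pos fun i _ => hpos t ht i
  -- Factor by factor, `1 + b λ = (1 + a λ) (1 + (b - a) λ / (1 + a λ))`, and `1 + y ≤ exp y`.
  have hZab : (1 + b • (Xᵀ * X)).det ≤ (1 + a • (Xᵀ * X)).det * Real.exp x := by
    rw [hdet, hdet, hx, Finset.mul_sum, Real.exp_sum, ← Finset.prod_mul_distrib]
    refine Finset.prod_le_prod (fun i _ => (hpos b hb i).le) fun i _ => ?_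
    have h1 := Real.add_one_le_exp ((b - a) * (lam i / (1 + a * lam i)))
    have h2 := mul_le_mul_of_nonneg_left h1 (hpos a ha i).le
    refine le_trans (le_of_eq ?_) h2
    have h3 := (hpos a ha i).ne'
    have h4 : (1 + a * lam i) * (lam i / (1 + a * lam i)) = lam i := by field_simp
    rw [mul_add, mul_left_comm, h4]
    ring
  have hratio : 1 - x ≤ (1 + a • (Xᵀ * X)).det / (1 + b • (Xᵀ * X)).det := by
    rw [le_div_iff₀ (hZ b hb)]
    have h1 := Real.add_one_le_exp (-x)
    calc (1 - x) * (1 + b • (Xᵀ * X)).det ≤ Real.exp (-x) * (1 + b • (Xᵀ * X)).det := by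
          refine mul_le_mul_of_nonneg_right (by linarith) (hZ b hb).le
      _ ≤ Real.exp (-x) * ((1 + a • (Xᵀ * X)).det * Real.exp x) := by gcongr
      _ = (1 + a • (Xᵀ * X)).det := by
          rw [mul_left_comm, ← Real.exp_add]; simp
  have hdpp : ∀ t : ℝ, 0 < t → ∀ S, dpp (√t • X) S =
      t ^ S.card * dppWeight X S / (1 + t • (Xᵀ * X)).det := fun t ht S => by
    rw [dpp_eq, dppWeight_smul, smul_transpose_mul_smul, Real.sq_sqrt ht.le]
  -- The unnormalized weights increase with the factor, so only the normalizing constants can make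
  -- the second mass function smaller.
  have hle : ∀ S, dpp (√a • X) S * (1 - x) ≤ dpp (√b • X) S := by
    intro S
    refine (mul_le_mul_of_nonneg_left hratio (dpp_nonneg _ S)).trans ?_
    rw [hdpp a ha, hdpp b hb, div_mul_div_comm, mul_comm (a ^ S.card * dppWeight X S),
      mul_div_mul_left _ _ (hZ a ha).ne']
    have := (hZ b hb).le
    have := dppWeight_nonneg X S
    gcongr
  have hx0 : 0 ≤ x := mul_nonneg (by linarith)
    (Finset.sum_nonneg fun i _ => div_nonneg (hl i) (hpos a ha i).le)
  -- The one-sided bound suffices: the difference subtracted on the right sums to zero, because both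
  -- masses are 1.
  have habs : ∀ S, |dpp (√a • X) S - dpp (√b • X) S| ≤
      2 * (x * dpp (√a • X) S) - (dpp (√a • X) S - dpp (√b • X) S) := by
    intro S
    have h1 := hle S
    have h2 := mul_nonneg hx0 (dpp_nonneg (√a • X) S)
    rw [abs_le]
    constructor <;> linarith
  refine (Finset.sum_le_sum fun S _ => habs S).trans (le_of_eq ?_)
  rw [Finset.sum_sub_distrib, Finset.sum_sub_distrib, ← Finset.mul_sum, ← Finset.mul_sum, sum_dpp,
    sum_dpp]
  ring

/-- The smaller of `t` and 1 serves as `a`. It is at least 3/4, and replacing `1 + a λ` by `1 + λ`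
costs the factor 4/3. -/
theorem tvDist_le {X : Matrix (Fin n) (Fin d) ℝ} {t η : ℝ} (hη : η ≤ 1 / 4) (h1 : 1 - η ≤ t)
    (h2 : t ≤ 1 + η) : tvDist (dpp (√t • X)) (dpp X) ≤ 4 / 3 * (η * dppSize X) := by
  obtain ⟨lam, hl, hdet, -⟩ := exists_eigenvalues (transpose_mul_self_posSemidef X)
  have hη0 : 0 ≤ η := by linarith
  have key : ∀ a b : ℝ, 3 / 4 ≤ a → a ≤ b → b - a ≤ η →
      1 / 2 * ∑ S, |dpp (√a • X) S - dpp (√b • X) S| ≤ 4 / 3 * (η * dppSize X) := by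
    intro a b ha hab hbη
    have h3 := sum_abs_sub_le hl hdet (by linarith : 0 < a) hab
    have h4 : ∑ i, lam i / (1 + a * lam i) ≤ 4 / 3 * dppSize X := by
      rw [dppSize_eq X hl hdet, Finset.mul_sum]
      refine Finset.sum_le_sum fun i _ => ?_
      have h5 := hl i
      have h6 := mul_le_mul_of_nonneg_right ha h5
      rw [mul_div_assoc', div_le_div_iff₀ (by linarith) (by linarith)]
      nlinarith
    have h7 : 0 ≤ ∑ i, lam i / (1 + a * lam i) := Finset.sum_nonneg fun i _ =>
      div_nonneg (hl i) (by nlinarith [hl i])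
    have h8 : (b - a) * ∑ i, lam i / (1 + a * lam i) ≤ η * (4 / 3 * dppSize X) :=
      mul_le_mul hbη h4 h7 hη0
    linarith
  unfold tvDist
  rcases le_total t 1 with h | h
  · have := key t 1 (by linarith) h (by linarith)
    simpa using this
  · have := key 1 t (by linarith) h (by linarith)
    simpa [abs_sub_comm] using this

theorem abs_dppSize_sub_le {X : Matrix (Fin n) (Fin d) ℝ} {t η : ℝ} (ht : 0 < t) (h1 : 1 - η ≤ t)
    (h2 : t ≤ 1 + η) : |dppSize (√t • X) - dppSize X| ≤ η * dppSize X := by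
  obtain ⟨lam, hl, hdet, -⟩ := exists_eigenvalues (transpose_mul_self_posSemidef X)
  rw [dppSize_smul X hl hdet (Real.sqrt_pos.2 ht).ne', dppSize_eq X hl hdet, Real.sq_sqrt ht.le,
    ← Finset.sum_sub_distrib, Finset.mul_sum]
  refine (Finset.abs_sum_le_sum_abs _ _).trans (Finset.sum_le_sum fun i _ => ?_)
  have h3 := hl i
  have h4 : 1 ≤ 1 + t * lam i := by nlinarith
  have h5 : t * lam i / (1 + t * lam i) - lam i / (1 + lam i) =
      (t - 1) / (1 + t * lam i) * (lam i / (1 + lam i)) := by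
    have : 1 + lam i ≠ 0 := by linarith
    have : 1 + t * lam i ≠ 0 := by linarith
    field_simp
    ring
  have h6 : 0 ≤ lam i / (1 + lam i) := div_nonneg h3 (by linarith)
  rw [h5, abs_mul, abs_of_nonneg h6]
  refine mul_le_mul_of_nonneg_right ?_ h6
  rw [abs_div, abs_of_nonneg (by linarith : 0 ≤ 1 + t * lam i)]
  refine (div_le_self (abs_nonneg _) h4).trans ?_
  rw [abs_le]
  constructor <;> linarith

theorem dppSize_le_dim (X : Matrix (Fin n) (Fin d) ℝ) : dppSize X ≤ d := by
  obtain ⟨lam, hl, hdet, -⟩ := exists_eigenvalues (transpose_mul_self_posSemidef X)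
  rw [dppSize_eq X hl hdet]
  calc ∑ i, lam i / (1 + lam i) ≤ ∑ _i : Fin d, (1 : ℝ) :=
        Finset.sum_le_sum fun i _ => by
          have := hl i
          rw [div_le_one (by linarith)]
          linarith
    _ = d := by simp

end DPP

/-! ### Success probability of a round, and costs of its parts. -/

namespace DPP

open Matrix RandComp Timed

variable {n d : ℕ}

namespace IsAdmissible

variable {X : Matrix (Fin n) (Fin d) ℝ} {A : Matrix (Fin d) (Fin d) ℝ} {lt : Fin n → ℝ} {η : ℝ}

/-- Since `η ≤ 1/4`, `I + A` dominates `(3/4) (I + G)`. Inversion reverses this, and `tr ((I + G)⁻¹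
G)` is the mean size of the DPP. -/
theorem scoreSum_le (h : IsAdmissible X A lt η) : scoreSum X A ≤ 4 / 3 * dppSize X := by
  obtain ⟨lam, hl, hdet, htr⟩ := exists_eigenvalues (transpose_mul_self_posSemidef X)
  have hG := transpose_mul_self_posSemidef X
  have hC : (1 + Xᵀ * X).PosDef := Matrix.PosDef.one.add_posSemidef hG
  have hCu := (isUnit_iff_isUnit_det _).1 hC.isUnit
  have h34 : (0 : ℝ) < 3 / 4 := by norm_num
  have hle : (1 + A - (3 / 4 : ℝ) • (1 + Xᵀ * X)).PosSemidef := by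
    have h1 : 0 ≤ 1 - η - 3 / 4 := by linarith [h.eta_le]
    have h2 : (0 : ℝ) ≤ 1 / 4 := by norm_num
    convert (h.lower.add (hG.smul h1)).add
      ((Matrix.PosSemidef.one (n := Fin d) (R := ℝ)).smul h2) using 1
    module
  have h3 : scoreSum X A ≤ ∑ i, X i ⬝ᵥ ((3 / 4 : ℝ) • (1 + Xᵀ * X))⁻¹ *ᵥ X i :=
    Finset.sum_le_sum fun i _ => dotProduct_inv_le h.posDef (hC.smul h34) hle _
  have hinv : ((3 / 4 : ℝ) • (1 + Xᵀ * X))⁻¹ = (4 / 3 : ℝ) • (1 + Xᵀ * X)⁻¹ := by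
    refine inv_eq_right_inv ?_
    rw [Matrix.smul_mul, Matrix.mul_smul, smul_smul, mul_nonsing_inv _ hCu]
    norm_num
  rw [sum_dotProduct_mulVec, hinv, Matrix.smul_mul, trace_smul, smul_eq_mul] at h3
  have h4 := htr 1 zero_le_one
  simp only [one_smul, one_mul] at h4
  rwa [h4, ← dppSize_eq X hl hdet] at h3

theorem effDim_le (h : IsAdmissible X A lt η) : effDim A ≤ 5 / 3 * sBar X := by
  have h1 := h.effDim_le_mul_scoreSum
  have h2 := h.scoreSum_le
  have h3 := dppSize_le_sBar X
  have h4 := h.scoreSum_pos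
  nlinarith [h.eta_le]

theorem one_le_dim_mul_sBar (h : IsAdmissible X A lt η) : 1 ≤ d * sBar X := by
  have h1 : (1 : ℝ) ≤ d := by exact_mod_cast h.one_le_dim
  nlinarith [one_le_sBar X]

theorem poissonRate_le (h : IsAdmissible X A lt η) : poissonRate A ≤ 5 * (d * sBar X) := by
  have h1 : poissonRate A < 2 * (d : ℝ) * effDim A + 1 := Int.ceil_lt_add_one _
  have h2 : (0 : ℝ) ≤ d := Nat.cast_nonneg d
  have h3 := mul_le_mul_of_nonneg_left h.effDim_le h2
  nlinarith [h.one_le_dim_mul_sBar]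

/-- Bernoulli's inequality; `q ≥ 2 d s` is chosen for this bound. -/
theorem half_le_pow (h : IsAdmissible X A lt η) :
    1 / 2 ≤ (1 - effDim A / poissonRate A) ^ d := by
  have hq := h.effDim_pos.trans h.effDim_lt_poissonRate
  have h1 : (d : ℝ) * (effDim A / poissonRate A) ≤ 1 / 2 := by
    rw [mul_div_assoc', div_le_iff₀ hq]
    linarith [h.le_poissonRate]
  have h2 := one_add_mul_le_pow (a := -(effDim A / poissonRate A))
    (by linarith [h.one_sub_pos]) d
  rw [← sub_eq_add_neg] at h2
  linarith

/-- The tangent bound at `P = I + t G`. Its exponent `tr (P⁻¹ (A - t G))` is at most `(1 + η - t) tr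
(P⁻¹ G) ≤ 2 η (4/3) s̄ ≤ 2/3`, by the upper Loewner bound on `A`. -/
theorem det_le_two_mul (h : IsAdmissible X A lt η) :
    (1 + A).det ≤ 2 * (1 + (effDim A / scoreSum X A) • (Xᵀ * X)).det := by
  obtain ⟨lam, hl, hdet, htr⟩ := exists_eigenvalues (transpose_mul_self_posSemidef X)
  have hG := transpose_mul_self_posSemidef X
  have ht := h.ratio_pos
  have ht1 := h.ratio_lower
  have ht2 := h.ratio_upper
  have hη := h.eta_le
  set t := effDim A / scoreSum X A with htdef
  have hP : (1 + t • (Xᵀ * X)).PosDef := Matrix.PosDef.one.add_posSemidef (hG.smul ht.le)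
  have hPu := (isUnit_iff_isUnit_det _).1 hP.isUnit
  have h1 := det_le_det_mul_exp hP h.posDef.posSemidef
  have h2 := trace_mul_nonneg hP.inv.posSemidef h.upper
  have h3 : ((1 + t • (Xᵀ * X))⁻¹ * (1 + A)).trace - d =
      (1 + η - t) * ∑ i, lam i / (1 + t * lam i) -
        ((1 + t • (Xᵀ * X))⁻¹ * ((1 + η) • (Xᵀ * X) - A)).trace := by
    have e : 1 + A = (1 + t • (Xᵀ * X)) + (1 + η - t) • (Xᵀ * X) -
        ((1 + η) • (Xᵀ * X) - A) := by module
    rw [e, Matrix.mul_sub, Matrix.mul_add, nonsing_inv_mul _ hPu, Matrix.mul_smul, trace_sub,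
      trace_add, trace_smul, htr t ht.le, trace_one, Fintype.card_fin, smul_eq_mul]
    ring
  have h4 : ∑ i, lam i / (1 + t * lam i) ≤ 4 / 3 * dppSize X := by
    rw [dppSize_eq X hl hdet, Finset.mul_sum]
    refine Finset.sum_le_sum fun i _ => ?_
    have h5 := hl i
    have h6 := mul_le_mul_of_nonneg_right (by linarith : 3 / 4 ≤ t) h5
    rw [mul_div_assoc', div_le_div_iff₀ (by linarith) (by linarith)]
    nlinarith
  have h5 : 0 ≤ ∑ i, lam i / (1 + t * lam i) := Finset.sum_nonneg fun i _ =>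
    div_nonneg (hl i) (by nlinarith [hl i])
  have h6 : (1 + η - t) * ∑ i, lam i / (1 + t * lam i) ≤ (2 * η) * (4 / 3 * sBar X) :=
    mul_le_mul (by linarith) (h4.trans (by linarith [dppSize_le_sBar X])) h5
      (by linarith [h.eta_nonneg])
  have h7 := h.eta_mul_sBar_le
  -- Equivalent to `e² ≤ 8` after cubing.
  have h8 : Real.exp (2 / 3) ≤ 2 := by
    refine le_of_pow_le_pow_left₀ (n := 3) (by norm_num) (by norm_num) ?_
    rw [← Real.exp_nat_mul]
    have h9 := Real.exp_one_lt_d9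
    have h10 : Real.exp ((3 : ℕ) * (2 / 3)) = Real.exp 1 ^ 2 := by
      rw [← Real.exp_nat_mul]
      norm_num
    rw [h10]
    nlinarith [Real.exp_pos 1]
  rw [Fintype.card_fin] at h1
  have h9 : Real.exp (((1 + t • (Xᵀ * X))⁻¹ * (1 + A)).trace - d) ≤ 2 := by
    refine le_trans (Real.exp_le_exp.2 ?_) h8
    rw [h3]
    linarith
  exact (h1.trans (mul_le_mul_of_nonneg_left h9 hP.det_pos.le)).trans_eq (mul_comm _ _)

/-- Every round of the main loop succeeds with probability at least `1 / 4`. -/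
theorem quarter_le_expect_one_round_some (h : IsAdmissible X A lt η) :
    ENNReal.ofReal (1 / 4) ≤ expect 1 (inputRound X A lt) (fun r => r.elim 0 fun _ => 1) := by
  have hD := h.posDef.det_pos
  have h1 := h.half_le_pow
  have h2 := h.det_le_two_mul
  rw [h.expect_one_round_some, ← ENNReal.ofReal_mul (div_nonneg (by linarith) hD.le)]
  refine ENNReal.ofReal_le_ofReal ?_
  rw [div_mul_eq_mul_div, le_div_iff₀ hD]
  nlinarith

end IsAdmissible

theorem expect_dppStep_le {k : ℕ} {z : ℝ≥0∞} (hz : 1 ≤ z) (W : Matrix (Fin d) (Fin d) ℝ)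
    (S : Finset (Fin k)) (t : Fin k) (y : Fin d → ℝ)
    {f : Matrix (Fin d) (Fin d) ℝ × Finset (Fin k) → ℝ≥0∞} {M : ℝ≥0∞} (hf : ∀ r, f r ≤ M) :
    expect z (dppStep W S t y) f ≤ z ^ (6 * d ^ 2 + 4 * d + 2) * M := by
  rw [dppStep, expect_bind, expect_lift, expect_bind, expect_lift, expect_bind]
  have h1 : ∀ b : Bool, expect z (if b then
      lift (subOuter W (Timed.mulVec W y).val (Timed.mulVec W y).val (dot y (Timed.mulVec W y).val).val) >>=
        fun W' => (pure (W', insert t S) : RandComp _)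
      else lift (Timed.sub (dot y (Timed.mulVec W y).val).val 1) >>= fun c =>
        lift (subOuter W (Timed.mulVec W y).val (Timed.mulVec W y).val c) >>=
        fun W' => (pure (W', S) : RandComp _)) f ≤ z ^ (d * (4 * d + 1) + 1) * M := by
    intro b
    cases b with
    | true =>
      simp only [if_true, expect_bind, expect_lift, expect_pure, time_subOuter]
      refine mul_le_mul' (pow_le_pow_right₀ hz (by omega)) (hf _)
    | false =>
      simp only [Bool.false_eq_true, if_false, expect_bind, expect_lift, expect_pure,
        time_subOuter, time_sub]
      rw [← mul_assoc, ← pow_add, add_comm 1]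
      exact mul_le_mul' le_rfl (hf _)
  refine (mul_le_mul' le_rfl (mul_le_mul' le_rfl (expect_bernoulli_le _ h1))).trans
    (le_of_eq ?_)
  rw [time_mulVec, time_dot]
  ring

theorem expect_foldlM_dppStep_le {k : ℕ} {z : ℝ≥0∞} (hz : 1 ≤ z) (Y : Fin k → Fin d → ℝ)
    (l : List (Fin k)) (r : Matrix (Fin d) (Fin d) ℝ × Finset (Fin k)) :
    expect z (l.foldlM (fun s t => dppStep s.1 s.2 t (Y t)) r) (fun _ => 1) ≤
      z ^ (l.length * (6 * d ^ 2 + 4 * d + 2)) := by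
  induction l generalizing r with
  | nil => rw [List.foldlM_nil, expect_pure]; simp
  | cons t l ih =>
    rw [List.foldlM_cons, expect_bind]
    refine (expect_dppStep_le hz _ _ _ _ fun r => ih r).trans (le_of_eq ?_)
    rw [← pow_add, List.length_cons]
    ring

theorem expect_dppSample_le {k : ℕ} {z : ℝ≥0∞} (hz : 1 ≤ z) (hd : 1 ≤ d)
    (Y : Matrix (Fin k) (Fin d) ℝ) :
    expect z (dppSample Y) (fun _ => 1) ≤ z ^ (30 * d ^ 2 * (k + 1)) := by
  rw [dppSample, expect_bind, expect_lift, expect_bind]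
  simp only [expect_pure]
  refine (mul_le_mul' le_rfl (expect_foldlM_dppStep_le hz (fun t => Y t) _ _)).trans ?_
  rw [List.length_finRange, ← pow_add]
  refine pow_le_pow_right₀ hz ?_
  have h1 : (invDet (fun t => Y t) fun t => Y t).time =
    d * (d + 1) + k * (8 * d ^ 2 + 5 * d + 2) := time_invDet _ _
  refine (Nat.add_le_add_right h1.le _).trans ?_
  have h2 : d ≤ d ^ 2 := Nat.le_self_pow two_ne_zero d
  have h3 : 1 ≤ d ^ 2 := hd.trans h2
  have h4 := Nat.mul_le_mul_left k h2
  have h5 := Nat.mul_le_mul_left k h3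
  nlinarith

/-- The bound on `f` is required only at results of length `K`, because the cost of the final step,
for which `f` will stand, grows with `K`. -/
theorem expect_roundTail_le {K : ℕ} {z : ℝ≥0∞} (hz : 1 ≤ z) (hd : 1 ≤ d)
    (X : Matrix (Fin n) (Fin d) ℝ) (D s q : ℝ) (smp : Fin K → Fin n × ℝ)
    {f : Option ((K : ℕ) × (Fin K → Fin n) × Matrix (Fin K) (Fin d) ℝ) → ℝ≥0∞} {M : ℝ≥0∞}
    (hs : ∀ Y, f (some ⟨K, fun t => (smp t).1, Y⟩) ≤ M) (hn : f none ≤ M) :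
    expect z (roundTail X D s q smp) f ≤ z ^ (23 * d ^ 2 * (K + 1)) * M := by
  simp only [roundTail, expect_bind, expect_lift, expect_pure, time_rescaledRows, time_constC,
    time_mul, time_div]
  have h1 : ∀ Y : Fin K → Fin d → ℝ, (invDet Y Y).time =
    d * (d + 1) + K * (8 * d ^ 2 + 5 * d + 2) := fun Y => time_invDet _ _
  refine (mul_le_mul' le_rfl (mul_le_mul' (pow_le_pow_right₀ hz (h1 _).le)
    (mul_le_mul' le_rfl (mul_le_mul' le_rfl (mul_le_mul' le_rfl
    (expect_bernoulli_le (M := M) _ ?_)))))).trans ?_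
  · intro b
    cases b
    · exact hn
    · exact hs _
  · simp only [← mul_assoc, ← pow_add, ← pow_succ]
    refine mul_le_mul' (pow_le_pow_right₀ hz ?_) le_rfl
    have h2 : d ≤ d ^ 2 := Nat.le_self_pow two_ne_zero d
    have h3 : 1 ≤ d ^ 2 := hd.trans h2
    have h4 := Nat.mul_le_mul_left K h2
    have h5 := Nat.mul_le_mul_left K h3
    nlinarith

/-- The moment generating function of a Poisson variable. -/
theorem tsum_poisson_mul_pow {q h : ℝ} (hq : 0 ≤ q) (hh : 0 ≤ h) :
    ∑' K : ℕ, ProbabilityTheory.poissonMeasure q.toNNReal {K} * ENNReal.ofReal h ^ K =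
      ENNReal.ofReal (Real.exp (q * (h - 1))) := by
  -- Tilting by `h ^ K` gives a multiple of the Poisson law with mean `q h`.
  have h1 : ∀ K : ℕ, ProbabilityTheory.poissonMeasure q.toNNReal {K} * ENNReal.ofReal h ^ K =
      ENNReal.ofReal (Real.exp (q * (h - 1))) *
        (ProbabilityTheory.poissonMeasure (q * h).toNNReal {K}) := by
    intro K
    rw [ProbabilityTheory.poissonMeasure_singleton, ProbabilityTheory.poissonMeasure_singleton,
      Real.coe_toNNReal _ hq, Real.coe_toNNReal _ (mul_nonneg hq hh), ← ENNReal.ofReal_pow hh,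
      ← ENNReal.ofReal_mul (by positivity), ← ENNReal.ofReal_mul (by positivity)]
    congr 1
    have h2 : Real.exp (q * (h - 1)) = Real.exp (q * h) * Real.exp (-q) := by
      rw [← Real.exp_add]; ring_nf
    have h3 : Real.exp (-(q * h)) * Real.exp (q * h) = 1 := by
      rw [← Real.exp_add]; simp
    rw [h2, mul_pow]
    linear_combination (-(Real.exp (-q) * q ^ K * h ^ K / K.factorial)) * h3
  simp_rw [h1, ENNReal.tsum_mul_left, tsum_poisson, mul_one]

theorem exp_le_one_add_two_mul {x : ℝ} (h0 : 0 ≤ x) (h1 : x ≤ 1 / 2) :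
    Real.exp x ≤ 1 + 2 * x := by
  have h2 := Real.exp_bound_div_one_sub_of_interval h0 (by linarith : x < 1)
  refine h2.trans ?_
  rw [div_le_iff₀ (by linarith)]
  nlinarith

theorem ofReal_exp_pow (x : ℝ) (m : ℕ) :
    ENNReal.ofReal (Real.exp x) ^ m = ENNReal.ofReal (Real.exp (m * x)) := by
  rw [← ENNReal.ofReal_pow (Real.exp_pos x).le, Real.exp_nat_mul]

end DPP

/-! ### Exponential moments and the tail of the running time. -/

namespace DPP

open Matrix RandComp Timed

variable {n d : ℕ}

namespace IsAdmissible

variable {X : Matrix (Fin n) (Fin d) ℝ} {A : Matrix (Fin d) (Fin d) ℝ} {lt : Fin n → ℝ} {η : ℝ}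

/-- The time of rejection sampling has an exponential moment of order `1 / d ^ 2`. -/
theorem expect_rowSample_le (h : IsAdmissible X A lt η) {θ : ℝ} (h0 : 0 ≤ θ)
    (h1 : θ * d ^ 2 ≤ 1 / 90) :
    expect (ENNReal.ofReal (Real.exp θ)) (rowSample X lt (1 + A)⁻¹) (fun _ => 1) ≤
      ENNReal.ofReal (Real.exp (90 * (θ * d ^ 2))) := by
  have := h.neZero
  have hL := h.scoreSum_pos
  have hΛ1 : scoreSum X A / 2 ≤ ∑ j, lt j := by
    rw [scoreSum, Finset.sum_div]
    exact Finset.sum_le_sum fun i _ => by linarith [h.oracle_lower i]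
  have hΛ2 : ∑ j, lt j ≤ 3 / 2 * scoreSum X A := by
    rw [scoreSum, Finset.mul_sum]
    exact Finset.sum_le_sum fun i _ => h.oracle_upper i
  have hΛ : 0 < ∑ j, lt j := by linarith
  -- The acceptance probability of a trial; the bounds on `lt` place it in `[1/3, 1]`.
  set p := scoreSum X A / (2 * ∑ j, lt j) with hp
  have hp1 : p ≤ 1 := by rw [hp, div_le_one (by linarith)]; linarith
  have hp2 : 1 / 3 ≤ p := by rw [hp, le_div_iff₀ (by linarith)]; linarith
  have hd : (1 : ℝ) ≤ d := by exact_mod_cast h.one_le_dim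
  set u := Real.exp ((2 * d ^ 2 + 3 * d + 4 : ℕ) * θ) with hu
  set v := 9 * (θ * d ^ 2) with hv
  have hv0 : 0 ≤ v := by positivity
  have hv1 : v ≤ 1 / 10 := by linarith
  have hle : ((2 * d ^ 2 + 3 * d + 4 : ℕ) : ℝ) * θ ≤ v := by
    push_cast
    rw [hv]
    nlinarith [mul_nonneg h0 (by nlinarith : (0 : ℝ) ≤ 9 * d ^ 2 - (2 * d ^ 2 + 3 * d + 4))]
  have hu1 : u ≤ 1 + 2 * v :=
    (Real.exp_le_exp.2 hle).trans (exp_le_one_add_two_mul hv0 (by linarith))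
  have hu0 : 0 < u := Real.exp_pos _
  have hden : 0 < 1 - u * (1 - p) := by nlinarith
  have hmain : u * p / (1 - u * (1 - p)) ≤ Real.exp (90 * (θ * d ^ 2)) := by
    have h2 : 1 + 10 * v ≤ Real.exp (90 * (θ * d ^ 2)) := by
      have := Real.add_one_le_exp (90 * (θ * (d : ℝ) ^ 2))
      linarith
    refine le_trans ?_ h2
    rw [div_le_iff₀ hden]
    -- After clearing the denominator the claim reads `u (1 + 10 v (1 - p)) ≤ 1 + 10 v`. With `1 - p
    -- ≤ 2/3` and `u ≤ 1 + 2 v` it holds precisely because `v ≤ 1/10`.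
    have h3 : u * (1 + 10 * v * (1 - p)) ≤ (1 + 2 * v) * (1 + 10 * v * (2 / 3)) := by
      refine mul_le_mul hu1 ?_ ?_ (by linarith)
      · nlinarith
      · nlinarith [mul_nonneg hv0 (sub_nonneg.2 hp1)]
    nlinarith
  have hscore : ∑ i, ENNReal.ofReal ((X i ⬝ᵥ (1 + A)⁻¹ *ᵥ X i) / (2 * ∑ j, lt j)) =
      ENNReal.ofReal p := by
    rw [← ENNReal.ofReal_sum_of_nonneg fun i _ => div_nonneg (h.score_pos i).le (by linarith),
      ← Finset.sum_div]
    rfl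
  have hsome : expect (ENNReal.ofReal (Real.exp θ)) (rowTrial X lt (1 + A)⁻¹)
      (fun r => r.elim 0 fun _ => 1) = ENNReal.ofReal (u * p) := by
    rw [expect_rowTrial_some h.score_pos h.score_le, ofReal_exp_pow, ENNReal.ofReal_mul hu0.le]
    simp only [mul_one]
    rw [hscore]
  have hnone : expect (ENNReal.ofReal (Real.exp θ)) (rowTrial X lt (1 + A)⁻¹)
      (fun r => r.elim 1 fun _ => 0) = ENNReal.ofReal (u * (1 - p)) := by
    rw [expect_rowTrial_none h.score_pos h.score_le, ofReal_exp_pow, ENNReal.ofReal_mul hu0.le]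
    rfl
  rw [rowSample_eq, expect_loop, hsome, hnone, ← ENNReal.ofReal_one,
    ← ENNReal.ofReal_sub _ (mul_nonneg hu0.le (by linarith)), ← div_eq_mul_inv,
    ← ENNReal.ofReal_div_of_pos hden]
  exact ENNReal.ofReal_le_ofReal hmain

/-- The time of a round, including the final step after a successful round, has an exponential
moment of order `1 / (d ^ 3 s̄)`. -/
theorem expect_inputRound_le (h : IsAdmissible X A lt η) {θ : ℝ} (h0 : 0 ≤ θ)
    (h1 : θ * d ^ 2 * (d * sBar X) ≤ 1 / 40000) :
    expect (ENNReal.ofReal (Real.exp θ)) (inputRound X A lt) (fun r => r.elim 1 fun r =>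
      ENNReal.ofReal (Real.exp θ) ^ (30 * d ^ 2 * (r.1 + 1))) ≤ ENNReal.ofReal (9 / 8) := by
  have hd := h.one_le_dim
  have hd' : (1 : ℝ) ≤ d := by exact_mod_cast hd
  have hds := h.one_le_dim_mul_sBar
  have hq0 : 0 < poissonRate A := h.effDim_pos.trans h.effDim_lt_poissonRate
  set z := ENNReal.ofReal (Real.exp θ) with hz
  have hz1 : 1 ≤ z := by
    rw [hz, ENNReal.one_le_ofReal]
    exact Real.one_le_exp h0
  set v := θ * d ^ 2 with hv
  have hv0 : 0 ≤ v := by positivity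
  have hv1 : v ≤ 1 / 40000 := by nlinarith
  have hθv : θ ≤ v := by
    rw [hv]
    nlinarith [mul_nonneg h0 (by nlinarith : (0 : ℝ) ≤ (d : ℝ) ^ 2 - 1)]
  have hrow := h.expect_rowSample_le h0 (by linarith)
  -- The exponent is linear in `K`: the Poisson draw contributes 1, the row samples 90, the rest of
  -- the round 23 and the final step 30, in units of `v`; the total 144 is rounded up to 150.
  have hK : ∀ K : ℕ, z ^ (K + 1) * expect z (replicate (rowSample X lt (1 + A)⁻¹) K >>= fun smp =>
      roundTail X (1 + A).det (effDim A) (poissonRate A) smp) (fun r => r.elim 1 fun r =>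
      z ^ (30 * d ^ 2 * (r.1 + 1))) ≤
      ENNReal.ofReal (Real.exp (150 * v)) ^ K * ENNReal.ofReal (Real.exp (150 * v)) := by
    intro K
    rw [expect_bind]
    have h2 : ∀ smp : Fin K → Fin n × ℝ,
        expect z (roundTail X (1 + A).det (effDim A) (poissonRate A) smp)
          (fun r => r.elim 1 fun r => z ^ (30 * d ^ 2 * (r.1 + 1))) ≤
        z ^ (23 * d ^ 2 * (K + 1)) * z ^ (30 * d ^ 2 * (K + 1)) := fun smp =>
      expect_roundTail_le hz1 hd X _ _ _ smp (fun Y => le_rfl) (one_le_pow₀ hz1)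
    refine (mul_le_mul' le_rfl (expect_mono _ h2)).trans ?_
    rw [expect_const, expect_replicate_one]
    refine (mul_le_mul' le_rfl (mul_le_mul' (pow_le_pow_left₀ zero_le hrow K) le_rfl)).trans ?_
    rw [hz]
    simp only [ofReal_exp_pow]
    simp only [← ENNReal.ofReal_mul (Real.exp_pos _).le, ← Real.exp_add]
    refine ENNReal.ofReal_le_ofReal (Real.exp_le_exp.2 ?_)
    push_cast
    have h3 : (0 : ℝ) ≤ K := Nat.cast_nonneg K
    have h4 : ((K : ℝ) + 1) * θ ≤ (K + 1) * v := by gcongr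
    have h5 : 23 * (d : ℝ) ^ 2 * (K + 1) * θ = 23 * ((K + 1) * v) := by rw [hv]; ring
    have h6 : 30 * (d : ℝ) ^ 2 * (K + 1) * θ = 30 * ((K + 1) * v) := by rw [hv]; ring
    nlinarith [mul_nonneg h3 hv0]
  rw [inputRound, mainRound_eq, expect_bind, expect_poisson]
  have h2 : ∀ K : ℕ, ProbabilityTheory.poissonMeasure (poissonRate A).toNNReal {K} * z ^ (K + 1) *
      expect z (replicate (rowSample X lt (1 + A)⁻¹) K >>= fun smp =>
      roundTail X (1 + A).det (effDim A) (poissonRate A) smp) (fun r => r.elim 1 fun r =>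
      z ^ (30 * d ^ 2 * (r.1 + 1))) ≤
      ProbabilityTheory.poissonMeasure (poissonRate A).toNNReal {K} *
      ENNReal.ofReal (Real.exp (150 * v)) ^ K * ENNReal.ofReal (Real.exp (150 * v)) := fun K => by
    rw [mul_assoc, mul_assoc]
    exact mul_le_mul' le_rfl (hK K)
  refine (ENNReal.tsum_le_tsum h2).trans ?_
  rw [ENNReal.tsum_mul_right, tsum_poisson_mul_pow hq0.le (Real.exp_pos _).le,
    ← ENNReal.ofReal_mul (Real.exp_pos _).le, ← Real.exp_add]
  refine ENNReal.ofReal_le_ofReal ?_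
  have h3 : Real.exp (150 * v) - 1 ≤ 300 * v := by
    linarith [exp_le_one_add_two_mul (by linarith : 0 ≤ 150 * v) (by linarith)]
  -- With `v d s̄ ≤ 1/40000` this is at most `1500 / 40000`, which leaves room for `150 v` below
  -- `1/16`; then `exp (1/16) ≤ 9/8`.
  have h4 : poissonRate A * (Real.exp (150 * v) - 1) ≤ 5 * (d * sBar X) * (300 * v) :=
    mul_le_mul h.poissonRate_le h3 (by linarith [Real.one_le_exp (by linarith : 0 ≤ 150 * v)])
      (by linarith)
  have h5 : poissonRate A * (Real.exp (150 * v) - 1) + 150 * v ≤ 1 / 16 := by nlinarith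
  refine (Real.exp_le_exp.2 h5).trans ?_
  linarith [exp_le_one_add_two_mul (by norm_num : (0 : ℝ) ≤ 1 / 16) (by norm_num)]

/-- The running time has an exponential moment of order `1 / (d ^ 3 s̄)`. -/
theorem expect_fastDPP_le (h : IsAdmissible X A lt η) {θ : ℝ} (h0 : 0 ≤ θ)
    (h1 : θ * d ^ 2 * (d * sBar X) ≤ 1 / 40000) :
    expect (ENNReal.ofReal (Real.exp θ)) (fastDPP X A lt) (fun _ => 1) ≤ 18 := by
  have hd := h.one_le_dim
  have hd' : (1 : ℝ) ≤ d := by exact_mod_cast hd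
  have hround := h.expect_inputRound_le h0 h1
  set z := ENNReal.ofReal (Real.exp θ) with hz
  have hz1 : 1 ≤ z := by
    rw [hz, ENNReal.one_le_ofReal]
    exact Real.one_le_exp h0
  have hα : expect z (inputRound X A lt) (fun r => r.elim 0 fun r =>
      z ^ (30 * d ^ 2 * (r.1 + 1))) ≤ ENNReal.ofReal (9 / 8) := by
    refine (expect_mono _ fun r => ?_).trans hround
    cases r with
    | none => exact zero_le
    | some r => exact le_rfl
  have hβ : expect z (inputRound X A lt) (fun r => r.elim 1 fun _ => 0) ≤
      ENNReal.ofReal (7 / 8) := by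
    -- As `z ≥ 1`, accepted rounds carry weight at least their probability 1/4. Hence at most `9/8 -
    -- 1/4 = 7/8` of the total is left for the rejected ones, and the geometric series converges.
    have h2 : expect z (inputRound X A lt) (fun r => r.elim 1 fun _ => 0) +
        ENNReal.ofReal (1 / 4) ≤ ENNReal.ofReal (9 / 8) := by
      refine (add_le_add le_rfl (h.quarter_le_expect_one_round_some.trans
        (expect_one_le hz1 _ _))).trans ?_
      rw [← expect_add]
      refine (expect_mono _ fun r => ?_).trans hround
      cases r with
      | none => simp
      | some r => simpa using one_le_pow₀ hz1
    have h3 := ENNReal.le_sub_of_add_le_right ENNReal.ofReal_ne_top h2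
    rwa [← ENNReal.ofReal_sub _ (by norm_num), show (9 / 8 - 1 / 4 : ℝ) = 7 / 8 by norm_num] at h3
  have hinv : (1 - expect z (inputRound X A lt) (fun r => r.elim 1 fun _ => 0))⁻¹ ≤
      ENNReal.ofReal 8 := by
    have h2 : ENNReal.ofReal (1 / 8) ≤
        1 - expect z (inputRound X A lt) (fun r => r.elim 1 fun _ => 0) := by
      refine le_trans (le_of_eq ?_) (tsub_le_tsub_left hβ 1)
      rw [← ENNReal.ofReal_one, ← ENNReal.ofReal_sub _ (by norm_num)]
      norm_num
    refine (ENNReal.inv_le_inv.2 h2).trans (le_of_eq ?_)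
    rw [← ENNReal.ofReal_inv_of_pos (by norm_num)]
    norm_num
  have hloop : expect z (loop (inputRound X A lt)) (fun r =>
      expect z (dppSample r.2.2) fun _ => 1) ≤ ENNReal.ofReal 9 := by
    have hsample : ∀ r : (K : ℕ) × (Fin K → Fin n) × Matrix (Fin K) (Fin d) ℝ,
        expect z (dppSample r.2.2) (fun _ => 1) ≤ z ^ (30 * d ^ 2 * (r.1 + 1)) :=
      fun r => expect_dppSample_le (d := d) (k := r.1) hz1 hd r.2.2
    refine (expect_mono _ hsample).trans ?_
    rw [expect_loop]
    refine (mul_le_mul' hα hinv).trans (le_of_eq ?_)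
    rw [← ENNReal.ofReal_mul (by norm_num)]
    norm_num
  have hpre : z ^ (8 * d ^ 3 + 9 * d ^ 2 + 5 * d + 3) ≤ ENNReal.ofReal 2 := by
    rw [hz, ofReal_exp_pow]
    refine ENNReal.ofReal_le_ofReal ?_
    have h2 : ((8 * d ^ 3 + 9 * d ^ 2 + 5 * d + 3 : ℕ) : ℝ) * θ ≤ 1 / 2 := by
      push_cast
      have h3 : θ * (d : ℝ) ^ 3 ≤ 1 / 40000 := by
        refine le_trans ?_ h1
        have h4 : 0 ≤ θ * (d : ℝ) ^ 3 := by positivity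
        have h5 := mul_le_mul_of_nonneg_left (one_le_sBar X) h4
        nlinarith
      have h6 : (d : ℝ) ^ 2 ≤ d ^ 3 := pow_le_pow_right₀ hd' (by norm_num)
      have h7 : (d : ℝ) ≤ d ^ 3 := le_self_pow₀ hd' (by norm_num)
      have h8 : (1 : ℝ) ≤ d ^ 3 := one_le_pow₀ hd'
      have h9 : (8 * (d : ℝ) ^ 3 + 9 * d ^ 2 + 5 * d + 3) * θ ≤ (25 * d ^ 3) * θ := by
        refine mul_le_mul_of_nonneg_right ?_ h0
        linarith
      nlinarith
    refine (Real.exp_le_exp.2 h2).trans ?_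
    linarith [exp_le_one_add_two_mul (by norm_num : (0 : ℝ) ≤ 1 / 2) le_rfl]
  rw [h.expect_fastDPP]
  refine (mul_le_mul' hpre hloop).trans (le_of_eq ?_)
  rw [← ENNReal.ofReal_mul (by norm_num)]
  norm_num

/-- Markov's inequality at `θ = 1 / M`. The exponential moment would give a threshold of order `M
log (1/δ)`; the square dominates it because `log (1/δ) ≥ log 2`. -/
theorem one_sub_le_haltsWithin (h : IsAdmissible X A lt η) {δ : ℝ} (hδ0 : 0 < δ)
    (hδ : δ ≤ 1 / 2) :
    ENNReal.ofReal (1 - δ) ≤ (fastDPP X A lt).haltsWithin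
      (800000 * (d : ℝ) ^ 3 * sBar X * Real.log (1 / δ) ^ 2) := by
  have hd' : (1 : ℝ) ≤ d := by exact_mod_cast h.one_le_dim
  have hs := one_le_sBar X
  set x := Real.log (1 / δ) with hx
  have hx0 : 0.69 ≤ x := by
    have h1 : Real.log 2 ≤ x := Real.log_le_log (by norm_num) (by
      rw [le_div_iff₀ hδ0]; linarith)
    linarith [Real.log_two_gt_d9]
  have hM : (1 : ℝ) ≤ 40000 * d ^ 3 * sBar X := by
    have := one_le_pow₀ (n := 3) hd'
    nlinarith
  set M := 40000 * (d : ℝ) ^ 3 * sBar X with hMdef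
  set θ := 1 / M with hθ
  have hθ0 : 0 ≤ θ := by positivity
  have hθ1 : θ * d ^ 2 * (d * sBar X) ≤ 1 / 40000 := by
    rw [hθ, hMdef]
    refine le_of_eq ?_
    field_simp
  have hB : 800000 * (d : ℝ) ^ 3 * sBar X * x ^ 2 = 20 * x ^ 2 * M := by
    rw [hMdef]; ring
  rw [hB]
  set m := ⌊20 * x ^ 2 * M⌋₊ with hm
  have hm1 : (m : ℝ) ≤ 20 * x ^ 2 * M := Nat.floor_le (by positivity)
  have hm2 : 20 * x ^ 2 * M < m + 1 := Nat.lt_floor_add_one _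
  have hz1 : 1 ≤ ENNReal.ofReal (Real.exp θ) := by
    rw [ENNReal.one_le_ofReal]
    exact Real.one_le_exp hθ0
  have hone : expect 1 (fastDPP X A lt) (fun _ => 1) = 1 := by
    rw [h.expect_one_fastDPP]
    simp only [mul_one]
    rw [← ENNReal.ofReal_sum_of_nonneg fun S _ => dpp_nonneg _ S, sum_dpp, ENNReal.ofReal_one]
  have h2 := one_le_haltsWithin_add (fastDPP X A lt) _ hz1 m hm1 hone
  have h3 := h2.trans (add_le_add le_rfl (h.expect_fastDPP_le hθ0 hθ1))
  have h4 : (18 : ℝ≥0∞) ≤ ENNReal.ofReal (Real.exp θ) ^ m * ENNReal.ofReal δ := by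
    rw [ofReal_exp_pow, ← ENNReal.ofReal_mul (Real.exp_pos _).le,
      show (18 : ℝ≥0∞) = ENNReal.ofReal 18 by norm_num]
    refine ENNReal.ofReal_le_ofReal ?_
    have h5 : δ = Real.exp (-x) := by
      rw [hx, one_div, Real.log_inv, neg_neg, Real.exp_log hδ0]
    rw [h5, ← Real.exp_add]
    -- Rounding the time bound down to the integer `m` loses at most 1, and `θ ≤ 1`.
    have h6 : 20 * x ^ 2 - 1 ≤ m * θ := by
      have h7 : (20 * x ^ 2 * M - 1) * θ ≤ m * θ :=
        mul_le_mul_of_nonneg_right (by linarith) hθ0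
      have h8 : M * θ = 1 := by rw [hθ]; field_simp
      have h9 : θ ≤ 1 := by rw [hθ, div_le_one (by linarith)]; exact hM
      have h10 : (20 * x ^ 2 * M - 1) * θ = 20 * x ^ 2 * (M * θ) - θ := by ring
      rw [h10, h8] at h7
      linarith
    have h11 : (3 : ℝ) ≤ m * θ + -x := by nlinarith
    refine le_trans ?_ (Real.exp_le_exp.2 h11)
    have h12 := Real.exp_one_gt_d9
    have h13 : Real.exp 3 = Real.exp 1 ^ 3 := by
      rw [← Real.exp_nat_mul]; norm_num
    rw [h13]
    calc (18 : ℝ) ≤ 2.7 ^ 3 := by norm_num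
      _ ≤ Real.exp 1 ^ 3 := by gcongr; linarith
  have h14 := h3.trans (add_le_add le_rfl h4)
  rw [← mul_add] at h14
  have hzm : ENNReal.ofReal (Real.exp θ) ^ m ≠ 0 :=
    pow_ne_zero _ (by simpa using Real.exp_pos θ)
  have hzm' : ENNReal.ofReal (Real.exp θ) ^ m ≠ ⊤ := ENNReal.pow_ne_top ENNReal.ofReal_ne_top
  have h15 : 1 ≤ (fastDPP X A lt).haltsWithin (20 * x ^ 2 * M) + ENNReal.ofReal δ := by
    rwa [← ENNReal.mul_le_mul_iff_right hzm hzm', mul_one]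
  rw [ENNReal.ofReal_sub _ hδ0.le, ENNReal.ofReal_one]
  exact tsub_le_iff_right.2 h15

end IsAdmissible

/-- The hypotheses of the theorem make the input admissible. -/
theorem isAdmissible_eta {X : Matrix (Fin n) (Fin d) ℝ} {A : Matrix (Fin d) (Fin d) ℝ}
    {lt : Fin n → ℝ} {ε C : ℝ} (hn : 0 < n) (hX : ∀ i, X i ≠ 0)
    (hη0 : 0 ≤ eta X ε C) (hη : eta X ε C * sBar X ≤ 1 / 4)
    (hlo : (A - (1 - eta X ε C) • (Xᵀ * X)).PosSemidef)
    (hup : ((1 + eta X ε C) • (Xᵀ * X) - A).PosSemidef)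
    (hlt : ∀ i, 1 / 2 * ridgeScore X A i ≤ lt i ∧ lt i ≤ 3 / 2 * ridgeScore X A i) :
    IsAdmissible X A lt (eta X ε C) :=
  ⟨hn, hX, hη0, hη, hlo, hup, fun i => (hlt i).1, fun i => (hlt i).2⟩

theorem eta_nonneg_and_mul_sBar_le (X : Matrix (Fin n) (Fin d) ℝ) {ε C : ℝ} (hε0 : 0 ≤ ε)
    (hε1 : ε ≤ 1) (hC : 0 ≤ C) : 0 ≤ eta X ε C ∧ eta X ε C * sBar X ≤ ε / 4 := by
  have hs := one_le_sBar X
  -- For `ε = 0` the numerator of `eta` vanishes, whatever the value of `log (9 / 0)`.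
  rcases hε0.eq_or_lt with rfl | hε
  · simp [eta]
  have hlog : 0 ≤ C * Real.log (9 / ε) := by
    refine mul_nonneg hC (Real.log_nonneg ?_)
    rw [le_div_iff₀ hε]
    linarith
  have hden : 0 < 4 * sBar X + C * Real.log (9 / ε) := by linarith
  refine ⟨div_nonneg hε0 hden.le, ?_⟩
  rw [eta, div_mul_eq_mul_div, div_le_iff₀ hden]
  nlinarith

end DPP

end

theorem theorem1 :
    (∀ (k d : ℕ) (Y : Matrix (Fin k) (Fin d) ℝ) (S : Finset (Fin k)),
      (DPP.dppSample Y).law S = ENNReal.ofReal (DPP.dpp Y S)) ∧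
    ∃ C₀ c : ℝ, 0 ≤ C₀ ∧ 0 < c ∧
      ∀ (n d : ℕ) (X : Matrix (Fin n) (Fin d) ℝ) (A : Matrix (Fin d) (Fin d) ℝ)
        (lt : Fin n → ℝ) (ε C : ℝ),
        0 < n → (∀ i, X i ≠ 0) → 0 ≤ ε → ε ≤ 1 → 0 ≤ C →
        (A - (1 - DPP.eta X ε C) • (X.transpose * X)).PosSemidef →
        ((1 + DPP.eta X ε C) • (X.transpose * X) - A).PosSemidef →
        (∀ i, 1 / 2 * DPP.ridgeScore X A i ≤ lt i ∧ lt i ≤ 3 / 2 * DPP.ridgeScore X A i) →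
        DPP.sBar X ≤ d ∧
        (∃ ρ : ℝ, |ρ - 1| ≤ DPP.eta X ε C ∧
          ∀ S, (DPP.fastDPP X A lt).law S = ENNReal.ofReal (DPP.dpp (ρ • X) S)) ∧
        |∑ S : Finset (Fin n), (S.card : ℝ) * ((DPP.fastDPP X A lt).law S).toReal
            - DPP.dppSize X| ≤ ε ∧
        (C₀ ≤ C →
          DPP.tvDist (fun S => ((DPP.fastDPP X A lt).law S).toReal) (DPP.dpp X) ≤ ε) ∧
        ∀ δ : ℝ, 0 < δ → δ ≤ 1 / 2 →
          ENNReal.ofReal (1 - δ) ≤ (DPP.fastDPP X A lt).haltsWithin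
            (c * (d : ℝ) ^ 3 * DPP.sBar X * Real.log (1 / δ) ^ 2) := by
  -- `C₀ = 0` suffices: the term `4 s̄` in the denominator of `η` already gives `η s̄ ≤ ε / 4`.
  refine ⟨fun k d Y S => DPP.law_dppSample Y S, 0, 800000, le_rfl, by norm_num, ?_⟩
  intro n d X A lt ε C hn hX hε0 hε1 hC hlo hup hlt
  obtain ⟨hη0, hη⟩ := DPP.eta_nonneg_and_mul_sBar_le X hε0 hε1 hC
  have h := DPP.isAdmissible_eta hn hX hη0 (by linarith) hlo hup hlt
  have hlaw : (fun S => ((DPP.fastDPP X A lt).law S).toReal) =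
      DPP.dpp (√(DPP.effDim A / DPP.scoreSum X A) • X) := by
    funext S
    rw [h.law_fastDPP, ENNReal.toReal_ofReal (DPP.dpp_nonneg _ S)]
  have hsize : DPP.eta X ε C * DPP.dppSize X ≤ ε / 4 :=
    (mul_le_mul_of_nonneg_left (DPP.dppSize_le_sBar X) hη0).trans hη
  refine ⟨max_le (by exact_mod_cast h.one_le_dim) (DPP.dppSize_le_dim X),
    ⟨_, h.abs_sqrt_sub_one_le, h.law_fastDPP⟩, ?_, fun _ => ?_,
    fun δ hδ0 hδ => h.one_sub_le_haltsWithin hδ0 hδ⟩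
  · have h1 : ∑ S : Finset (Fin n), (S.card : ℝ) * ((DPP.fastDPP X A lt).law S).toReal =
        DPP.dppSize (√(DPP.effDim A / DPP.scoreSum X A) • X) :=
      Finset.sum_congr rfl fun S _ => congrArg _ (congrFun hlaw S)
    rw [h1]
    exact (DPP.abs_dppSize_sub_le h.ratio_pos h.ratio_lower h.ratio_upper).trans (by linarith)
  · rw [hlaw]
    -- The bound is `(4/3) (ε / 4) = ε / 3`.
    exact (DPP.tvDist_le h.eta_le h.ratio_lower h.ratio_upper).trans (by linarith)
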